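/- Let $n\ge 1$, $p\ge 0$, $L=\mathbf Z^{n-1}$, and let $P\subseteq L_{\mathbf R}$ be an $(n-1)$-dimensional polytope with a Minkowski decomposition $P=R_0+\cdots+R_p$ into non-empty lattice polytopes $R_k\subseteq L_{\mathbf R}$. Let $N'=L\oplus\mathbf Z^{p+1}$ with $e_0,\dots,e_p$ the standard basis of $\mathbf Z^{p+1}$, let $M'=\mathrm{Hom}(N',\mathbf Z)$, and let $\tilde\sigma\subseteq N'_{\mathbf R}$ be the cone generated by $\bigcup_{k}R_k\times\{e_k\}$. Let $Y_{\tilde\sigma}=\mathrm{Spec}\,\mathbf C[\tilde\sigma^\vee\cap M']$ be the affine toric variety of dimension $n+p$ with dense torus $T_{\mathbf C}(N')=N'\otimes_{\mathbf Z}\mathbf C^*$. Let $t_k$ be the regular function on $Y_{\tilde\sigma}$ given by the character $e_k^*$, and let $f:Y_{\tilde\sigma}\to\mathbf C^{p+1}/\mathbf C(1,\dots,1)$ be the map induced by $(t_0,\dots,t_p)$, i.e. $f=(t_0-t_1,\dots,t_0-t_p)$. For $x\in\mathbf C^{p+1}/\mathbf C(1,\dots,1)$ write $Y^{ns}_{\tilde\sigma,x}$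 for the non-singular part of the fibre $f^{-1}(x)$. There is a nowhere vanishing algebraic $(n+p)$-form on the non-singular part of $Y_{\tilde\sigma}$. Let $\Omega$ be any such form. Then: 1. For every $x$, the points of $Y^{ns}_{\tilde\sigma,x}$ are non-singular points of $Y_{\tilde\sigma}$, and at these points the vectors $\partial_{t_1},\dots,\partial_{t_p}$ of $\mathbf C^{p+1}/\mathbf C(1,\dots,1)$ lift along $df$ to tangent vectors of $Y_{\tilde\sigma}$. The form $$\Omega_x=\bigl(\iota(\partial_{t_1},\dots,\partial_{t_p})\Omega\bigr)\big|_{f^{-1}(x)}$$ does not depend on the lifts, and it is a nowhere vanishing holomorphic (indeed algebraic) $n$-form on $Y^{ns}_{\tilde\sigma,x}$. 2. $\Omega_x$ is invariant under the action of $T_{\mathbf C}(L)=L\otimes_{\mathbf Z}\mathbf C^*$ on $Y^{ns}_{\tilde\sigma,x}$, in particular under the compact torus $T(L)=L\otimes_{\mathbf Z}\mathbf R/L$. 3. Let $z_1,\dots,z_{n-1}$ be a basis of the characters of $T_{\mathbf C}(L)$. Then $z_1,\dots,z_{n-1},t_0,\dots,t_p$ form a basis of the characters of $T_{\mathbf C}(N')$.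 The torus $T_{\mathbf C}(N')$ lies in the non-singular part of $Y_{\tilde\sigma}$, and there is a constant $C\ne0$ with $$\Omega|_{T_{\mathbf C}(N')}=C\,\frac{dz_1\wedge\cdots\wedge dz_{n-1}}{\prod_i z_i}\wedge dt_0\wedge\cdots\wedge dt_p .$$ For every $x$, the set $T_{\mathbf C}(N')\cap f^{-1}(x)$ lies in $Y^{ns}_{\tilde\sigma,x}$, and $$\Omega_x|_{T_{\mathbf C}(N')\cap f^{-1}(x)}=\varepsilon\, C\,\frac{dz_1\wedge\cdots\wedge dz_{n-1}}{\prod_i z_i}\wedge dt_0,$$ with a sign $\varepsilon\in\{1,-1\}$ that depends neither on $x$ nor on $\Omega$. -/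

import Mathlib

open scoped Topology Pointwise

noncomputable section

/-! ## Affine complex varieties through their coordinate rings

For a finitely generated `ℂ`-algebra `B` the points of the affine variety `Spec B` are the
`ℂ`-algebra homomorphisms `B → ℂ`; the value of a regular function `a : B` at `y` is `y a`. -/

/-- The (closed) points of the affine variety with coordinate ring `B`. -/
abbrev Pt (B : Type*) [CommRing B] [Algebra ℂ B] : Type _ := B →ₐ[ℂ] ℂ

section Forms

variable {A B : Type*} [CommRing A] [Algebra ℂ A] [CommRing B] [Algebra ℂ B]

/-- The tangent space at the point `y`: the `ℂ`-linear derivations `B → ℂ` at `y`. -/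
def tangentSpace (y : Pt B) : Submodule ℂ (B →ₗ[ℂ] ℂ) where
  carrier := {D | ∀ a b : B, D (a * b) = y a * D b + y b * D a}
  add_mem' := by
    intro D E hD hE a b
    simp only [LinearMap.add_apply, hD a b, hE a b]; ring
  zero_mem' := by intro a b; simp
  smul_mem' := by
    intro c D hD a b
    simp only [LinearMap.smul_apply, hD a b, smul_eq_mul]; ring

/-- The point `y` is non-singular: the local ring of the variety at `y` is regular. -/
def IsNonsingular (y : Pt B) : Prop :=
  haveI : (RingHom.ker y).IsPrime := RingHom.ker_isPrime y
  IsRegularLocalRing (Localization.AtPrime (RingHom.ker y))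

/-- The non-singular part of the variety. -/
def nonsingularPart (B : Type*) [CommRing B] [Algebra ℂ B] : Set (Pt B) :=
  {y | IsNonsingular y}

/-- The differential at `y` of the morphism of varieties given by the algebra map `φ`. -/
def pushTangent (φ : A →ₐ[ℂ] B) (y : Pt B) : tangentSpace y →ₗ[ℂ] tangentSpace (y.comp φ) where
  toFun D := ⟨(D : B →ₗ[ℂ] ℂ).comp φ.toLinearMap, by
    intro a b
    simpa using D.2 (φ a) (φ b)⟩
  map_add' _ _ := rfl
  map_smul' _ _ := rfl

/-- A (not necessarily continuous) family of alternating `k`-forms on the tangent spaces.  Only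
the values on a prescribed set of points (the non-singular part) will matter. -/
abbrev Form (B : Type*) [CommRing B] [Algebra ℂ B] (k : ℕ) : Type _ :=
  ∀ y : Pt B, (tangentSpace y) [⋀^Fin k]→ₗ[ℂ] ℂ

/-- The form `dh₁ ∧ ⋯ ∧ dh_k`, i.e. `(D₁, …, D_k) ↦ det (D_a h_b)`. -/
def dWedge {k : ℕ} (h : Fin k → B) : Form B k := fun y =>
  (Matrix.detRowAlternating : (Fin k → ℂ) [⋀^Fin k]→ₗ[ℂ] ℂ).compLinearMap
    ((LinearMap.pi fun b => LinearMap.applyₗ (h b)) ∘ₗ (tangentSpace y).subtype)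

/-- Pull-back of forms along the morphism of varieties given by the algebra map `φ`; for a
surjective `φ`, or a localization, this is restriction to the closed, or open, subvariety. -/
def Form.pullback {k : ℕ} (φ : A →ₐ[ℂ] B) (ω : Form A k) : Form B k := fun y =>
  (ω (y.comp φ)).compLinearMap (pushTangent φ y)

/-- `ω` is a regular (algebraic) form on `U`: locally in the Zariski topology it is a sum of terms
`(g / s) dh₁ ∧ ⋯ ∧ dh_k` with regular functions `g, s, h₁, …, h_k`. -/
def IsRegularForm {k : ℕ} (U : Set (Pt B)) (ω : Form B k) : Prop :=
  ∀ y ∈ U, ∃ s : B, y s ≠ 0 ∧ ∃ (r : ℕ) (g : Fin r → B) (h : Fin r → Fin k → B),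
    ∀ y' ∈ U, y' s ≠ 0 → ω y' = ∑ j, (y' (g j) / y' s) • dWedge (h j) y'

/-- The neighbourhoods of a point in the classical (analytic) topology, which is the topology of
convergence of the values of all regular functions. -/
def analyticNhds (y : Pt B) : Filter (Pt B) :=
  Filter.comap (fun (y' : Pt B) (a : B) => y' a) (𝓝 fun a : B => y a)

/-- `ω` is a holomorphic form on `U`: locally in the classical topology it is a sum of terms
`G dh₁ ∧ ⋯ ∧ dh_k`, where `G` is a holomorphic function of finitely many regular functions. -/
def IsHolomorphicForm {k : ℕ} (U : Set (Pt B)) (ω : Form B k) : Prop :=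
  ∀ y ∈ U, ∃ (m : ℕ) (a : Fin m → B) (r : ℕ) (G : Fin r → (Fin m → ℂ) → ℂ)
    (h : Fin r → Fin k → B),
    (∀ j, AnalyticAt ℂ (G j) fun i => y (a i)) ∧
    ∀ᶠ y' in analyticNhds y, y' ∈ U → ω y' = ∑ j, G j (fun i => y' (a i)) • dWedge (h j) y'

/-- `ω` has no zeros on `U`. -/
def IsNowhereVanishing {k : ℕ} (U : Set (Pt B)) (ω : Form B k) : Prop :=
  ∀ y ∈ U, ω y ≠ 0

end Forms

/-! ## The toric variety of a Minkowski decomposition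

`L = ℤ^d` (so `n = d + 1`), `N' = L ⊕ ℤ^(p+1)`, `M' = Hom(N', ℤ)` written in dual coordinates. -/

/-- A non-empty convex polytope with vertices in the lattice `ℤ^d ⊆ ℝ^d`. -/
def IsLatticePolytope {d : ℕ} (R : Set (Fin d → ℝ)) : Prop :=
  ∃ V : Finset (Fin d → ℤ), V.Nonempty ∧
    R = convexHull ℝ ((fun (v : Fin d → ℤ) (i : Fin d) => (v i : ℝ)) '' (V : Set (Fin d → ℤ)))

/-- The lattice `M' = L* ⊕ ℤ^(p+1)` of characters of `T_ℂ(N')`. -/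
abbrev CharLattice (d p : ℕ) : Type := (Fin d → ℤ) × (Fin (p + 1) → ℤ)

/-- The pairing of `M'` with `N'_ℝ`. -/
def pairing {d p : ℕ} (m : CharLattice d p) (u : (Fin d → ℝ) × (Fin (p + 1) → ℝ)) : ℝ :=
  ∑ i, (m.1 i : ℝ) * u.1 i + ∑ k, (m.2 k : ℝ) * u.2 k

section Toric

variable {d p : ℕ} (R : Fin (p + 1) → Set (Fin d → ℝ))

/-- The cone `σ̃` generated by the union of the sets `R_k × {e_k}`. -/
def sigmaTilde : PointedCone ℝ ((Fin d → ℝ) × (Fin (p + 1) → ℝ)) :=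
  PointedCone.hull ℝ (⋃ k, R k ×ˢ {Pi.single k 1})

/-- The semigroup `σ̃^∨ ∩ M'`. -/
def dualMonoid : AddSubmonoid (CharLattice d p) where
  carrier := {m | ∀ u ∈ sigmaTilde R, 0 ≤ pairing m u}
  zero_mem' := by intro u _; simp [pairing]
  add_mem' := by
    intro m m' hm hm' u hu
    have h : pairing (m + m') u = pairing m u + pairing m' u := by
      simp only [pairing, Prod.fst_add, Prod.snd_add, Pi.add_apply, Int.cast_add, add_mul,
        Finset.sum_add_distrib]
      ring
    rw [h]
    exact add_nonneg (hm u hu) (hm' u hu)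

/-- The coordinate ring `ℂ[σ̃^∨ ∩ M']` of the affine toric variety `Y_σ̃`. -/
abbrev CoordRing : Type := AddMonoidAlgebra ℂ (dualMonoid R)

/-- The coordinate ring `ℂ[M']` of the torus `T_ℂ(N')`. -/
abbrev TorusRing (d p : ℕ) : Type := AddMonoidAlgebra ℂ (CharLattice d p)

/-- The inclusion of the torus `T_ℂ(N') ⊆ Y_σ̃`, on coordinate rings. -/
def torusIncl : CoordRing R →ₐ[ℂ] TorusRing d p :=
  AddMonoidAlgebra.mapDomainAlgHom ℂ ℂ (dualMonoid R).subtype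

theorem dualBasis_mem (k : Fin (p + 1)) :
    ((0, Pi.single k 1) : CharLattice d p) ∈ dualMonoid R := by
  intro u hu
  have key : pairing ((0, Pi.single k 1) : CharLattice d p) u = u.2 k := by
    simp [pairing, Pi.single_apply]
  rw [key]
  refine Submodule.span_induction (p := fun u _ => 0 ≤ u.2 k) ?_ ?_ ?_ ?_ hu
  · intro v hv
    obtain ⟨j, -, hj⟩ := Set.mem_iUnion.1 hv
    rw [Set.mem_singleton_iff.1 hj]
    by_cases h : k = j
    · subst h; simp
    · simp [h]
  · simp
  · intro v w _ _ hv hw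
    exact add_nonneg hv hw
  · intro c v _ hv
    exact mul_nonneg c.2 hv

/-- The regular function `t_k` on `Y_σ̃`: the character `e_k^*`. -/
def tFun (k : Fin (p + 1)) : CoordRing R :=
  AddMonoidAlgebra.single ⟨(0, Pi.single k 1), dualBasis_mem R k⟩ 1

/-- The base `ℂ^(p+1) / ℂ(1, …, 1)` of the deformation. -/
abbrev Base (p : ℕ) : Type := (Fin (p + 1) → ℂ) ⧸ (Submodule.span ℂ {(1 : Fin (p + 1) → ℂ)})

/-- The differential at `y` of `f : Y_σ̃ → ℂ^(p+1) / ℂ(1, …, 1)`, the map induced by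
`(t_0, …, t_p)`. -/
def dMap (y : Pt (CoordRing R)) (D : tangentSpace y) : Base p :=
  Submodule.Quotient.mk fun k => (D : CoordRing R →ₗ[ℂ] ℂ) (tFun R k)

/-- `V 0, …, V (p-1)` are lifts to `T_y Y_σ̃` of the vectors `∂_{t_1}, …, ∂_{t_p}`. -/
def AreLifts (y : Pt (CoordRing R)) (V : Fin p → tangentSpace y) : Prop :=
  ∀ j : Fin p, dMap R y (V j) = Submodule.Quotient.mk (Pi.single j.succ 1)

/-- The ideal of the fibre of `f` over the class of `x ∈ ℂ^(p+1)`, where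
`f = (t_0 - t_1, …, t_0 - t_p)`. -/
def fibreIdeal (x : Fin (p + 1) → ℂ) : Ideal (CoordRing R) :=
  Ideal.span (Set.range fun j : Fin p =>
    tFun R 0 - tFun R j.succ - algebraMap ℂ (CoordRing R) (x 0 - x j.succ))

/-- The coordinate ring of the fibre `f⁻¹(x)`. -/
abbrev FibreRing (x : Fin (p + 1) → ℂ) : Type := CoordRing R ⧸ fibreIdeal R x

/-- The inclusion of the fibre `f⁻¹(x) ⊆ Y_σ̃`, on coordinate rings. -/
def fibreIncl (x : Fin (p + 1) → ℂ) : CoordRing R →ₐ[ℂ] FibreRing R x :=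
  Ideal.Quotient.mkₐ ℂ (fibreIdeal R x)

/-- The coordinate ring of `T_ℂ(N') ∩ f⁻¹(x)`. -/
abbrev TorusFibreRing (x : Fin (p + 1) → ℂ) : Type :=
  TorusRing d p ⧸ (fibreIdeal R x).map (torusIncl R)

/-- The inclusion `T_ℂ(N') ∩ f⁻¹(x) ⊆ f⁻¹(x)`, on coordinate rings. -/
def torusFibreIncl (x : Fin (p + 1) → ℂ) : FibreRing R x →ₐ[ℂ] TorusFibreRing R x :=
  Ideal.quotientMapₐ _ (torusIncl R) Ideal.le_comap_map

/-! ## The action of `T_ℂ(L)` -/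

/-- The value of the character `m ∈ L*` at `s ∈ T_ℂ(L) = (ℂ^×)^d`. -/
def charValue (s : Fin d → ℂˣ) (m : Fin d → ℤ) : ℂ :=
  ((∏ i, s i ^ m i : ℂˣ) : ℂ)

/-- The action of `s ∈ T_ℂ(L) ⊆ T_ℂ(N')` on `Y_σ̃`, on coordinate rings: the character `m` is
multiplied by its value at `s`. -/
def torusAct (s : Fin d → ℂˣ) : CoordRing R →ₐ[ℂ] CoordRing R :=
  AddMonoidAlgebra.lift ℂ (CoordRing R) (dualMonoid R)
    { toFun := fun m => AddMonoidAlgebra.single m.toAdd (charValue s m.toAdd.1.1)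
      map_one' := by
        simp [charValue, AddMonoidAlgebra.one_def]
      map_mul' := by
        intro m m'
        simp [charValue, AddMonoidAlgebra.single_mul_single, zpow_add, Finset.prod_mul_distrib] }

theorem torusAct_tFun (s : Fin d → ℂˣ) (k : Fin (p + 1)) :
    torusAct R s (tFun R k) = tFun R k := by
  simp [torusAct, tFun, AddMonoidAlgebra.lift_single, charValue]

theorem fibreIdeal_le_comap (s : Fin d → ℂˣ) (x : Fin (p + 1) → ℂ) :
    fibreIdeal R x ≤ (fibreIdeal R x).comap (torusAct R s) := by
  rw [fibreIdeal, Ideal.span_le]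
  rintro _ ⟨j, rfl⟩
  have h : torusAct R s (tFun R 0 - tFun R j.succ -
      algebraMap ℂ (CoordRing R) (x 0 - x j.succ)) =
      tFun R 0 - tFun R j.succ - algebraMap ℂ (CoordRing R) (x 0 - x j.succ) := by
    rw [_root_.map_sub, _root_.map_sub, torusAct_tFun, torusAct_tFun, AlgHom.commutes]
  simp only [SetLike.mem_coe, Ideal.mem_comap]
  rw [h]
  exact Ideal.subset_span ⟨j, rfl⟩

/-- The action of `s ∈ T_ℂ(L)` on the fibre `f⁻¹(x)`, on coordinate rings. -/
def fibreAct (s : Fin d → ℂˣ) (x : Fin (p + 1) → ℂ) : FibreRing R x →ₐ[ℂ] FibreRing R x :=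
  Ideal.quotientMapₐ _ (torusAct R s) (fibreIdeal_le_comap R s x)

/-! ## Forms on `Y_σ̃` and on its fibres -/

/-- `Ω` is a nowhere vanishing (algebraic) form of degree `n + p`, `n = d + 1`, on the
non-singular part of `Y_σ̃`. -/
def IsVolumeForm (Ω : Form (CoordRing R) (p + (d + 1))) : Prop :=
  IsRegularForm (nonsingularPart (CoordRing R)) Ω ∧
    IsNowhereVanishing (nonsingularPart (CoordRing R)) Ω

/-- `ω` is the restriction to the non-singular part of `f⁻¹(x)` of
`ι(∂_{t_1}, …, ∂_{t_p})Ω = Ω(∂_{t_1}, …, ∂_{t_p}, …)`, whatever lifts of the `∂_{t_j}` are used. -/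
def IsContraction (Ω : Form (CoordRing R) (p + (d + 1))) (x : Fin (p + 1) → ℂ)
    (ω : Form (FibreRing R x) (d + 1)) : Prop :=
  ∀ y ∈ nonsingularPart (FibreRing R x),
    ∀ V : Fin p → tangentSpace (y.comp (fibreIncl R x)), AreLifts R _ V →
      ∀ v : Fin (d + 1) → tangentSpace y,
        ω y v = Ω (y.comp (fibreIncl R x))
          (Fin.append V fun i => pushTangent (fibreIncl R x) y (v i))

end Toric

/-- The character `z ∈ L*` of `T_ℂ(L)`, as a function on `T_ℂ(N') = T_ℂ(L) × T_ℂ(ℤ^(p+1))`. -/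
def zFun {d : ℕ} (p : ℕ) (z : Fin d → ℤ) : TorusRing d p :=
  AddMonoidAlgebra.single (z, 0) 1

/-- The character `t_k` of `T_ℂ(N')`. -/
def tChar (d : ℕ) {p : ℕ} (k : Fin (p + 1)) : TorusRing d p :=
  AddMonoidAlgebra.single (0, Pi.single k 1) 1

/-- The form `(dz_1 ∧ ⋯ ∧ dz_{n-1} / ∏ z_i) ∧ dt_0 ∧ ⋯ ∧ dt_p` on `T_ℂ(N')`. -/
def torusForm {d : ℕ} (p : ℕ) (z : Fin d → (Fin d → ℤ)) :
    Form (TorusRing d p) (p + (d + 1)) := fun u =>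
  (∏ i, u (zFun p (z i)))⁻¹ •
    dWedge (fun a : Fin (p + (d + 1)) =>
      Fin.append (fun i => zFun p (z i)) (fun k : Fin (p + 1) => tChar d k)
        (Fin.cast (by omega) a)) u

/-- The form `(dz_1 ∧ ⋯ ∧ dz_{n-1} / ∏ z_i) ∧ dt_0` on `T_ℂ(N') ∩ f⁻¹(x)`. -/
def torusFibreForm {d p : ℕ} (R : Fin (p + 1) → Set (Fin d → ℝ)) (x : Fin (p + 1) → ℂ)
    (z : Fin d → (Fin d → ℤ)) : Form (TorusFibreRing R x) (d + 1) := fun u =>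
  (∏ i, u (Ideal.Quotient.mk _ (zFun p (z i))))⁻¹ •
    dWedge (Fin.snoc (α := fun _ => TorusFibreRing R x)
      (fun i => Ideal.Quotient.mk _ (zFun p (z i))) (Ideal.Quotient.mk _ (tChar d 0))) u

end

/-! Write N = p + (d + 1), M' for the character lattice, S for the dual monoid and e = (0, 1) for
the sum of the e_k^*. Every generator (v, e_k) of the cone, v a vertex of R_k, pairs to 1 with e:
the toric variety is Gorenstein (`isGorenstein_dualMonoid`). Hence the invariant logarithmic form of
the torus multiplied by χ^e extends without zeros over the non-singular part. Since χ^e = t_0 ⋯ t_p,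
it is the form of the theorem on the torus.

The extension requires charts at all non-singular points. A transcendence degree count
(`trdeg_le_of_coordRing_surjective`) bounds the dimension of the variety by N, so tangent spaces at
non-singular points have dimension at most N. Enough tangent vectors can be written down
combinatorially (`IsFace.finrank_add_card_le`) that this bound forces S to look locally like ℕ^J ×
ℤ^(N-|J|) (`IsGorenstein.exists_isChart`). There e has coordinate 1 along every j in J
(`IsChart.repr_e`), so the volume form is a unit times dβ_1 ∧ ⋯ ∧ dβ_N in local coordinates β.

For uniqueness, the ratio of Ω to this form is a unit on the torus, that is cχ^m. It is also a unit
at the general point of each divisor orbit, so every facet functional kills m. As P has interior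
points, S contains no line and m = 0 (`IsGorenstein.eq_smul_volForm`).

For a fibre, the same count gives dimension at most d + 1. The tangent space of the fibre is the
kernel of df, so at a non-singular point of the fibre the tangent space of Y has dimension at most
N. A chart therefore exists: Y is non-singular there, the dimension is exactly N, and f is
submersive (`submersive_of_isNonsingular`). Contraction is then linear algebra in coordinates (τ, g)
with τ_j = t_0 - t_j (`IsFibre.exists_contraction`). Invariance holds because e is trivial on
T_ℂ(L). On the torus the fields ∂/∂t_j are explicit lifts, which gives both the non-singularity of
the torus part of the fibre and the formula, with a sign coming only from a reordering of
coordinates. -/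

noncomputable section

/-! ## Krull dimension and transcendence degree -/

open Cardinal in
-- Lifts of a transcendence basis of `B ⧸ Q` stay independent in `B ⧸ P`, and any element of `Q`
-- outside `P` is transcendental over them.
theorem trdeg_quotient_add_one_le {k B : Type*} [Field k] [CommRing B] [Algebra k B]
    {P Q : Ideal B} [P.IsPrime] [Q.IsPrime] (hPQ : P < Q) :
    Algebra.trdeg k (B ⧸ Q) + 1 ≤ Algebra.trdeg k (B ⧸ P) := by
  obtain ⟨s, hs⟩ := exists_isTranscendenceBasis' k (B ⧸ Q)
  obtain ⟨x, hx⟩ := hs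
  have hsurj : ∀ i, ∃ b : B, Ideal.Quotient.mk Q b = x i := fun i =>
    Ideal.Quotient.mk_surjective _
  choose b hb using hsurj
  obtain ⟨a, haQ, haP⟩ := Set.exists_of_ssubset hPQ
  let φ : (B ⧸ P) →ₐ[k] (B ⧸ Q) := Ideal.Quotient.factorₐ k hPQ.le
  let x' : s → B ⧸ P := fun i => Ideal.Quotient.mk P (b i)
  have hφx : φ ∘ x' = x := by
    ext i
    simp [φ, x', hb]
  have hind : AlgebraicIndependent k (φ ∘ x') := by rw [hφx]; exact hx.1
  have hx' : AlgebraicIndependent k x' := AlgebraicIndependent.of_comp φ hind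
  have ha0 : Ideal.Quotient.mk P a ≠ 0 := by
    rwa [Ne, Ideal.Quotient.eq_zero_iff_mem]
  have hφa : φ (Ideal.Quotient.mk P a) = 0 := by
    simpa [φ, Ideal.Quotient.eq_zero_iff_mem] using haQ
  have htr : Transcendental (Algebra.adjoin k (Set.range x')) (Ideal.Quotient.mk P a) := by
    intro halg
    -- In a domain a relation can be divided by powers of the variable until its constant term is
    -- non-zero; modulo `Q` only that constant term survives.
    obtain ⟨q, hq0, hq⟩ := halg.exists_nonzero_coeff_and_aeval_eq_zero
      (mem_nonZeroDivisors_of_ne_zero ha0)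
    apply hq0
    have h1 : (φ ((q.coeff 0 : Algebra.adjoin k (Set.range x')) : B ⧸ P)) = 0 := by
      have := congrArg φ hq
      rw [Polynomial.aeval_eq_sum_range, map_sum, Finset.sum_eq_single 0] at this
      · simpa [Algebra.smul_def] using this
      · intro i _ hi
        simp [Algebra.smul_def, hφa, hi]
      · simp
    obtain ⟨c, hc⟩ := (AlgebraicIndependent.aevalEquiv hx').surjective (q.coeff 0)
    have hc' : ((q.coeff 0 : Algebra.adjoin k (Set.range x')) : B ⧸ P) = MvPolynomial.aeval x' c := by
      rw [← hc]; simp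
    rw [hc', ← AlgHom.comp_apply, MvPolynomial.comp_aeval] at h1
    have : c = 0 := hind.eq_zero_of_aeval_eq_zero c h1
    rw [← hc, this, map_zero]
  have hopt := (hx'.option_iff_transcendental _).2 htr
  have := hopt.lift_cardinalMk_le_trdeg
  have h2 := hx.lift_cardinalMk_eq_trdeg
  simp only [Cardinal.lift_id] at h2
  simpa [← h2] using this

/-- The transcendence degree of `B ⧸ Q` drops strictly along chains of primes, so a chain injects
into `Fin (n + 1)`. No finiteness of `B` is required. -/
theorem ringKrullDim_le_of_forall_trdeg_le (k : Type*) {B : Type*} [Field k] [CommRing B]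
    [Algebra k B] (n : ℕ) (h : ∀ Q : Ideal B, Q.IsPrime → Algebra.trdeg k (B ⧸ Q) ≤ n) :
    ringKrullDim B ≤ n := by
  have hfin : ∀ Q : PrimeSpectrum B, Algebra.trdeg k (B ⧸ Q.asIdeal) < Cardinal.aleph0 := fun Q =>
    (h _ Q.2).trans_lt (Cardinal.natCast_lt_aleph0)
  let g : PrimeSpectrum B → ℕ := fun Q => (Algebra.trdeg k (B ⧸ Q.asIdeal)).toNat
  have hg : ∀ Q, g Q ≤ n := fun Q => by
    have := Cardinal.toNat_le_toNat (h _ Q.2) (Cardinal.natCast_lt_aleph0)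
    simpa using this
  have hlt : ∀ P Q : PrimeSpectrum B, P < Q → g Q + 1 ≤ g P := fun P Q hPQ => by
    have := Cardinal.toNat_le_toNat (trdeg_quotient_add_one_le (k := k)
      (show P.asIdeal < Q.asIdeal from hPQ)) (hfin P)
    rw [Cardinal.toNat_add (hfin Q) Cardinal.one_lt_aleph0] at this
    simpa using this
  let f : PrimeSpectrum B → Fin (n + 1) := fun Q => ⟨n - g Q, by omega⟩
  have hf : StrictMono f := fun P Q hPQ => by
    have h1 := hlt P Q hPQ
    have h2 := hg P
    simp only [f, Fin.mk_lt_mk]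
    omega
  refine iSup_le fun p => ?_
  have := (p.map f hf).length_lt_card
  simp only [Fintype.card_fin, LTSeries.map_length] at this
  exact_mod_cast Nat.lt_succ_iff.1 this

theorem ringKrullDim_atPrime_le {B : Type*} [CommRing B] (P : Ideal B) [P.IsPrime] :
    ringKrullDim (Localization.AtPrime P) ≤ ringKrullDim B := by
  rw [IsLocalization.AtPrime.ringKrullDim_eq_height P]
  exact Ideal.height_le_ringKrullDim_of_isPrime

end


noncomputable section

/-! ## Tangent spaces and regularity -/

section Tangent

variable {B : Type*} [CommRing B] [Algebra ℂ B]

theorem tangentSpace_mul {y : Pt B} (D : tangentSpace y) (a b : B) :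
    (D : B →ₗ[ℂ] ℂ) (a * b) = y a * (D : B →ₗ[ℂ] ℂ) b + y b * (D : B →ₗ[ℂ] ℂ) a :=
  D.2 a b

theorem tangentSpace_one {y : Pt B} (D : tangentSpace y) : (D : B →ₗ[ℂ] ℂ) 1 = 0 := by
  have := tangentSpace_mul D 1 1
  simp only [mul_one, map_one, one_mul] at this
  linear_combination -this

theorem tangentSpace_algebraMap {y : Pt B} (D : tangentSpace y) (c : ℂ) :
    (D : B →ₗ[ℂ] ℂ) (algebraMap ℂ B c) = 0 := by
  rw [Algebra.algebraMap_eq_smul_one, map_smul, tangentSpace_one, smul_zero]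

theorem pushTangent_apply {A : Type*} [CommRing A] [Algebra ℂ A] (φ : A →ₐ[ℂ] B) (y : Pt B)
    (D : tangentSpace y) (a : A) :
    (pushTangent φ y D : A →ₗ[ℂ] ℂ) a = (D : B →ₗ[ℂ] ℂ) (φ a) := rfl

instance (y : Pt B) : (RingHom.ker y).IsPrime := RingHom.ker_isPrime y

/-- The local ring of the variety at `y`. -/
abbrev LocalRingAt (y : Pt B) : Type _ := Localization.AtPrime (RingHom.ker y)

theorem isNonsingular_iff (y : Pt B) : IsNonsingular y ↔ IsRegularLocalRing (LocalRingAt y) :=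
  Iff.rfl

/-- The elements of the maximal ideal at `y` killed by `D`. -/
def tangentKer {y : Pt B} (D : tangentSpace y) : Ideal B where
  carrier := {b | y b = 0 ∧ (D : B →ₗ[ℂ] ℂ) b = 0}
  add_mem' := by
    rintro a b ⟨h1, h2⟩ ⟨h3, h4⟩
    exact ⟨by simp [h1, h3], by simp [h2, h4]⟩
  zero_mem' := by simp
  smul_mem' := by
    rintro c b ⟨h1, h2⟩
    refine ⟨by simp [h1], ?_⟩
    rw [smul_eq_mul, tangentSpace_mul, h1, h2]; simp

theorem tangentSpace_eq_zero_of_ker {y : Pt B} (D : tangentSpace y)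
    (h : ∀ b, y b = 0 → (D : B →ₗ[ℂ] ℂ) b = 0) : D = 0 := by
  ext b
  have h1 := h (b - algebraMap ℂ B (y b)) (by simp)
  rw [map_sub, tangentSpace_algebraMap, sub_zero] at h1
  simpa using h1

/-- A tangent vector is determined by its values on numerators of a minimal generating set of the
maximal ideal; in a regular local ring the size of that set is the dimension. -/
theorem finite_tangentSpace_of_isNonsingular {y : Pt B} (hy : IsNonsingular y) :
    Module.Finite ℂ (tangentSpace y) ∧
      (Module.finrank ℂ (tangentSpace y) : WithBot ℕ∞) ≤ ringKrullDim (LocalRingAt y) := by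
  have hreg : IsRegularLocalRing (LocalRingAt y) := hy
  let m := IsLocalRing.maximalIdeal (LocalRingAt y)
  have hfg : Submodule.FG m := IsNoetherian.noetherian m
  have hfin : m.generators.Finite := hfg.finite_generators
  have : Fintype m.generators := hfin.fintype
  have hcard : Fintype.card m.generators = m.spanFinrank := by
    rw [← hfg.generators_ncard, ← Nat.card_eq_fintype_card]; rfl
  have hnum : ∀ g : m.generators, ∃ a : B, ∃ s : (RingHom.ker y).primeCompl,
      IsLocalization.mk' (LocalRingAt y) a s = g := fun g =>
    IsLocalization.exists_mk'_eq _ _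
  choose a s has using hnum
  let Φ : tangentSpace y →ₗ[ℂ] (m.generators → ℂ) :=
    LinearMap.pi fun g => (LinearMap.applyₗ (a g)) ∘ₗ (tangentSpace y).subtype
  have hΦ : Function.Injective Φ := by
    rw [← LinearMap.ker_eq_bot, LinearMap.ker_eq_bot']
    intro D hD
    have hD' : ∀ g, (D : B →ₗ[ℂ] ℂ) (a g) = 0 := fun g => congrFun hD g
    have hya : ∀ g, y (a g) = 0 := fun g => by
      have h1 : (g : LocalRingAt y) ∈ m := by
        have h0 : (g : LocalRingAt y) ∈ Submodule.span (LocalRingAt y) m.generators := Submodule.subset_span g.2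
        rwa [m.span_generators] at h0
      rw [← has g] at h1
      exact (IsLocalization.AtPrime.mk'_mem_maximal_iff (LocalRingAt y) (RingHom.ker y)
        (a g) (s g)).1 h1
    -- The ideal killed by `D` contains the numerators, so its extension to the local ring is the
    -- whole maximal ideal.
    have hle : m ≤ (tangentKer D).map (algebraMap B (LocalRingAt y)) := by
      rw [← m.span_generators]
      refine Submodule.span_le.2 fun g hg => ?_
      have h2 := has ⟨g, hg⟩
      simp only at h2
      rw [← h2, IsLocalization.mk'_eq_mul_mk'_one, mul_comm]
      exact Ideal.mul_mem_left _ _ (Ideal.mem_map_of_mem _ ⟨hya _, hD' _⟩)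
    refine tangentSpace_eq_zero_of_ker D fun b hb => ?_
    have hbm : algebraMap B (LocalRingAt y) b ∈ m :=
      (IsLocalization.AtPrime.to_map_mem_maximal_iff _ (RingHom.ker y) b).2 hb
    obtain ⟨⟨c, t⟩, hct⟩ := (IsLocalization.mem_map_algebraMap_iff
      (RingHom.ker y).primeCompl _).1 (hle hbm)
    simp only [← map_mul] at hct
    obtain ⟨w, hw⟩ := (IsLocalization.eq_iff_exists (RingHom.ker y).primeCompl _).1 hct
    have h3 : (D : B →ₗ[ℂ] ℂ) ((w : B) * (b * t)) = 0 := by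
      rw [hw]
      exact ((tangentKer D).mul_mem_left _ c.2).2
    rw [tangentSpace_mul, tangentSpace_mul, map_mul, hb] at h3
    have hw0 : y w ≠ 0 := w.2
    have ht0 : y t ≠ 0 := t.2
    simpa [hw0, ht0] using h3
  refine ⟨Module.Finite.of_injective Φ hΦ, ?_⟩
  rw [← hreg.spanFinrank_maximalIdeal]
  have h := LinearMap.finrank_le_finrank_of_injective hΦ
  rw [Module.finrank_fintype_fun_eq_card, hcard] at h
  exact_mod_cast h

/-- A functional on the cotangent space of the local ring is a tangent vector. -/
def tangentOfCotangent (y : Pt B) :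
    Module.Dual ℂ (IsLocalRing.maximalIdeal (LocalRingAt y)).Cotangent →ₗ[ℂ] tangentSpace y :=
  let m := IsLocalRing.maximalIdeal (LocalRingAt y)
  let δ : B →ₗ[ℂ] m := LinearMap.codRestrict (m.restrictScalars ℂ)
    ((Algebra.linearMap B (LocalRingAt y)).restrictScalars ℂ ∘ₗ
      (LinearMap.id - (Algebra.linearMap ℂ B) ∘ₗ y.toLinearMap)) (fun b => by
        refine (IsLocalization.AtPrime.to_map_mem_maximal_iff _ (RingHom.ker y) _).2 ?_
        simp [RingHom.mem_ker])
  have hδ : ∀ b, (δ b : LocalRingAt y) =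
      algebraMap B (LocalRingAt y) (b - algebraMap ℂ B (y b)) := fun b => rfl
  { toFun := fun φ => ⟨φ ∘ₗ (m.toCotangent.restrictScalars ℂ) ∘ₗ δ, by
      intro a b
      -- Leibniz rule modulo m²: the two sides differ by the product `δ a * δ b`.
      have h : m.toCotangent (δ (a * b)) =
          m.toCotangent (y a • δ b + y b • δ a) := by
        rw [Ideal.toCotangent_eq, pow_two]
        have : ((δ (a * b) : m) : LocalRingAt y) - ((y a • δ b + y b • δ a : m) : LocalRingAt y) =
            (δ a : LocalRingAt y) * (δ b : LocalRingAt y) := by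
          simp only [Submodule.coe_add, Submodule.coe_smul_of_tower, hδ, Algebra.smul_def,
            IsScalarTower.algebraMap_apply ℂ B (LocalRingAt y), ← map_mul, ← map_add, ← map_sub]
          congr 1
          rw [map_mul, map_mul]; ring
        rw [this]
        exact Ideal.mul_mem_mul (δ a).2 (δ b).2
      have h2 : (m.toCotangent.restrictScalars ℂ) (δ (a * b)) =
          y a • (m.toCotangent.restrictScalars ℂ) (δ b) +
          y b • (m.toCotangent.restrictScalars ℂ) (δ a) := by
        rw [← LinearMap.map_smul _ (y a) (δ b), ← LinearMap.map_smul _ (y b) (δ a),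
          ← LinearMap.map_add]
        exact h
      simp only [LinearMap.comp_apply, h2, map_add, map_smul, smul_eq_mul]⟩
    map_add' := fun _ _ => rfl
    map_smul' := fun _ _ => rfl }

theorem tangentOfCotangent_apply (y : Pt B)
    (φ : Module.Dual ℂ (IsLocalRing.maximalIdeal (LocalRingAt y)).Cotangent) (b : B) (hb : y b = 0)
    (hb' : algebraMap B (LocalRingAt y) b ∈ IsLocalRing.maximalIdeal (LocalRingAt y)) :
    (tangentOfCotangent y φ : B →ₗ[ℂ] ℂ) b =
      φ ((IsLocalRing.maximalIdeal (LocalRingAt y)).toCotangent ⟨algebraMap _ _ b, hb'⟩) := by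
  change φ ((IsLocalRing.maximalIdeal (LocalRingAt y)).toCotangent _) = _
  congr 2
  ext
  change algebraMap B (LocalRingAt y) (b - algebraMap ℂ B (y b)) = _
  rw [hb, map_zero, sub_zero]

theorem tangentOfCotangent_injective (y : Pt B) : Function.Injective (tangentOfCotangent y) := by
  rw [← LinearMap.ker_eq_bot, LinearMap.ker_eq_bot']
  intro φ hφ
  ext c
  obtain ⟨⟨x, hx⟩, rfl⟩ := Ideal.toCotangent_surjective _ c
  obtain ⟨b, s, rfl⟩ := IsLocalization.exists_mk'_eq (RingHom.ker y).primeCompl x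
  have hb : y b = 0 := (IsLocalization.AtPrime.mk'_mem_maximal_iff (LocalRingAt y) (RingHom.ker y)
        b s).1 hx
  have hs0 : y s ≠ 0 := s.2
  have hb' : algebraMap B (LocalRingAt y) b ∈ IsLocalRing.maximalIdeal (LocalRingAt y) :=
    (IsLocalization.AtPrime.to_map_mem_maximal_iff _ (RingHom.ker y) b).2 hb
  have h0 : φ ((IsLocalRing.maximalIdeal (LocalRingAt y)).toCotangent
      ⟨algebraMap _ _ b, hb'⟩) = 0 := by
    rw [← tangentOfCotangent_apply y φ b hb hb', hφ]; rfl
  have hsm : algebraMap B (LocalRingAt y) (s - algebraMap ℂ B (y s)) ∈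
      IsLocalRing.maximalIdeal (LocalRingAt y) :=
    (IsLocalization.AtPrime.to_map_mem_maximal_iff _ (RingHom.ker y) _).2
      (by simp [RingHom.mem_ker])
  -- Modulo m² the fraction b/s equals b/y(s), because s - y(s) lies in m; so the class of every
  -- fraction is determined by its numerator.
  have key : (IsLocalRing.maximalIdeal (LocalRingAt y)).toCotangent
        ⟨IsLocalization.mk' (LocalRingAt y) b s, hx⟩ =
      (IsLocalRing.maximalIdeal (LocalRingAt y)).toCotangent
        ((y s)⁻¹ • ⟨algebraMap _ _ b, hb'⟩) := by
    rw [Ideal.toCotangent_eq, pow_two]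
    have e1 : IsLocalization.mk' (LocalRingAt y) b s -
        (y s)⁻¹ • algebraMap B (LocalRingAt y) b = - ((y s)⁻¹ •
        algebraMap B (LocalRingAt y) (s - algebraMap ℂ B (y s))) *
          IsLocalization.mk' (LocalRingAt y) b s := by
      have e2 : algebraMap B (LocalRingAt y) b =
          algebraMap B (LocalRingAt y) s * IsLocalization.mk' (LocalRingAt y) b s :=
        (IsLocalization.mk'_spec' _ _ _).symm
      rw [e2, map_sub, ← IsScalarTower.algebraMap_apply, smul_sub, Algebra.smul_def,
        Algebra.smul_def, Algebra.smul_def, ← map_mul, inv_mul_cancel₀ hs0, map_one]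
      ring
    change _ - (y s)⁻¹ • algebraMap B (LocalRingAt y) b ∈ _
    rw [e1]
    refine Ideal.mul_mem_mul (neg_mem ?_) hx
    rw [Algebra.smul_def]
    exact Ideal.mul_mem_left _ _ hsm
  have key2 : (IsLocalRing.maximalIdeal (LocalRingAt y)).toCotangent
        ((y s)⁻¹ • ⟨algebraMap _ _ b, hb'⟩) = (y s)⁻¹ •
      (IsLocalRing.maximalIdeal (LocalRingAt y)).toCotangent
        ⟨algebraMap _ _ b, hb'⟩ :=
    LinearMap.map_smul ((IsLocalRing.maximalIdeal (LocalRingAt y)).toCotangent.restrictScalars ℂ)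
      (y s)⁻¹ ⟨algebraMap _ _ b, hb'⟩
  rw [key, key2, map_smul, h0, smul_zero]
  rfl

theorem residueField_bijective (y : Pt B) :
    Function.Bijective (algebraMap ℂ (IsLocalRing.ResidueField (LocalRingAt y))) := by
  refine ⟨RingHom.injective _, fun x => ?_⟩
  obtain ⟨x, rfl⟩ := IsLocalRing.residue_surjective x
  obtain ⟨b, s, rfl⟩ := IsLocalization.exists_mk'_eq (RingHom.ker y).primeCompl x
  have hs0 : y s ≠ 0 := s.2
  refine ⟨y b / y s, ?_⟩
  rw [IsScalarTower.algebraMap_apply ℂ (LocalRingAt y)]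
  change IsLocalRing.residue _ _ = _
  rw [← sub_eq_zero, ← map_sub, IsLocalRing.residue_eq_zero_iff]
  have hx : algebraMap ℂ (LocalRingAt y) (y b / y s) - IsLocalization.mk' (LocalRingAt y) b s =
      IsLocalization.mk' (LocalRingAt y) (algebraMap ℂ B (y b / y s) * s - b) s := by
    rw [IsLocalization.eq_mk'_iff_mul_eq, sub_mul, IsLocalization.mk'_spec, map_sub, map_mul,
      ← IsScalarTower.algebraMap_apply]
  rw [hx]
  refine (IsLocalization.AtPrime.mk'_mem_maximal_iff (LocalRingAt y) (RingHom.ker y) _ s).2 ?_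
  simp [RingHom.mem_ker, hs0]

/-- The dual of the cotangent space embeds into the tangent space. The residue field is ℂ, so the
two ways of counting dimensions agree. -/
theorem isNonsingular_of_finrank_le {y : Pt B} [IsNoetherianRing (LocalRingAt y)]
    [Module.Finite ℂ (tangentSpace y)]
    (h : (Module.finrank ℂ (tangentSpace y) : WithBot ℕ∞) ≤ ringKrullDim (LocalRingAt y)) :
    IsNonsingular y := by
  rw [isNonsingular_iff]
  refine IsRegularLocalRing.of_spanFinrank_maximalIdeal_le _ (le_trans ?_ h)
  rw [IsLocalRing.spanFinrank_maximalIdeal_eq_finrank_cotangentSpace]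
  norm_cast
  let κ := IsLocalRing.ResidueField (LocalRingAt y)
  let V := IsLocalRing.CotangentSpace (LocalRingAt y)
  have hκ : Module.finrank ℂ κ = 1 := by
    have e : ℂ ≃ₗ[ℂ] κ := LinearEquiv.ofBijective (Algebra.linearMap ℂ κ) (residueField_bijective y)
    rw [← e.finrank_eq, Module.finrank_self]
  have : IsScalarTower ℂ (LocalRingAt y) V := inferInstance
  have : IsScalarTower ℂ κ V := IsScalarTower.of_algebraMap_smul fun r x => by
    rw [IsScalarTower.algebraMap_apply ℂ (LocalRingAt y) κ, algebraMap_smul, algebraMap_smul]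
  have h1 : Module.finrank ℂ κ * Module.finrank κ V = Module.finrank ℂ V :=
    Module.finrank_mul_finrank ℂ κ V
  rw [hκ, one_mul] at h1
  change Module.finrank κ V ≤ _
  rw [h1, ← Subspace.dual_finrank_eq]
  exact LinearMap.finrank_le_finrank_of_injective (tangentOfCotangent_injective y)

theorem IsNonsingular.comp_algEquiv {A : Type*} [CommRing A] [Algebra ℂ A] (φ : A ≃ₐ[ℂ] B)
    {y : Pt B} (hy : IsNonsingular y) : IsNonsingular (y.comp (φ : A →ₐ[ℂ] B)) := by
  rw [isNonsingular_iff] at hy ⊢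
  have := hy
  refine IsRegularLocalRing.of_ringEquiv (R := LocalRingAt y) ?_
  refine (IsLocalization.ringEquivOfRingEquiv (M := (RingHom.ker y).primeCompl)
    (T := (RingHom.ker (y.comp (φ : A →ₐ[ℂ] B))).primeCompl) _ _ φ.symm.toRingEquiv ?_)
  ext a
  constructor
  · rintro ⟨b, hb, rfl⟩
    change ¬ _
    intro h
    apply hb
    simpa [RingHom.mem_ker] using h
  · intro ha
    refine ⟨φ a, fun h => ha ?_, by simp⟩
    simpa [RingHom.mem_ker] using h

end Tangent
end


noncomputable section

/-! ## Tangent vectors of affine monoid algebras -/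

section Chi

variable {Γ : Type*} [AddCommMonoid Γ]

/-- The character `m` as an element of the monoid algebra. -/
def chi (m : Γ) : AddMonoidAlgebra ℂ Γ := AddMonoidAlgebra.single m 1

theorem chi_add (m m' : Γ) : chi (m + m') = chi m * chi m' := by
  simp [chi, AddMonoidAlgebra.single_mul_single]

theorem chi_zero : chi (0 : Γ) = 1 := rfl

theorem chi_nsmul (n : ℕ) (m : Γ) : chi (n • m) = chi m ^ n := by
  induction n with
  | zero => simp [chi_zero]
  | succ n ih => rw [add_smul, chi_add, ih, one_smul, pow_succ]

theorem chi_sum {ι : Type*} (s : Finset ι) (m : ι → Γ) :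
    chi (∑ i ∈ s, m i) = ∏ i ∈ s, chi (m i) := by
  classical
  induction s using Finset.induction_on with
  | empty => simp [chi_zero]
  | insert a s ha ih => rw [Finset.sum_insert ha, Finset.prod_insert ha, chi_add, ih]

theorem smul_chi (c : ℂ) (m : Γ) : c • chi m = AddMonoidAlgebra.single m c := by
  simp [chi]

theorem chi_induction {P : AddMonoidAlgebra ℂ Γ → Prop} (a : AddMonoidAlgebra ℂ Γ)
    (hchi : ∀ m, P (chi m)) (hadd : ∀ a b, P a → P b → P (a + b))
    (hsmul : ∀ (c : ℂ) a, P a → P (c • a)) : P a := by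
  induction a using AddMonoidAlgebra.induction_linear with
  | zero => simpa using hsmul 0 _ (hchi 0)
  | add a b ha hb => exact hadd a b ha hb
  | single m c => rw [← smul_chi]; exact hsmul _ _ (hchi m)

theorem linearMap_ext_chi {W : Type*} [AddCommMonoid W] [Module ℂ W]
    {D E : AddMonoidAlgebra ℂ Γ →ₗ[ℂ] W} (h : ∀ m, D (chi m) = E (chi m)) : D = E := by
  refine LinearMap.ext fun a => ?_
  induction a using chi_induction with
  | hchi m => exact h m
  | hadd a b ha hb => rw [map_add, map_add, ha, hb]
  | hsmul c a ha => rw [map_smul, map_smul, ha]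

/-- The linear map with prescribed values on the characters. -/
def linearOfChi {W : Type*} [AddCommMonoid W] [Module ℂ W] (δ : Γ → W) :
    AddMonoidAlgebra ℂ Γ →ₗ[ℂ] W :=
  (Finsupp.lift W ℂ Γ δ) ∘ₗ (AddMonoidAlgebra.coeffLinearEquiv ℂ).toLinearMap

omit [AddCommMonoid Γ] in
@[simp] theorem linearOfChi_chi {W : Type*} [AddCommMonoid W] [Module ℂ W] (δ : Γ → W) (m : Γ) :
    linearOfChi δ (chi m) = δ m := by
  simp [linearOfChi, chi]

theorem leibniz_of_chi {W : Type*} [AddCommGroup W] [Module ℂ W]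
    (act : AddMonoidAlgebra ℂ Γ →ₗ[ℂ] W →ₗ[ℂ] W) (D : AddMonoidAlgebra ℂ Γ →ₗ[ℂ] W)
    (h : ∀ m m', D (chi m * chi m') = act (chi m) (D (chi m')) + act (chi m') (D (chi m)))
    (a b : AddMonoidAlgebra ℂ Γ) : D (a * b) = act a (D b) + act b (D a) := by
  induction a using chi_induction with
  | hchi m =>
    induction b using chi_induction with
    | hchi m' => exact h m m'
    | hadd a b ha hb => simp only [mul_add, map_add, ha, hb, LinearMap.add_apply]; abel
    | hsmul c a ha => simp only [mul_smul_comm, map_smul, ha, LinearMap.smul_apply, smul_add]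
  | hadd a b ha hb => simp only [add_mul, map_add, ha, hb, LinearMap.add_apply]; abel
  | hsmul c a ha => simp only [smul_mul_assoc, map_smul, ha, LinearMap.smul_apply, smul_add]

/-- The tangent vector with prescribed values on the characters. -/
def tangentOfChi (y : Pt (AddMonoidAlgebra ℂ Γ)) (δ : Γ → ℂ)
    (h : ∀ m m', δ (m + m') = y (chi m) * δ m' + y (chi m') * δ m) : tangentSpace y :=
  ⟨linearOfChi δ, fun a b => by
    have := leibniz_of_chi ((LinearMap.mul ℂ ℂ) ∘ₗ y.toLinearMap) (linearOfChi δ)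
      (fun m m' => by simp [← chi_add, h]) a b
    simpa using this⟩

@[simp] theorem tangentOfChi_chi (y : Pt (AddMonoidAlgebra ℂ Γ)) (δ : Γ → ℂ)
    (h : ∀ m m', δ (m + m') = y (chi m) * δ m' + y (chi m') * δ m) (m : Γ) :
    (tangentOfChi y δ h : AddMonoidAlgebra ℂ Γ →ₗ[ℂ] ℂ) (chi m) = δ m := by
  simp [tangentOfChi]

theorem tangentSpace_ext_chi {y : Pt (AddMonoidAlgebra ℂ Γ)} {D E : tangentSpace y}
    (h : ∀ m, (D : AddMonoidAlgebra ℂ Γ →ₗ[ℂ] ℂ) (chi m) = (E : _ →ₗ[ℂ] ℂ) (chi m)) : D = E :=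
  Subtype.ext (linearMap_ext_chi h)

end Chi

/-! ## The face of a point and its tangent space -/

section Face

variable {M : Type*} [AddCommGroup M] {S : AddSubmonoid M}

/-- `K` is the group generated by the face of characters not vanishing at `y`, and `f` is an
interior point of that face. -/
structure IsFace (y : Pt (AddMonoidAlgebra ℂ S)) (K : Submodule ℤ M) (f : S) : Prop where
  ne_zero : y (chi f) ≠ 0
  exists_add_mem : ∀ k ∈ K, ∃ c : ℕ, k + c • (f : M) ∈ S
  ne_zero_iff : ∀ g : S, y (chi g) ≠ 0 ↔ (g : M) ∈ K

namespace IsFace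

variable {y : Pt (AddMonoidAlgebra ℂ S)} {K : Submodule ℤ M} {f : S} (hf : IsFace y K f)

include hf

theorem mem : (f : M) ∈ K := (hf.ne_zero_iff f).1 hf.ne_zero

/-- Each k in `K` is the difference of k + c f and c f, characters of the face at which `y` is
non-zero. So `y` extends from the face to a character of the group `K`. -/
theorem exists_character : ∃ w : K → ℂ, w 0 = 1 ∧ (∀ k k', w (k + k') = w k * w k') ∧
    ∀ g : S, ∀ hg : (g : M) ∈ K, w ⟨g, hg⟩ = y (chi g) := by
  choose c hc using hf.exists_add_mem
  have hw : ∀ (k : M) (hk : k ∈ K) (g : S) (n : ℕ), (g : M) = k + n • (f : M) →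
      y (chi g) = y (chi ⟨_, hc k hk⟩) / y (chi f) ^ c k hk * y (chi f) ^ n := by
    intro k hk g n hg
    have h1 : g + c k hk • f = ⟨_, hc k hk⟩ + n • f := by
      apply Subtype.ext
      simp only [AddSubmonoid.coe_add, AddSubmonoidClass.coe_nsmul, hg]
      abel
    have h2 := congrArg (fun z => y (chi z)) h1
    simp only [chi_add, map_mul, chi_nsmul, map_pow] at h2
    have := hf.ne_zero
    field_simp
    exact h2
  refine ⟨fun k => y (chi ⟨_, hc k k.2⟩) / y (chi f) ^ c k k.2, ?_, ?_, ?_⟩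
  · have := hw 0 K.zero_mem 0 0 (by simp)
    simp only [chi_zero, map_one, pow_zero, mul_one] at this
    exact this.symm
  · intro k k'
    have h1 := hw (k + k') (k + k').2 (⟨_, hc k k.2⟩ + ⟨_, hc k' k'.2⟩)
      (c k k.2 + c k' k'.2) (by simp only [AddSubmonoid.coe_add, add_smul]; abel)
    have h0 := hf.ne_zero
    simp only [chi_add, map_mul, pow_add] at h1
    simp only [Submodule.coe_add] at h1 ⊢
    have hne : y (chi f) ^ c k k.2 * y (chi f) ^ c k' k'.2 ≠ 0 :=
      mul_ne_zero (pow_ne_zero _ h0) (pow_ne_zero _ h0)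
    rw [div_mul_div_comm, h1, mul_div_cancel_right₀ _ hne]
  · intro g hg
    have := hw g hg g 0 (by simp)
    simpa using this.symm

open Classical in
-- These are the directions along the torus orbit of `y`: `l` prescribes the logarithmic derivative
-- on the face. Leibniz holds because a sum of elements of `S` lies in the face only if both
-- summands do.
theorem exists_tangent_of_linear (l : K →ₗ[ℤ] ℂ) : ∃ D : tangentSpace y, ∀ g : S,
    (D : AddMonoidAlgebra ℂ S →ₗ[ℂ] ℂ) (chi g) =
      if h : (g : M) ∈ K then l ⟨g, h⟩ * y (chi g) else 0 := by
  refine ⟨tangentOfChi y (fun g => if h : (g : M) ∈ K then l ⟨g, h⟩ * y (chi g) else 0) ?_,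
    fun g => tangentOfChi_chi _ _ _ g⟩
  intro m m'
  by_cases hm : (m : M) ∈ K
  · by_cases hm' : (m' : M) ∈ K
    · have h : (m : M) + m' ∈ K := K.add_mem hm hm'
      have hl : l ⟨(m : M) + m', h⟩ = l ⟨m, hm⟩ + l ⟨m', hm'⟩ := by rw [← map_add]; rfl
      rw [dif_pos hm, dif_pos hm', dif_pos (show ((m + m' : S) : M) ∈ K from h), chi_add, map_mul]
      change l ⟨(m : M) + m', h⟩ * _ = _
      rw [hl]
      ring
    · have h : (m : M) + m' ∉ K := fun h => hm' ((K.add_mem_iff_right hm).1 h)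
      have h0 : y (chi m') = 0 := by simpa using (hf.ne_zero_iff m').not.2 hm'
      simp [AddSubmonoid.coe_add, h, hm', h0]
  · have h0 : y (chi m) = 0 := by simpa using (hf.ne_zero_iff m).not.2 hm
    have h : ((m + m' : S) : M) ∉ K := by
      rw [← hf.ne_zero_iff, chi_add, map_mul, h0]; simp
    simp only [AddSubmonoid.coe_add] at h
    simp [AddSubmonoid.coe_add, h, hm, h0]

open Classical in
-- A direction transverse to the orbit, supported on the coset h + K. Irreducibility of that coset
-- ensures that a product of two characters vanishing at `y` never reaches it, which is what Leibniz
-- demands.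
theorem exists_tangent_of_irreducible (h : S) (hK : (h : M) ∉ K)
    (hirr : ∀ m m' : S, (m : M) + m' - h ∈ K → (m : M) ∈ K ∨ (m' : M) ∈ K) :
    ∃ D : tangentSpace y, (D : AddMonoidAlgebra ℂ S →ₗ[ℂ] ℂ) (chi h) = 1 ∧
      ∀ g : S, (g : M) - h ∉ K → (D : AddMonoidAlgebra ℂ S →ₗ[ℂ] ℂ) (chi g) = 0 := by
  obtain ⟨w, hw0, hwadd, hwy⟩ := hf.exists_character
  have hnot : ∀ g : S, (g : M) ∈ K → (g : M) - h ∉ K := fun g hg hgh => hK (by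
    have := K.sub_mem hg hgh
    simpa using this)
  refine ⟨tangentOfChi y (fun g => if hg : (g : M) - h ∈ K then w ⟨_, hg⟩ else 0) ?_, ?_, ?_⟩
  · have key : ∀ m m' : S, (m : M) ∈ K →
        (if hg : ((m + m' : S) : M) - h ∈ K then w ⟨_, hg⟩ else 0) =
        y (chi m) * (if hg : (m' : M) - h ∈ K then w ⟨_, hg⟩ else 0) := by
      intro m m' hm
      have he : ((m + m' : S) : M) - h = m + (m' - h) := by
        simp only [AddSubmonoid.coe_add]; abel
      by_cases hm' : (m' : M) - h ∈ K
      · have h1 : ((m + m' : S) : M) - h ∈ K := by rw [he]; exact K.add_mem hm hm'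
        simp only [h1, hm', dite_true]
        rw [← hwy m hm, ← hwadd]
        congr 1
        exact Subtype.ext he
      · have h1 : ((m + m' : S) : M) - h ∉ K := by
          rw [he]; exact fun h' => hm' ((K.add_mem_iff_right hm).1 h')
        simp only [h1, hm', dite_false, mul_zero]
    intro m m'
    by_cases hm : (m : M) ∈ K
    · rw [key m m' hm, dif_neg (hnot m hm), mul_zero, add_zero]
    · by_cases hm' : (m' : M) ∈ K
      · rw [add_comm m m', key m' m hm', dif_neg (hnot m' hm'), mul_zero, zero_add]
      · have h0 : y (chi m) = 0 := by simpa using (hf.ne_zero_iff m).not.2 hm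
        have h0' : y (chi m') = 0 := by simpa using (hf.ne_zero_iff m').not.2 hm'
        rw [dif_neg (fun h' : ((m + m' : S) : M) - h ∈ K => (hirr m m' h').elim hm hm'), h0, h0']
        simp
  · simp only [tangentOfChi_chi, sub_self, K.zero_mem, dite_true]
    exact hw0
  · intro g hg
    simp [hg]

/-- Orbit directions and transverse directions are independent: at `h i` only the i-th transverse
vector is non-zero, and what remains is tested on the face. -/
theorem finrank_add_card_le [Module.Free ℤ M] [Module.Finite ℤ M]
    [Module.Finite ℂ (tangentSpace y)]
    {ι : Type*} [Fintype ι] (h : ι → S) (hK : ∀ i, (h i : M) ∉ K)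
    (hinj : ∀ i j, (h i : M) - h j ∈ K → i = j)
    (hirr : ∀ i, ∀ m m' : S, (m : M) + m' - h i ∈ K → (m : M) ∈ K ∨ (m' : M) ∈ K) :
    Module.finrank ℤ K + Fintype.card ι ≤ Module.finrank ℂ (tangentSpace y) := by
  classical
  let bK := Module.finBasis ℤ K
  choose E hE using fun i => hf.exists_tangent_of_linear
    ((Algebra.linearMap ℤ ℂ) ∘ₗ (bK.coord i))
  choose D hD hD0 using fun i => hf.exists_tangent_of_irreducible (h i) (hK i) (hirr i)
  have hli : LinearIndependent ℂ (Sum.elim E D) := by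
    rw [Fintype.linearIndependent_iff]
    intro c hc
    simp only [Fintype.sum_sum_type, Sum.elim_inl, Sum.elim_inr] at hc
    have hc' : ∀ g : S, ∑ i, c (Sum.inl i) * (E i : AddMonoidAlgebra ℂ S →ₗ[ℂ] ℂ) (chi g) +
        ∑ i, c (Sum.inr i) * (D i : AddMonoidAlgebra ℂ S →ₗ[ℂ] ℂ) (chi g) = 0 := by
      intro g
      have := congrArg (fun F : tangentSpace y =>
        (F : AddMonoidAlgebra ℂ S →ₗ[ℂ] ℂ) (chi g)) hc
      simpa using this
    have hr : ∀ i, c (Sum.inr i) = 0 := by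
      intro i
      have := hc' (h i)
      rw [Finset.sum_eq_zero, zero_add, Finset.sum_eq_single i] at this
      · simpa [hD] using this
      · intro j _ hj
        rw [hD0 j (h i) (fun h' => hj (hinj i j h').symm), mul_zero]
      · simp
      · intro j _
        rw [hE, dif_neg (hK i), mul_zero]
    have hl : ∀ g : S, ∀ hg : (g : M) ∈ K, ∑ i, c (Sum.inl i) * (bK.repr ⟨g, hg⟩ i : ℂ) = 0 := by
      intro g hg
      have h1 := hc' g
      simp only [hr, zero_mul, Finset.sum_const_zero, add_zero, hE, hg, dite_true] at h1
      have h2 : (∑ i, c (Sum.inl i) * (bK.repr ⟨g, hg⟩ i : ℂ)) * y (chi g) = 0 := by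
        rw [Finset.sum_mul, ← h1]
        exact Finset.sum_congr rfl fun i _ => by simp [mul_assoc]
      exact (mul_eq_zero.1 h2).resolve_right ((hf.ne_zero_iff g).2 hg)
    rintro (i | i)
    -- The basis vector itself need not lie in `S`; it is tested as the difference of two elements
    -- of the face.
    · obtain ⟨n, hn⟩ := hf.exists_add_mem (bK i) (bK i).2
      have h1 := hl ⟨_, hn⟩ (K.add_mem (bK i).2 (K.smul_of_tower_mem n hf.mem))
      have h2 := hl f hf.mem
      have h3 : (⟨(bK i : M) + n • (f : M), (K.add_mem (bK i).2 (K.smul_of_tower_mem n hf.mem))⟩ : K)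
        = bK i + n • ⟨f, hf.mem⟩ := rfl
      simp only [h3, map_add, map_nsmul, Finsupp.add_apply, Finsupp.smul_apply, Int.cast_add,
        mul_add, Finset.sum_add_distrib, Module.Basis.repr_self, nsmul_eq_mul, Int.cast_mul,
        Int.cast_natCast, mul_left_comm _ (n : ℂ), ← Finset.mul_sum, h2] at h1
      simpa [Finsupp.single_apply] using h1
    · exact hr i
  have := hli.fintype_card_le_finrank
  simpa using this

end IsFace
end Face
end


noncomputable section

/-! ## Toric charts at points with small tangent space -/

section Gorenstein

variable {M : Type*} [AddCommGroup M]

/-- `S` is cut out by the functionals in `U`, all of which take the value `1` at `e`. -/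
structure IsGorenstein (S : AddSubmonoid M) (U : Finset (M →+ ℤ)) (e : M) : Prop where
  mem_iff : ∀ m, m ∈ S ↔ ∀ u ∈ U, 0 ≤ u m
  apply_eq_one : ∀ u ∈ U, u e = 1

/-- A toric chart `ℂ^J × (ℂ^×)^(ι ∖ J)` at the point `y`: the dual monoid becomes
`ℕ^J × ℤ^(ι ∖ J)` after inverting `f`, and `y` lies in its closed orbit. -/
structure IsChart {S : AddSubmonoid M} (y : Pt (AddMonoidAlgebra ℂ S)) {ι : Type*}
    (b : Module.Basis ι ℤ M) (J : Set ι) (f : S) : Prop where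
  ne_zero : y (chi f) ≠ 0
  nonneg : ∀ m ∈ S, ∀ j ∈ J, 0 ≤ b.repr m j
  eq_zero : ∀ m : S, y (chi m) ≠ 0 → ∀ j ∈ J, b.repr m j = 0
  exists_add_mem : ∀ m : M, (∀ j ∈ J, 0 ≤ b.repr m j) → ∃ c : ℕ, m + c • (f : M) ∈ S

theorem IsChart.reindex {S : AddSubmonoid M} {y : Pt (AddMonoidAlgebra ℂ S)} {ι κ : Type*}
    {b : Module.Basis ι ℤ M} {J : Set ι} {f : S} (h : IsChart y b J f) (σ : ι ≃ κ) :
    IsChart y (b.reindex σ) (σ '' J) f where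
  ne_zero := h.ne_zero
  nonneg := by
    rintro m hm _ ⟨j, hj, rfl⟩
    simpa using h.nonneg m hm j hj
  eq_zero := by
    rintro m hm _ ⟨j, hj, rfl⟩
    simpa using h.eq_zero m hm j hj
  exists_add_mem := fun m hm => h.exists_add_mem m fun j hj => by
    simpa using hm (σ j) ⟨j, hj, rfl⟩

namespace IsGorenstein

variable {S : AddSubmonoid M} {U : Finset (M →+ ℤ)} {e : M} (h : IsGorenstein S U e)

include h

theorem mem : e ∈ S := (h.mem_iff e).2 fun u hu => by rw [h.apply_eq_one u hu]; exact zero_le_one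

theorem add_nsmul_mem {m f : M} (hf : ∀ u ∈ U, 0 ≤ u f)
    (hm : ∀ u ∈ U, 0 ≤ u m ∨ 1 ≤ u f) : ∃ c : ℕ, m + c • f ∈ S := by
  -- This multiple dominates |u m| for all `u` at once.
  refine ⟨∑ u ∈ U, (u m).natAbs, (h.mem_iff _).2 fun u hu => ?_⟩
  rw [map_add, map_nsmul, nsmul_eq_mul]
  have h1 : (u m).natAbs ≤ ∑ u ∈ U, (u m).natAbs :=
    Finset.single_le_sum (f := fun u : M →+ ℤ => (u m).natAbs) (fun _ _ => Nat.zero_le _) hu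
  rcases hm u hu with h2 | h2
  · have := mul_nonneg (Int.natCast_nonneg (∑ u ∈ U, (u m).natAbs)) (hf u hu)
    omega
  · have h3 : ((∑ u ∈ U, (u m).natAbs : ℕ) : ℤ) ≤ ((∑ u ∈ U, (u m).natAbs : ℕ) : ℤ) * u f :=
      le_mul_of_one_le_right (Int.natCast_nonneg _) h2
    omega

theorem add_nsmul_e_mem (m : M) : ∃ c : ℕ, m + c • e ∈ S :=
  h.add_nsmul_mem (fun u hu => by rw [h.apply_eq_one u hu]; exact zero_le_one)
    fun u hu => Or.inr (h.apply_eq_one u hu).ge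

open Classical in
-- `T` consists of the functionals vanishing on every character that is non-zero at `y`. For each
-- other functional some such character is positive on it; the sum of these is the interior point
-- `f`.
theorem exists_face (y : Pt (AddMonoidAlgebra ℂ S)) :
    ∃ (T : Finset (M →+ ℤ)) (K : Submodule ℤ M) (f : S), T ⊆ U ∧ (∀ m, m ∈ K ↔ ∀ u ∈ T, u m = 0) ∧
      (∀ m, (∀ u ∈ T, 0 ≤ u m) → ∃ c : ℕ, m + c • (f : M) ∈ S) ∧ IsFace y K f := by
  let T := U.filter fun u => ∀ g : S, y (chi g) ≠ 0 → u g = 0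
  have hex : ∀ u : M →+ ℤ, ∃ g : S, y (chi g) ≠ 0 ∧ (u ∈ U → u ∈ T ∨ 1 ≤ u g) := by
    intro u
    by_cases hu : u ∈ T
    · exact ⟨0, by simp [chi_zero], fun _ => Or.inl hu⟩
    · by_cases huU : u ∈ U
      · have : ¬ ∀ g : S, y (chi g) ≠ 0 → u g = 0 := fun h' => hu (by simp [T, huU]; simpa using h')
        push Not at this
        obtain ⟨g, hg, hug⟩ := this
        refine ⟨g, hg, fun _ => Or.inr ?_⟩
        have := (h.mem_iff g).1 g.2 u huU
        omega
      · exact ⟨0, by simp [chi_zero], fun h' => absurd h' huU⟩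
  choose g hg0 hg using hex
  let f : S := ∑ u ∈ U, g u
  have hf0 : y (chi f) ≠ 0 := by
    rw [chi_sum, map_prod]
    exact Finset.prod_ne_zero_iff.2 fun u _ => hg0 u
  have hfU : ∀ u ∈ U, 0 ≤ u f := (h.mem_iff f).1 f.2
  have hfT : ∀ u ∈ U, u ∈ T ∨ 1 ≤ u f := by
    intro u hu
    refine (hg u hu).imp_right fun h1 => h1.trans ?_
    have : u f = ∑ v ∈ U, u (g v) := by
      rw [← map_sum]; congr 1; simp [f]
    rw [this]
    exact Finset.single_le_sum (f := fun v => u (g v))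
      (fun v _ => (h.mem_iff _).1 (g v).2 u hu) hu
  let K : Submodule ℤ M := AddSubgroup.toIntSubmodule
    { carrier := {m | ∀ u ∈ T, u m = 0}
      add_mem' := fun {a b} ha hb u hu => by rw [map_add, ha u hu, hb u hu, add_zero]
      zero_mem' := fun u _ => map_zero u
      neg_mem' := fun {a} ha u hu => by rw [map_neg, ha u hu, neg_zero] }
  have hK : ∀ m, m ∈ K ↔ ∀ u ∈ T, u m = 0 := fun m => Iff.rfl
  have hA : ∀ m, (∀ u ∈ T, 0 ≤ u m) → ∃ c : ℕ, m + c • (f : M) ∈ S := fun m hm =>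
    h.add_nsmul_mem hfU fun u hu => (hfT u hu).imp_left (hm u)
  refine ⟨T, K, f, Finset.filter_subset _ _, hK, hA, hf0, ?_, ?_⟩
  · exact fun k hk => hA k fun u hu => ((hK k).1 hk u hu).ge
  · intro g'
    refine ⟨fun hg' => (hK _).2 fun u hu => (Finset.mem_filter.1 hu).2 g' hg', fun hg' => ?_⟩
    -- A character in `K` divides a power of χ^f, so it cannot vanish at `y`.
    obtain ⟨c, hc⟩ := hA (-g') fun u hu => by rw [map_neg, (hK _).1 hg' u hu, neg_zero]
    have h1 : g' + ⟨_, hc⟩ = c • f := by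
      apply Subtype.ext
      simp only [AddSubmonoid.coe_add, AddSubmonoidClass.coe_nsmul]
      abel
    intro h0
    have h2 := congrArg (fun z => y (chi z)) h1
    simp only [chi_add, map_mul, h0, zero_mul, chi_nsmul, map_pow] at h2
    exact pow_ne_zero c hf0 h2.symm

/-- The irreducible classes generate the image of `S` in M/K. `finrank_add_card_le` and the bound on
the tangent space leave room for at most rank(M/K) of them, so being a spanning set they form a
basis. Thus the image of `S` is a free monoid ℕ^H. -/
theorem exists_isChart [Module.Free ℤ M] [Module.Finite ℤ M] (y : Pt (AddMonoidAlgebra ℂ S))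
    [Module.Finite ℂ (tangentSpace y)]
    (hy : Module.finrank ℂ (tangentSpace y) ≤ Module.finrank ℤ M) :
    ∃ (b : Module.Basis (Fin (Module.finrank ℤ M)) ℤ M) (J : Set (Fin (Module.finrank ℤ M)))
      (f : S), IsChart y b J f := by
  classical
  obtain ⟨T, K, f, hTU, hK, hA, hface⟩ := h.exists_face y
  have hUS : ∀ m ∈ S, ∀ u ∈ T, 0 ≤ u m := fun m hm u hu => (h.mem_iff m).1 hm u (hTU hu)
  -- A grading that is zero on `K` and at least 1 on the rest of `S`, so decomposing into
  -- irreducibles terminates.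
  let deg : M →+ ℤ := ∑ u ∈ T, u
  have hdeg : ∀ m, deg m = ∑ u ∈ T, u m := fun m => by simp [deg]
  have hdeg0 : ∀ m ∈ S, 0 ≤ deg m := fun m hm => by
    rw [hdeg]; exact Finset.sum_nonneg (hUS m hm)
  have hdegK : ∀ m ∈ K, deg m = 0 := fun m hm => by
    rw [hdeg]; exact Finset.sum_eq_zero ((hK m).1 hm)
  have hdegpos : ∀ m ∈ S, m ∉ K → 1 ≤ deg m := fun m hm hmK => by
    by_contra hlt
    have h0 : deg m = 0 := by have := hdeg0 m hm; omega
    rw [hdeg, Finset.sum_eq_zero_iff_of_nonneg (hUS m hm)] at h0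
    exact hmK ((hK m).2 h0)
  have hmk : ∀ a b : M, (Submodule.Quotient.mk a : M ⧸ K) = Submodule.Quotient.mk b ↔ a - b ∈ K :=
    fun a b => Submodule.Quotient.eq K
  -- irreducible classes
  let H : Set (M ⧸ K) := {q | q ≠ 0 ∧ (∃ m : S, Submodule.Quotient.mk (m : M) = q) ∧
    ∀ m m' : S, (Submodule.Quotient.mk (m : M) : M ⧸ K) + Submodule.Quotient.mk (m' : M) = q →
      (m : M) ∈ K ∨ (m' : M) ∈ K}
  have hgen : ∀ (n : ℕ) (m : S), deg m = n →
      (Submodule.Quotient.mk (m : M) : M ⧸ K) ∈ AddSubmonoid.closure H := by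
    intro n
    induction n using Nat.strong_induction_on with
    | _ n ih =>
      intro m hm
      by_cases hmK : (m : M) ∈ K
      · rw [(Submodule.Quotient.mk_eq_zero K).2 hmK]; exact zero_mem _
      by_cases hmH : (Submodule.Quotient.mk (m : M) : M ⧸ K) ∈ H
      · exact AddSubmonoid.subset_closure hmH
      have : ¬ ∀ m₁ m₂ : S, (Submodule.Quotient.mk (m₁ : M) : M ⧸ K) +
          Submodule.Quotient.mk (m₂ : M) = Submodule.Quotient.mk (m : M) →
          (m₁ : M) ∈ K ∨ (m₂ : M) ∈ K := fun h' =>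
        hmH ⟨fun h0 => hmK ((Submodule.Quotient.mk_eq_zero K).1 h0), ⟨m, rfl⟩, h'⟩
      push Not at this
      obtain ⟨m₁, m₂, h12, h1, h2⟩ := this
      have hd : deg m = deg m₁ + deg m₂ := by
        rw [← Submodule.Quotient.mk_add, hmk] at h12
        have := hdegK _ h12
        rw [map_sub, map_add] at this
        omega
      have p1 := hdegpos _ m₁.2 h1
      have p2 := hdegpos _ m₂.2 h2
      rw [← h12]
      exact add_mem (ih (deg m₁).toNat (by omega) m₁ (by omega))
        (ih (deg m₂).toNat (by omega) m₂ (by omega))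
  have hgen' : ∀ m : S, (Submodule.Quotient.mk (m : M) : M ⧸ K) ∈ AddSubmonoid.closure H :=
    fun m => hgen (deg m).toNat m (by have := hdeg0 m m.2; omega)
  have hcard : ∀ A : Finset (M ⧸ K), (A : Set (M ⧸ K)) ⊆ H →
      A.card ≤ Module.finrank ℤ (M ⧸ K) := by
    intro A hAH
    choose g hg using fun i : A => (hAH i.2).2.1
    have h1 := hface.finrank_add_card_le (ι := A) g
      (fun i hi => (hAH i.2).1 (by rw [← hg i]; exact (Submodule.Quotient.mk_eq_zero K).2 hi))
      (fun i j hij => Subtype.ext (by rw [← hg i, ← hg j]; exact (hmk _ _).2 hij))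
      (fun i m m' hmm => (hAH i.2).2.2 m m' (by
        rw [← hg i, ← Submodule.Quotient.mk_add]; exact (hmk _ _).2 hmm))
    have h2 := Submodule.finrank_quotient_add_finrank K
    rw [Fintype.card_coe] at h1
    omega
  have hfin : H.Finite := by
    by_contra hinf
    obtain ⟨A, hAH, hA⟩ := Set.Infinite.exists_subset_card_eq hinf (Module.finrank ℤ (M ⧸ K) + 1)
    have := hcard A hAH
    omega
  have : Fintype H := hfin.fintype
  have hHcard : Fintype.card H ≤ Module.finrank ℤ (M ⧸ K) := by
    rw [← Set.toFinset_card]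
    exact hcard _ (by simp)
  -- `K` is the common kernel of functionals with values in ℤ, hence saturated.
  have htf : Module.IsTorsionFree ℤ (M ⧸ K) := by
    rw [Module.isTorsionFree_iff_smul_eq_zero]
    intro n q hq
    by_cases hn : n = 0
    · exact Or.inl hn
    · refine Or.inr ?_
      obtain ⟨m, rfl⟩ := Submodule.Quotient.mk_surjective K q
      rw [← Submodule.Quotient.mk_smul, Submodule.Quotient.mk_eq_zero, hK] at hq
      rw [Submodule.Quotient.mk_eq_zero, hK]
      intro u hu
      have := hq u hu
      rw [map_zsmul, smul_eq_mul] at this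
      exact (mul_eq_zero.1 this).resolve_left hn
  have hfree : Module.Free ℤ (M ⧸ K) := Module.free_of_finite_type_torsion_free'
  have hspan : ⊤ ≤ Submodule.span ℤ (Set.range ((↑) : H → M ⧸ K)) := by
    rintro q -
    obtain ⟨m, rfl⟩ := Submodule.Quotient.mk_surjective K q
    have hle : AddSubmonoid.closure H ≤ (Submodule.span ℤ H).toAddSubmonoid :=
      AddSubmonoid.closure_le.2 Submodule.subset_span
    rw [Subtype.range_coe]
    -- `S` generates M as a group, since m = (m + c e) - c e.
    obtain ⟨c, hc⟩ := h.add_nsmul_e_mem m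
    have h1 := hle (hgen' ⟨_, hc⟩)
    have h2 := hle (hgen' (c • ⟨e, h.mem⟩))
    have h3 : (Submodule.Quotient.mk m : M ⧸ K) = Submodule.Quotient.mk (m + c • e) -
        Submodule.Quotient.mk (c • e) := by
      rw [← Submodule.Quotient.mk_sub]; simp
    rw [h3]
    exact (Submodule.span ℤ H).sub_mem h1 h2
  let bQ : Module.Basis H ℤ (M ⧸ K) := Module.Basis.mk
    (linearIndependent_of_top_le_span_of_card_le_finrank hspan hHcard) hspan
  have hbQ : ∀ q : H, bQ q = q := fun q => by simp [bQ]
  let b := (Module.finBasis ℤ K).sumQuot bQ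
  have hbr : ∀ m q, b.repr m (Sum.inr q) = bQ.repr (Submodule.Quotient.mk m) q := by
    intro m q
    exact Module.Basis.sumQuot_repr_inr _ _ _ _
  have hQnonneg : ∀ x ∈ AddSubmonoid.closure H, ∀ q, 0 ≤ bQ.repr x q := by
    intro x hx q
    induction hx using AddSubmonoid.closure_induction with
    | mem x hx =>
      have := bQ.repr_self ⟨x, hx⟩
      rw [hbQ] at this
      simp only at this
      rw [this, Finsupp.single_apply]
      split_ifs <;> simp
    | zero => simp
    | add x y _ _ hx hy => rw [map_add, Finsupp.add_apply]; exact add_nonneg hx hy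
  have hchart : IsChart y b (Set.range Sum.inr) f := by
    refine ⟨hface.ne_zero, ?_, ?_, ?_⟩
    · rintro m hm _ ⟨q, rfl⟩
      rw [hbr]
      exact hQnonneg _ (hgen' ⟨m, hm⟩) q
    · rintro m hm _ ⟨q, rfl⟩
      rw [hbr, (Submodule.Quotient.mk_eq_zero K).2 ((hface.ne_zero_iff m).1 hm)]
      simp
    · intro m hm
      refine hA m fun u hu => ?_
      -- Modulo `K`, such an m is a non-negative combination of elements of `S`, and the functionals
      -- in `T` depend only on the class modulo `K`.
      choose g hg using fun q : H => q.2.2.1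
      have h1 : (Submodule.Quotient.mk m : M ⧸ K) =
          Submodule.Quotient.mk (∑ q, bQ.repr (Submodule.Quotient.mk m) q • (g q : M)) := by
        rw [← Submodule.mkQ_apply, ← Submodule.mkQ_apply, map_sum]
        simp only [map_smul, Submodule.mkQ_apply, hg]
        conv_lhs => rw [← bQ.sum_repr (Submodule.Quotient.mk m)]
        simp only [hbQ]
      have h2 := (hK _).1 ((hmk _ _).1 h1) u hu
      rw [map_sub, sub_eq_zero] at h2
      rw [h2, map_sum]
      refine Finset.sum_nonneg fun q _ => ?_
      rw [map_zsmul, smul_eq_mul]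
      refine mul_nonneg ?_ (hUS _ (g q).2 u hu)
      rw [← hbr]
      exact hm _ ⟨q, rfl⟩
  have hcardι : Fintype.card (Fin (Module.finrank ℤ K) ⊕ H) = Module.finrank ℤ M :=
    (Module.finrank_eq_card_basis b).symm
  exact ⟨_, _, f, hchart.reindex (Fintype.equivFinOfCardEq hcardι)⟩

end IsGorenstein
end Gorenstein
end


noncomputable section

/-! ## Local coordinates at points with a toric chart -/

section Coordinates

/-- The tangent vector at `y` given by a derivation. -/
def Derivation.toTangent {B : Type*} [CommRing B] [Algebra ℂ B] (E : Derivation ℂ B B) (y : Pt B) :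
    tangentSpace y :=
  ⟨y.toLinearMap ∘ₗ (E : B →ₗ[ℂ] B), fun a b => by simp⟩

@[simp] theorem Derivation.toTangent_apply {B : Type*} [CommRing B] [Algebra ℂ B]
    (E : Derivation ℂ B B) (y : Pt B) (a : B) :
    (E.toTangent y : B →ₗ[ℂ] ℂ) a = y (E a) := rfl

variable {M : Type*} [AddCommGroup M]

/-- Toric coordinates `chi (β i)` in a neighbourhood `f ≠ 0` of `y`, together with a frame `E` of
the tangent bundle and monomials `g`, `s` without zeros such that `g ∏ β = s e`. -/
structure LocalCoords {S : AddSubmonoid M} (e : M) {ι : Type*} [Fintype ι] [DecidableEq ι]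
    (b₀ : Module.Basis ι ℤ M) (y : Pt (AddMonoidAlgebra ℂ S)) where
  f : S
  β : ι → S
  E : ι → Derivation ℂ (AddMonoidAlgebra ℂ S) (AddMonoidAlgebra ℂ S)
  g : S
  s : S
  ne_zero : y (chi f) ≠ 0
  linearIndependent : ∀ y' : Pt (AddMonoidAlgebra ℂ S), y' (chi f) ≠ 0 →
    LinearIndependent ℂ fun i => (E i).toTangent y'
  ext_coord : ∀ y' : Pt (AddMonoidAlgebra ℂ S), y' (chi f) ≠ 0 → ∀ D : tangentSpace y',
    (∀ i, (D : AddMonoidAlgebra ℂ S →ₗ[ℂ] ℂ) (chi (β i)) = 0) → D = 0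
  sum_eq : (g : M) + ∑ i, (β i : M) = s + e
  g_ne_zero : ∀ y' : Pt (AddMonoidAlgebra ℂ S), y' (chi f) ≠ 0 → y' (chi g) ≠ 0
  s_ne_zero : ∀ y' : Pt (AddMonoidAlgebra ℂ S), y' (chi f) ≠ 0 → y' (chi s) ≠ 0
  det_ne_zero : b₀.det (fun i => (β i : M)) ≠ 0

/-- In the basis `b` the matrix is the identity plus a matrix of rank one, with determinant 1 + c Σ
f_i. The proof shows directly that a kernel vector must vanish. -/
theorem det_add_smul_ne_zero {ι : Type*} [Fintype ι] [DecidableEq ι]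
    (b₀ b : Module.Basis ι ℤ M) (c : ℤ) (f : M) (h : 1 + c * ∑ i, b.repr f i ≠ 0) :
    b₀.det (fun i => b i + c • f) ≠ 0 := by
  rw [Module.Basis.det_apply]
  intro h0
  obtain ⟨v, hv, hv0⟩ := Matrix.exists_mulVec_eq_zero_iff.2 h0
  apply hv
  have h1 : ∑ k, v k • (b k + c • f) = 0 := by
    apply b₀.ext_elem
    intro i
    have := congrFun hv0 i
    simp only [Matrix.mulVec, dotProduct, Module.Basis.toMatrix_apply, Pi.zero_apply] at this
    rw [map_sum, Finsupp.finsetSum_apply, map_zero, Finsupp.zero_apply, ← this]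
    exact Finset.sum_congr rfl fun k _ => by rw [map_zsmul, Finsupp.smul_apply, smul_eq_mul, mul_comm]
  have h2 : ∀ i, v i + (∑ k, v k) * c * b.repr f i = 0 := by
    intro i
    have := congrArg (fun m => b.repr m i) h1
    simp only [smul_add, Finset.sum_add_distrib, map_add, map_sum, map_zsmul, Finsupp.add_apply,
      Finsupp.finsetSum_apply, Finsupp.smul_apply, smul_eq_mul, Module.Basis.repr_self,
      map_zero, Finsupp.zero_apply] at this
    rw [Finset.sum_eq_single i (by intro k _ hk; simp [hk]) (by simp)] at this
    simp only [Finsupp.single_eq_same, mul_one] at this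
    rw [Finset.sum_mul, Finset.sum_mul]
    simpa [mul_assoc] using this
  have h3 : (∑ k, v k) * (1 + c * ∑ i, b.repr f i) = 0 := by
    have := Finset.sum_eq_zero (s := Finset.univ) fun i _ => h2 i
    rw [Finset.sum_add_distrib, ← Finset.mul_sum] at this
    linear_combination this
  have h4 := (mul_eq_zero.1 h3).resolve_right h
  ext i
  simpa [h4] using h2 i

namespace IsChart

variable {S : AddSubmonoid M} {y : Pt (AddMonoidAlgebra ℂ S)} {ι : Type*} [Fintype ι]
  [DecidableEq ι] {b : Module.Basis ι ℤ M} {J : Set ι} {f : S} {U : Finset (M →+ ℤ)} {e : M}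
  (hc : IsChart y b J f)

include hc

omit [Fintype ι] [DecidableEq ι] in
theorem repr_f {j : ι} (hj : j ∈ J) : b.repr f j = 0 := hc.eq_zero f hc.ne_zero j hj

omit [Fintype ι] [DecidableEq ι] in
-- Such a monomial divides a power of χ^f, because -m + c f lies in `S` for some c.
theorem ne_zero_of_repr {m : S} (hm : ∀ j ∈ J, b.repr m j = 0) {y' : Pt (AddMonoidAlgebra ℂ S)}
    (hy' : y' (chi f) ≠ 0) : y' (chi m) ≠ 0 := by
  obtain ⟨c, h⟩ := hc.exists_add_mem (-m) fun j hj => by simp [hm j hj]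
  have h1 : m + ⟨_, h⟩ = c • f := by
    apply Subtype.ext
    simp only [AddSubmonoid.coe_add, AddSubmonoidClass.coe_nsmul]
    abel
  intro h0
  have h2 := congrArg (fun z => y' (chi z)) h1
  simp only [chi_add, map_mul, h0, zero_mul, chi_nsmul, map_pow] at h2
  exact pow_ne_zero c hy' h2.symm

/-- On a Gorenstein toric variety, `e` is the sum of the coordinates of a chart, up to units. -/
theorem repr_e (h : IsGorenstein S U e) {j : ι} (hj : j ∈ J) : b.repr e j = 1 := by
  choose c hcm using fun k => hc.exists_add_mem (b k) (fun j _ => by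
    rw [Module.Basis.repr_self, Finsupp.single_apply]; split_ifs <;> simp)
  let β : ι → S := fun k => ⟨_, hcm k⟩
  -- `g` lies over the coordinate hyperplane of `j`, with every other coordinate direction added in;
  -- a functional vanishing on it sees only the j-th coordinate.
  let g : S := f + ∑ k ∈ Finset.univ.erase j, β k
  have hgj : b.repr g j = 0 := by
    have : (g : M) = f + ∑ k ∈ Finset.univ.erase j, (b k + c k • (f : M)) := by
      simp [g, β]
    rw [this, map_add, map_sum, Finsupp.add_apply, hc.repr_f hj, Finsupp.finsetSum_apply,
      Finset.sum_eq_zero, add_zero]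
    intro k hk
    have hkj : k ≠ j := Finset.ne_of_mem_erase hk
    rw [map_add, map_nsmul, Finsupp.add_apply, Finsupp.smul_apply, hc.repr_f hj]
    simp [hkj.symm]
  have hgU : ∀ u ∈ U, 0 ≤ u g := (h.mem_iff _).1 g.2
  -- Were every functional positive on `g`, some -b_j + n g would lie in `S` although its j-th
  -- coordinate is -1.
  have hex : ∃ u ∈ U, u g = 0 := by
    by_contra hne
    push Not at hne
    obtain ⟨n, hn⟩ := h.add_nsmul_mem (m := -(b j)) hgU fun u hu => Or.inr (by
      have h1 := hgU u hu
      have h2 := hne u hu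
      omega)
    have := hc.nonneg _ hn j hj
    rw [map_add, map_neg, map_nsmul, Finsupp.add_apply, Finsupp.smul_apply, hgj] at this
    simp at this
  obtain ⟨u, huU, hug⟩ := hex
  have hUS : ∀ m : S, 0 ≤ u m := fun m => (h.mem_iff _).1 m.2 u huU
  have hg : (g : M) = f + ∑ k ∈ Finset.univ.erase j, (β k : M) := by simp [g]
  rw [hg, map_add, map_sum] at hug
  have hs := Finset.sum_nonneg (s := Finset.univ.erase j) fun k _ => hUS (β k)
  have huf : u f = 0 := by have := hUS f; omega
  have huβ : ∀ k ∈ Finset.univ.erase j, u (β k) = 0 :=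
    (Finset.sum_eq_zero_iff_of_nonneg fun k _ => hUS (β k)).1 (by omega)
  have hub : ∀ k, k ≠ j → u (b k) = 0 := by
    intro k hk
    have := huβ k (Finset.mem_erase.2 ⟨hk, Finset.mem_univ k⟩)
    simpa [β, huf] using this
  -- The functional kills all b_k with k ≠ j, so 1 = u(e) is a product of two integers one of which
  -- is the j-th coordinate of `e`.
  have hue : u e = b.repr e j * u (b j) := by
    conv_lhs => rw [← b.sum_repr e]
    rw [map_sum, Finset.sum_eq_single j]
    · rw [map_zsmul, smul_eq_mul]
    · intro k _ hk; rw [map_zsmul, hub k hk, smul_zero]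
    · simp
  rw [h.apply_eq_one u huU] at hue
  have h0 := hc.nonneg e h.mem j hj
  rcases Int.eq_one_or_neg_one_of_mul_eq_one hue.symm with h1 | h1 <;> omega

/-- One exponent serves all m in `S`: the value of `u` at m - b_k is at least -|u(b_k)|, whatever m
is. This makes χ^(cf) ∂/∂x_k a derivation of the coordinate ring. -/
theorem exists_uniform (h : IsGorenstein S U e) : ∃ c₀ : ℕ, ∀ c ≥ c₀,
    (∀ k, b k + c • (f : M) ∈ S) ∧
    ∀ k ∈ J, ∀ m ∈ S, 1 ≤ b.repr m k → m - b k + c • (f : M) ∈ S := by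
  have hfU : ∀ u ∈ U, 0 ≤ u f := (h.mem_iff _).1 f.2
  refine ⟨∑ k, ∑ u ∈ U, (u (b k)).natAbs, fun c hcc => ?_⟩
  have hbd : ∀ k, ∀ u ∈ U, (u (b k)).natAbs ≤ c := fun k u hu =>
    ((Finset.single_le_sum (f := fun u : M →+ ℤ => (u (b k)).natAbs)
      (fun _ _ => Nat.zero_le _) hu).trans
      (Finset.single_le_sum (f := fun k => ∑ u ∈ U, (u (b k)).natAbs)
      (fun _ _ => Nat.zero_le _) (Finset.mem_univ k))).trans hcc
  have key : ∀ m : M, (∀ j ∈ J, 0 ≤ b.repr m j) → (∀ u ∈ U, - (c : ℤ) ≤ u m) →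
      m + c • (f : M) ∈ S := by
    intro m hm hmu
    refine (h.mem_iff _).2 fun u hu => ?_
    rw [map_add, map_nsmul, nsmul_eq_mul]
    rcases (hfU u hu).eq_or_lt with h0 | h0
    -- Where `u` kills `f`, adding multiples of `f` does not change `u`, so non-negativity is read
    -- off from any multiple.
    · obtain ⟨n, hn⟩ := hc.exists_add_mem m hm
      have := (h.mem_iff _).1 hn u hu
      rw [map_add, map_nsmul, ← h0, smul_zero, add_zero] at this
      rw [← h0, mul_zero, add_zero]
      exact this
    · have h3 : (c : ℤ) ≤ c * u f := le_mul_of_one_le_right (Int.natCast_nonneg _) h0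
      have := hmu u hu
      omega
  refine ⟨fun k => key _ (fun j _ => ?_) fun u hu => ?_, fun k hk m hm hmk =>
    key _ (fun j hj => ?_) fun u hu => ?_⟩
  · rw [Module.Basis.repr_self, Finsupp.single_apply]; split_ifs <;> simp
  · have := hbd k u hu; omega
  · rw [map_sub, Finsupp.sub_apply, Module.Basis.repr_self, Finsupp.single_apply]
    split_ifs with hkj
    · subst hkj; omega
    · simpa using hc.nonneg m hm j hj
  · rw [map_sub]
    have h1 := hbd k u hu
    have h2 := (h.mem_iff _).1 hm u hu
    omega

open Classical in
omit [Fintype ι] [DecidableEq ι] in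
-- The vector field χ^(cf) ∂/∂x_k, for a coordinate x_k that may vanish.
theorem exists_derivation_of_mem (c : ℕ) {k : ι} (hk : k ∈ J)
    (hcm : ∀ m ∈ S, 1 ≤ b.repr m k → m - b k + c • (f : M) ∈ S) :
    ∃ E : Derivation ℂ (AddMonoidAlgebra ℂ S) (AddMonoidAlgebra ℂ S), ∀ m : S,
      E (chi m) = if hm : 1 ≤ b.repr m k then
        (b.repr m k : ℂ) • chi ⟨_, hcm m m.2 hm⟩ else 0 := by
  let δ : S → AddMonoidAlgebra ℂ S := fun m => if hm : 1 ≤ b.repr m k then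
        (b.repr m k : ℂ) • chi ⟨_, hcm m m.2 hm⟩ else 0
  have hδ : ∀ m m' : S, δ (m + m') = chi m * δ m' + chi m' * δ m := by
    have key : ∀ m m' : S, b.repr m k = 0 → δ (m + m') = chi m * δ m' + chi m' * δ m := by
      intro m m' hm
      have h1 : ¬ 1 ≤ b.repr m k := by omega
      have hadd : b.repr ((m + m' : S) : M) k = b.repr m' k := by
        rw [AddSubmonoid.coe_add, map_add, Finsupp.add_apply, hm, zero_add]
      simp only [δ]
      rw [dif_neg h1, mul_zero, add_zero]
      by_cases h2 : 1 ≤ b.repr m' k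
      · rw [dif_pos h2, dif_pos (hadd ▸ h2), mul_smul_comm, ← chi_add]
        refine congrArg₂ _ (by rw [hadd]) (congrArg chi (Subtype.ext ?_))
        simp only [AddSubmonoid.coe_add]
        abel
      · rw [dif_neg h2, dif_neg (hadd ▸ h2), mul_zero]
    intro m m'
    have n1 := hc.nonneg m m.2 k hk
    have n2 := hc.nonneg m' m'.2 k hk
    rcases n1.eq_or_lt with h1 | h1
    · exact key m m' h1.symm
    rcases n2.eq_or_lt with h2 | h2
    · rw [add_comm m m', add_comm (chi m * _)]
      exact key m' m h2.symm
    have hadd : b.repr ((m + m' : S) : M) k = b.repr m k + b.repr m' k := by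
      rw [AddSubmonoid.coe_add, map_add, Finsupp.add_apply]
    have h3 : 1 ≤ b.repr ((m + m' : S) : M) k := by rw [hadd]; omega
    have haddC : (b.repr ((m + m' : S) : M) k : ℂ) = b.repr m k + b.repr m' k := by
      rw [hadd, Int.cast_add]
    simp only [δ]
    rw [dif_pos h3, dif_pos (show 1 ≤ b.repr (m : M) k from h1),
      dif_pos (show 1 ≤ b.repr (m' : M) k from h2), mul_smul_comm, mul_smul_comm, ← chi_add,
      ← chi_add, haddC, add_smul, add_comm]
    congr 3
    · apply Subtype.ext
      simp only [AddSubmonoid.coe_add]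
      abel
    · apply Subtype.ext
      simp only [AddSubmonoid.coe_add]
      abel
  refine ⟨Derivation.mk' (linearOfChi δ) fun x z => ?_, fun m => ?_⟩
  · have := leibniz_of_chi (LinearMap.mul ℂ (AddMonoidAlgebra ℂ S)) (linearOfChi δ)
      (fun m m' => by simp [← chi_add, hδ]) x z
    simpa using this
  · exact linearOfChi_chi δ m

omit hc [Fintype ι] [DecidableEq ι] in
-- The logarithmic field x_k ∂/∂x_k, which serves the invertible coordinates of a chart.
theorem exists_derivation (S : AddSubmonoid M) (b : Module.Basis ι ℤ M) (k : ι) :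
    ∃ E : Derivation ℂ (AddMonoidAlgebra ℂ S) (AddMonoidAlgebra ℂ S), ∀ m : S,
      E (chi m) = (b.repr m k : ℂ) • chi m := by
  refine ⟨Derivation.mk' (linearOfChi fun m : S => (b.repr m k : ℂ) • chi m) fun x z => ?_,
    fun m => linearOfChi_chi _ m⟩
  have := leibniz_of_chi (LinearMap.mul ℂ (AddMonoidAlgebra ℂ S))
    (linearOfChi fun m : S => (b.repr m k : ℂ) • chi m)
    (fun m m' => by
      simp only [← chi_add, linearOfChi_chi, LinearMap.mul_apply', mul_smul_comm,
        AddSubmonoid.coe_add, map_add, Finsupp.add_apply, Int.cast_add, add_smul, add_comm m' m]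
      abel) x z
  simpa using this

end IsChart
end Coordinates
end


noncomputable section

/-! ### Existence of local coordinates and frames at points with a chart -/

section CoordinatesExist

variable {M : Type*} [AddCommGroup M]

/-- The characters on which a tangent vector vanishes. -/
def charKer {S : AddSubmonoid M} {y : Pt (AddMonoidAlgebra ℂ S)} (D : tangentSpace y) :
    AddSubmonoid S where
  carrier := {m | (D : AddMonoidAlgebra ℂ S →ₗ[ℂ] ℂ) (chi m) = 0}
  add_mem' := by
    intro a b ha hb
    change (D : AddMonoidAlgebra ℂ S →ₗ[ℂ] ℂ) (chi (a + b)) = 0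
    rw [chi_add, tangentSpace_mul, show (D : AddMonoidAlgebra ℂ S →ₗ[ℂ] ℂ) (chi a) = 0 from ha,
      show (D : AddMonoidAlgebra ℂ S →ₗ[ℂ] ℂ) (chi b) = 0 from hb]
    simp
  zero_mem' := by
    change (D : AddMonoidAlgebra ℂ S →ₗ[ℂ] ℂ) (chi 0) = 0
    rw [chi_zero, tangentSpace_one]

theorem apply_add_of_mem_charKer {S : AddSubmonoid M} {y : Pt (AddMonoidAlgebra ℂ S)}
    {D : tangentSpace y} {z : S} (hz : z ∈ charKer D) (m : S) :
    (D : AddMonoidAlgebra ℂ S →ₗ[ℂ] ℂ) (chi (z + m)) =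
      y (chi z) * (D : AddMonoidAlgebra ℂ S →ₗ[ℂ] ℂ) (chi m) := by
  rw [chi_add, tangentSpace_mul, show (D : AddMonoidAlgebra ℂ S →ₗ[ℂ] ℂ) (chi z) = 0 from hz]
  simp

/-- Moves negative coefficients to the other side, so that integral relations in M become relations
between elements of `S`. -/
theorem sum_posPart_smul {ι : Type*} [Fintype ι] (v : ι → ℤ) (x : ι → M) :
    ∑ i, (v i).toNat • x i = ∑ i, v i • x i + ∑ i, (-v i).toNat • x i := by
  rw [← Finset.sum_add_distrib]
  refine Finset.sum_congr rfl fun i _ => ?_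
  rw [← natCast_zsmul, ← natCast_zsmul, ← add_smul]
  congr 1
  omega

theorem tangentSpace_nsmul {S : AddSubmonoid M} {y : Pt (AddMonoidAlgebra ℂ S)}
    (D : tangentSpace y) (n : ℕ) (m : S) (hm : y (chi m) ≠ 0) :
    (D : AddMonoidAlgebra ℂ S →ₗ[ℂ] ℂ) (chi (n • m)) =
      y (chi (n • m)) * (n * ((D : AddMonoidAlgebra ℂ S →ₗ[ℂ] ℂ) (chi m) / y (chi m))) := by
  induction n with
  | zero => simp [chi_zero, tangentSpace_one]
  | succ n ih =>
    rw [succ_nsmul, chi_add, tangentSpace_mul, ih, map_mul]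
    push_cast
    field_simp
    ring

namespace IsChart

variable {S : AddSubmonoid M} {y : Pt (AddMonoidAlgebra ℂ S)} {ι : Type*} [Fintype ι]
  [DecidableEq ι] {b : Module.Basis ι ℤ M} {J : Set ι} {f : S} {U : Finset (M →+ ℤ)} {e : M}
  (hc : IsChart y b J f)

include hc

/-- The coordinates are χ^(β_i) = x_i χ^(cf). With φ the coordinates of `f`, ∏ χ^(φ_i β_i) = χ^(qf)
for q = 1 + c Σ φ_i ≠ 0, so a vector killing the β_i kills χ^f. Every character is a quotient of
monomials in the β_i and `f`. -/
theorem ext_coord {c : ℕ} (β : ι → S) (hβ : ∀ i, (β i : M) = b i + c • (f : M))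
    (hq : 1 + (c : ℤ) * ∑ i, b.repr f i ≠ 0) {y' : Pt (AddMonoidAlgebra ℂ S)}
    (hy' : y' (chi f) ≠ 0) (D : tangentSpace y')
    (hD : ∀ i, (D : AddMonoidAlgebra ℂ S →ₗ[ℂ] ℂ) (chi (β i)) = 0) : D = 0 := by
  have hβK : ∀ i, β i ∈ charKer D := hD
  have hβJ : ∀ i, i ∉ J → ∀ j ∈ J, b.repr (β i) j = 0 := by
    intro i hi j hj
    rw [hβ, map_add, map_nsmul, Finsupp.add_apply, Finsupp.smul_apply, hc.repr_f hj,
      Module.Basis.repr_self, Finsupp.single_apply, if_neg (by rintro rfl; exact hi hj)]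
    simp
  have hβsum : ∀ v : ι → ℕ, ((∑ i, v i • β i : S) : M) =
      ∑ i, v i • b i + (c * ∑ i, v i) • (f : M) := by
    intro v
    simp only [AddSubmonoid.coe_finsetSum, AddSubmonoidClass.coe_nsmul, hβ, smul_add,
      Finset.sum_add_distrib]
    congr 1
    rw [Finset.mul_sum, Finset.sum_smul]
    exact Finset.sum_congr rfl fun i _ => by rw [smul_smul, mul_comm]
  have hne : ∀ v : ι → ℕ, (∀ j ∈ J, v j = 0) → y' (chi (∑ i, v i • β i)) ≠ 0 := by
    intro v hv
    rw [chi_sum, map_prod]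
    refine Finset.prod_ne_zero_iff.2 fun i _ => ?_
    rw [chi_nsmul, map_pow]
    by_cases hi : i ∈ J
    · rw [hv i hi]; simp
    · exact pow_ne_zero _ (hc.ne_zero_of_repr (hβJ i hi) hy')
  have hmem : ∀ v : ι → ℕ, ∑ i, v i • β i ∈ charKer D := fun v =>
    sum_mem fun i _ => nsmul_mem (hβK i) _
  have hfK : f ∈ charKer D := by
    set φ : ι → ℤ := fun i => b.repr f i with hφ
    set q : ℤ := 1 + (c : ℤ) * ∑ i, φ i with hqdef
    have hφJ : ∀ j ∈ J, φ j = 0 := fun j hj => hc.repr_f hj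
    have hrel : (∑ i, (φ i).toNat • β i) + (-q).toNat • f =
        (∑ i, (-φ i).toNat • β i) + q.toNat • f := by
      apply Subtype.ext
      simp only [AddSubmonoid.coe_add, hβsum, AddSubmonoidClass.coe_nsmul]
      rw [sum_posPart_smul φ (fun i => b i), b.sum_repr]
      have e1 : ((c * ∑ i, (φ i).toNat : ℕ) : ℤ) = c * ∑ i, φ i +
          ((c * ∑ i, (-φ i).toNat : ℕ) : ℤ) := by
        push_cast
        rw [← mul_add, ← Finset.sum_add_distrib]
        congr 1
        exact Finset.sum_congr rfl fun i _ => by omega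
      have e2 : (q.toNat : ℤ) = 1 + c * ∑ i, φ i + ((-q).toNat : ℤ) := by
        rw [← hqdef]; omega
      rw [← natCast_zsmul (f : M) (c * ∑ i, (φ i).toNat), e1, ← natCast_zsmul (f : M) q.toNat, e2,
        add_smul, add_smul, add_smul, natCast_zsmul, natCast_zsmul, one_smul]
      abel
    have h1 := congrArg (fun z => (D : AddMonoidAlgebra ℂ S →ₗ[ℂ] ℂ) (chi z)) hrel
    have h2 := congrArg (fun z => y' (chi z)) hrel
    simp only [apply_add_of_mem_charKer (hmem _), tangentSpace_nsmul D _ f hy'] at h1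
    simp only [chi_add, map_mul] at h2
    have h3 := hne (fun i => (φ i).toNat) (fun j hj => by simp [hφJ j hj])
    have h4 : y' (chi ((-q).toNat • f)) ≠ 0 := by
      rw [chi_nsmul, map_pow]; exact pow_ne_zero _ hy'
    have h5 : (((-q).toNat : ℂ) - (q.toNat : ℂ)) *
        ((D : AddMonoidAlgebra ℂ S →ₗ[ℂ] ℂ) (chi f) / y' (chi f)) = 0 := by
      have h6 : y' (chi (∑ i, (φ i).toNat • β i)) * y' (chi ((-q).toNat • f)) *
        ((((-q).toNat : ℂ) - (q.toNat : ℂ)) *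
        ((D : AddMonoidAlgebra ℂ S →ₗ[ℂ] ℂ) (chi f) / y' (chi f))) = 0 := by
        linear_combination h1 - (q.toNat : ℂ) *
          ((D : AddMonoidAlgebra ℂ S →ₗ[ℂ] ℂ) (chi f) / y' (chi f)) * h2
      exact (mul_eq_zero.1 h6).resolve_left (mul_ne_zero h3 h4)
    have h7 : ((-q).toNat : ℂ) - (q.toNat : ℂ) ≠ 0 := by
      rw [sub_ne_zero]
      norm_cast
      omega
    have h8 := (mul_eq_zero.1 h5).resolve_left h7
    exact (div_eq_zero_iff.1 h8).resolve_right hy'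
  refine tangentSpace_ext_chi fun m => ?_
  -- `B` clears the denominators of m. It does not vanish at `y'`: only invertible coordinates
  -- enter, as the coordinates of m along `J` are non-negative.
  let B : S := (∑ i, (-b.repr m i).toNat • β i) + (c * ∑ i, (b.repr m i).toNat) • f
  have hB : B ∈ charKer D := add_mem (hmem _) (nsmul_mem hfK _)
  have hrel : B + m = (∑ i, (b.repr m i).toNat • β i) +
      (c * ∑ i, (-b.repr m i).toNat) • f := by
    apply Subtype.ext
    simp only [B, AddSubmonoid.coe_add, hβsum, AddSubmonoidClass.coe_nsmul]
    rw [sum_posPart_smul (fun i => b.repr m i) (fun i => b i), b.sum_repr]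
    abel
  have hBm : B + m ∈ charKer D := by
    rw [hrel]; exact add_mem (hmem _) (nsmul_mem hfK _)
  have h1 : (D : AddMonoidAlgebra ℂ S →ₗ[ℂ] ℂ) (chi (B + m)) = 0 := hBm
  rw [apply_add_of_mem_charKer hB] at h1
  refine (mul_eq_zero.1 h1).resolve_left ?_
  simp only [B]
  rw [chi_add, map_mul, chi_nsmul _ f, map_pow]
  refine mul_ne_zero (hne _ fun j hj => ?_) (pow_ne_zero _ hy')
  have := hc.nonneg m m.2 j hj
  omega

theorem exists_localCoords (h : IsGorenstein S U e) (b₀ : Module.Basis ι ℤ M) :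
    Nonempty (LocalCoords e b₀ y) := by
  classical
  obtain ⟨c₀, hc₀⟩ := hc.exists_uniform h
  -- The extra 2 makes c at least 2, so that 1 + c k is non-zero for every integer k.
  obtain ⟨c, hcdef⟩ : ∃ c, c = c₀ + 2 := ⟨_, rfl⟩
  obtain ⟨hb, hbJ⟩ := hc₀ c (by omega)
  let β : ι → S := fun i => ⟨_, hb i⟩
  have hβ : ∀ i, (β i : M) = b i + c • (f : M) := fun i => rfl
  have hq : 1 + (c : ℤ) * ∑ i, b.repr f i ≠ 0 := by
    intro h0
    have h1 : (c : ℤ) * (-∑ i, b.repr f i) = 1 := by linarith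
    rcases Int.eq_one_or_neg_one_of_mul_eq_one h1 with h2 | h2 <;> omega
  have hβr : ∀ i k, b.repr (β i) k = (if i = k then 1 else 0) + c * b.repr f k := by
    intro i k
    rw [hβ, map_add, map_nsmul, Finsupp.add_apply, Finsupp.smul_apply, Module.Basis.repr_self,
      Finsupp.single_apply, nsmul_eq_mul]
  -- the frame
  have hE : ∀ k, ∃ E : Derivation ℂ (AddMonoidAlgebra ℂ S) (AddMonoidAlgebra ℂ S),
      (k ∉ J → ∀ m : S, E (chi m) = (b.repr m k : ℂ) • chi m) ∧
      (k ∈ J → (∀ m : S, b.repr m k = 0 → E (chi m) = 0) ∧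
        E (chi (β k)) = chi ((2 * c) • f)) := by
    intro k
    by_cases hk : k ∈ J
    · obtain ⟨E, hE⟩ := hc.exists_derivation_of_mem c hk (hbJ k hk)
      refine ⟨E, fun h => absurd hk h, fun _ => ⟨fun m hm => ?_, ?_⟩⟩
      · rw [hE, dif_neg (by omega)]
      · have h1 : b.repr (β k) k = 1 := by rw [hβr, hc.repr_f hk]; simp
        have h2 : (b.repr (β k) k : ℂ) = 1 := by rw [h1, Int.cast_one]
        rw [hE, dif_pos h1.ge, h2, one_smul]
        congr 1
        apply Subtype.ext
        -- One factor χ^(cf) comes from β_k and another from the derivation, hence the exponent 2c.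
        change (β k : M) - b k + c • (f : M) = _
        rw [AddSubmonoidClass.coe_nsmul, two_mul, add_smul c c (f : M), hβ]
        abel
    · obtain ⟨E, hE⟩ := exists_derivation S b k
      exact ⟨E, fun _ => hE, fun h => absurd h hk⟩
  choose E hEn hEJ using hE
  -- the monomials `g`, `s`
  have hge : ∀ j ∈ J, b.repr (e - ∑ i, (β i : M)) j = 0 := by
    intro j hj
    rw [map_sub, map_sum, Finsupp.sub_apply, Finsupp.finsetSum_apply, hc.repr_e h hj,
      Finset.sum_eq_single j]
    · rw [hβr, hc.repr_f hj]; simp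
    · intro i _ hi; rw [hβr, hc.repr_f hj]; simp [hi]
    · simp
  obtain ⟨n, hn⟩ := hc.exists_add_mem _ fun j hj => (hge j hj).ge
  refine ⟨⟨f, β, E, ⟨_, hn⟩, n • f, hc.ne_zero, ?_, ?_, ?_, ?_, ?_, ?_⟩⟩
  · intro y' hy'
    rw [Fintype.linearIndependent_iff]
    intro a ha
    have ha' : ∀ m : S, ∑ i, a i * y' (E i (chi m)) = 0 := by
      intro m
      have := congrArg (fun F : tangentSpace y' =>
        (F : AddMonoidAlgebra ℂ S →ₗ[ℂ] ℂ) (chi m)) ha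
      simpa using this
    -- Testing on χ^f gives Σ a_i φ_i = 0, which removes the contribution of the factors χ^(cf) when
    -- testing on χ^(β_k).
    have hf0 : ∑ i, a i * (b.repr f i : ℂ) = 0 := by
      have h1 := ha' f
      have h2 : (∑ i, a i * (b.repr f i : ℂ)) * y' (chi f) = 0 := by
        rw [Finset.sum_mul, ← h1]
        refine Finset.sum_congr rfl fun i _ => ?_
        by_cases hi : i ∈ J
        · rw [((hEJ i hi).1 f (hc.repr_f hi)), hc.repr_f hi]; simp
        · rw [hEn i hi]; simp [mul_assoc]
      exact (mul_eq_zero.1 h2).resolve_right hy'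
    intro k
    have h1 := ha' (β k)
    have h2 : ∀ i, a i * y' (E i (chi (β k))) =
        (if i = k then a k * (if k ∈ J then y' (chi ((2 * c) • f)) else y' (chi (β k))) else 0) +
        c * y' (chi (β k)) * (a i * b.repr f i) := by
      intro i
      by_cases hik : i = k
      · subst hik
        rw [if_pos rfl]
        by_cases hi : i ∈ J
        · rw [if_pos hi, (hEJ i hi).2, hc.repr_f hi]; simp
        · rw [if_neg hi, hEn i hi, hβr, if_pos rfl]
          simp only [map_smul, smul_eq_mul]
          push_cast
          ring
      · rw [if_neg hik]
        by_cases hi : i ∈ J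
        · rw [(hEJ i hi).1 _ (by rw [hβr, hc.repr_f hi, if_neg (Ne.symm hik)]; simp), hc.repr_f hi]
          simp
        · rw [hEn i hi, hβr, if_neg (Ne.symm hik)]
          simp only [map_smul, smul_eq_mul]
          push_cast
          ring
    rw [Finset.sum_congr rfl fun i _ => h2 i, Finset.sum_add_distrib, ← Finset.mul_sum, hf0,
      mul_zero, add_zero, Finset.sum_ite_eq' Finset.univ k, if_pos (Finset.mem_univ k)] at h1
    refine (mul_eq_zero.1 h1).resolve_right ?_
    split_ifs with hk
    · rw [chi_nsmul, map_pow]; exact pow_ne_zero _ hy'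
    · refine hc.ne_zero_of_repr (fun j hj => ?_) hy'
      rw [hβr, hc.repr_f hj, if_neg (by rintro rfl; exact hk hj)]; simp
  · exact fun y' hy' D hD => hc.ext_coord β hβ hq hy' D hD
  · simp only [AddSubmonoidClass.coe_nsmul]
    abel
  · intro y' hy'
    refine hc.ne_zero_of_repr (fun j hj => ?_) hy'
    simp only
    rw [map_add, map_nsmul, Finsupp.add_apply, hge j hj, Finsupp.smul_apply, hc.repr_f hj]
    simp
  · intro y' hy'
    rw [chi_nsmul, map_pow]; exact pow_ne_zero _ hy'
  · have := det_add_smul_ne_zero b₀ b c f hq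
    convert! this using 3 with i
    rw [hβ, natCast_zsmul]

end IsChart

namespace LocalCoords

variable {S : AddSubmonoid M} {y : Pt (AddMonoidAlgebra ℂ S)} {ι : Type*} [Fintype ι]
  [DecidableEq ι] {b₀ : Module.Basis ι ℤ M} {e : M} (L : LocalCoords e b₀ y)

include L

theorem finite_tangentSpace {y' : Pt (AddMonoidAlgebra ℂ S)} (hy' : y' (chi L.f) ≠ 0) :
    Module.Finite ℂ (tangentSpace y') ∧
      Module.finrank ℂ (tangentSpace y') = Fintype.card ι := by
  let Φ : tangentSpace y' →ₗ[ℂ] (ι → ℂ) :=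
    LinearMap.pi fun i => (LinearMap.applyₗ (chi (L.β i))) ∘ₗ (tangentSpace y').subtype
  have hΦ : Function.Injective Φ := by
    rw [← LinearMap.ker_eq_bot, LinearMap.ker_eq_bot']
    exact fun D hD => L.ext_coord y' hy' D fun i => congrFun hD i
  have hfin : Module.Finite ℂ (tangentSpace y') := Module.Finite.of_injective Φ hΦ
  refine ⟨hfin, le_antisymm ?_ (L.linearIndependent y' hy').fintype_card_le_finrank⟩
  have h := LinearMap.finrank_le_finrank_of_injective hΦ
  rwa [Module.finrank_fintype_fun_eq_card] at h

/-- The frame as a basis of the tangent space. -/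
def basis [Nonempty ι] {y' : Pt (AddMonoidAlgebra ℂ S)} (hy' : y' (chi L.f) ≠ 0) :
    Module.Basis ι ℂ (tangentSpace y') :=
  basisOfLinearIndependentOfCardEqFinrank (L.linearIndependent y' hy')
    (L.finite_tangentSpace hy').2.symm

theorem basis_apply [Nonempty ι] {y' : Pt (AddMonoidAlgebra ℂ S)} (hy' : y' (chi L.f) ≠ 0)
    (i : ι) : L.basis hy' i = (L.E i).toTangent y' := by
  simp [basis]

theorem det_frame_ne_zero [Nonempty ι] {y' : Pt (AddMonoidAlgebra ℂ S)}
    (hy' : y' (chi L.f) ≠ 0) :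
    (Matrix.of fun i j => y' (L.E i (chi (L.β j)))).det ≠ 0 := by
  intro h0
  obtain ⟨v, hv, hv0⟩ := Matrix.exists_vecMul_eq_zero_iff.2 h0
  apply hv
  have h1 : ∑ i, v i • (L.E i).toTangent y' = 0 := by
    refine L.ext_coord y' hy' _ fun j => ?_
    have := congrFun hv0 j
    simpa [Matrix.vecMul, dotProduct] using this
  exact funext (Fintype.linearIndependent_iff.1 (L.linearIndependent y' hy') v h1)

end LocalCoords

end CoordinatesExist
end


noncomputable section

/-! ### Points with a toric chart are non-singular -/

section ChartRegular

theorem chi_injective {Γ Δ : Type*} [AddCommMonoid Γ] [AddCommMonoid Δ] (φ : Γ →+ Δ)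
    (hφ : Function.Injective φ) :
    Function.Injective (AddMonoidAlgebra.mapDomainAlgHom ℂ ℂ φ) :=
  AddMonoidAlgebra.mapDomain_injective hφ

@[simp] theorem mapDomainAlgHom_chi {Γ Δ : Type*} [AddCommMonoid Γ] [AddCommMonoid Δ] (φ : Γ →+ Δ)
    (m : Γ) : AddMonoidAlgebra.mapDomainAlgHom ℂ ℂ φ (chi m) = chi (φ m) := by
  simp [chi]

variable {M : Type*} [AddCommGroup M] [Module.Free ℤ M] [Module.Finite ℤ M]

/-- Source of the absence of zero divisors and, later, of the fact that units of the Laurent ring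
are monomials. -/
instance instTwoUniqueSumsLattice : TwoUniqueSums M :=
  let b := Module.finBasis ℤ M
  .of_injective_addHom (b.equivFun.toLinearMap.toAddMonoidHom.toAddHom)
    b.equivFun.injective inferInstance

instance instNoZeroDivisorsSub (S : AddSubmonoid M) : NoZeroDivisors (AddMonoidAlgebra ℂ S) :=
  (chi_injective S.subtype S.subtype_injective).noZeroDivisors _ (map_zero _) (map_mul _)

variable {S : AddSubmonoid M} {y : Pt (AddMonoidAlgebra ℂ S)} {ι : Type*} [Fintype ι]
  [DecidableEq ι] {b : Module.Basis ι ℤ M} {J : Set ι} {f : S} {U : Finset (M →+ ℤ)} {e : M}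

open MvPolynomial in
-- The local ring at `y` is a localization, at a prime, of the polynomial ring in the coordinates
-- x_i = χ^(β_i) / χ^(cf), hence regular.
theorem IsChart.isNonsingular (hc : IsChart y b J f) (h : IsGorenstein S U e) :
    IsNonsingular y := by
  classical
  obtain ⟨c, hc₀⟩ := hc.exists_uniform h
  obtain ⟨hb, -⟩ := hc₀ c le_rfl
  let β : ι → S := fun i => ⟨_, hb i⟩
  have hβ : ∀ i, (β i : M) = b i + c • (f : M) := fun i => rfl
  let R := LocalRingAt y
  let al : AddMonoidAlgebra ℂ S →ₐ[ℂ] R := IsScalarTower.toAlgHom ℂ (AddMonoidAlgebra ℂ S) R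
  have hunit : ∀ a : AddMonoidAlgebra ℂ S, y a ≠ 0 → IsUnit (al a) := fun a ha =>
    IsLocalization.map_units R (⟨a, ha⟩ : (RingHom.ker y).primeCompl)
  obtain ⟨F, hF⟩ := hunit (chi f) hc.ne_zero
  let X' : ι → R := fun i => al (chi (β i)) * ((F⁻¹ : Rˣ) : R) ^ c
  have hX' : ∀ i, X' i * al (chi f) ^ c = al (chi (β i)) := by
    intro i
    simp only [X']
    rw [mul_assoc, ← hF, ← mul_pow, Units.inv_mul, one_pow, mul_one]
  let ψ : MvPolynomial ι ℂ →ₐ[ℂ] R := aeval X'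
  -- relation between monomials and characters
  have hmon : ∀ (v w : ι → ℕ) (m m' : S), (m : M) + ∑ i, v i • b i = m' + ∑ i, w i • b i →
      al (chi m) * ∏ i, X' i ^ v i = al (chi m') * ∏ i, X' i ^ w i := by
    intro v w m m' hvw
    have hs : ∀ v : ι → ℕ, (∏ i, X' i ^ v i) * al (chi f) ^ (c * ∑ i, v i) =
        al (chi (∑ i, v i • β i)) := by
      intro v
      rw [Finset.mul_sum, ← Finset.prod_pow_eq_pow_sum, ← Finset.prod_mul_distrib, chi_sum, map_prod]
      refine Finset.prod_congr rfl fun i _ => ?_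
      rw [pow_mul, ← mul_pow, hX', chi_nsmul, map_pow]
    have hS : m + ∑ i, v i • β i + (c * ∑ i, w i) • f =
        m' + ∑ i, w i • β i + (c * ∑ i, v i) • f := by
      apply Subtype.ext
      have hβsum : ∀ v : ι → ℕ, ((∑ i, v i • β i : S) : M) =
          ∑ i, v i • b i + (c * ∑ i, v i) • (f : M) := by
        intro v
        simp only [AddSubmonoid.coe_finsetSum, AddSubmonoidClass.coe_nsmul, hβ, smul_add,
          Finset.sum_add_distrib]
        congr 1
        rw [Finset.mul_sum, Finset.sum_smul]
        exact Finset.sum_congr rfl fun i _ => by rw [smul_smul, mul_comm]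
      simp only [AddSubmonoid.coe_add, hβsum, AddSubmonoidClass.coe_nsmul]
      rw [← add_assoc, ← add_assoc, hvw]
      abel
    have h1 := congrArg (fun z => al (chi z)) hS
    simp only [chi_add, map_mul, ← hs, chi_nsmul, map_pow] at h1
    have hu : IsUnit (al (chi f) ^ (c * ∑ i, v i) * al (chi f) ^ (c * ∑ i, w i)) :=
      ((hunit _ hc.ne_zero).pow _).mul ((hunit _ hc.ne_zero).pow _)
    refine hu.mul_left_injective ?_
    simp only
    linear_combination h1
  have hψmon : ∀ v : ι → ℕ, ψ (∏ i, X i ^ v i) = ∏ i, X' i ^ v i := by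
    intro v; simp [ψ]
  have hXunit : ∀ i, i ∉ J → IsUnit (X' i) := by
    intro i hi
    refine (hunit (chi (β i)) (hc.ne_zero_of_repr (fun j hj => ?_) hc.ne_zero)).mul
      (Units.isUnit _ |>.pow c)
    rw [hβ, map_add, map_nsmul, Finsupp.add_apply, Finsupp.smul_apply, hc.repr_f hj,
      Module.Basis.repr_self, Finsupp.single_apply, if_neg (by rintro rfl; exact hi hj)]
    simp
  have hprodunit : ∀ v : ι → ℕ, (∀ j ∈ J, v j = 0) → IsUnit (ψ (∏ i, X i ^ v i)) := by
    intro v hv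
    rw [hψmon]
    refine IsUnit.prod_univ_iff.2 fun i => ?_
    by_cases hi : i ∈ J
    · rw [hv i hi, pow_zero]; exact isUnit_one
    · exact (hXunit i hi).pow _
  -- every regular function is a polynomial over a unit monomial
  have hnum : ∀ a : AddMonoidAlgebra ℂ S, ∃ (Q P : MvPolynomial ι ℂ), IsUnit (ψ Q) ∧
      al a * ψ Q = ψ P := by
    intro a
    induction a using chi_induction with
    | hchi m =>
      refine ⟨∏ i, X i ^ (-b.repr m i).toNat, ∏ i, X i ^ (b.repr m i).toNat,
        hprodunit _ fun j hj => ?_, ?_⟩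
      · have := hc.nonneg m m.2 j hj
        omega
      · rw [hψmon, hψmon, hmon _ (fun i => (b.repr m i).toNat) m 0, chi_zero, map_one, one_mul]
        rw [sum_posPart_smul (fun i => b.repr m i) (fun i => b i), b.sum_repr]; simp
    | hadd a a' ha ha' =>
      obtain ⟨Q, P, hQ, hP⟩ := ha
      obtain ⟨Q', P', hQ', hP'⟩ := ha'
      refine ⟨Q * Q', P * Q' + P' * Q, by rw [map_mul]; exact hQ.mul hQ', ?_⟩
      rw [map_add, map_mul, map_add, map_mul, map_mul, ← hP, ← hP']
      ring
    | hsmul r a ha =>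
      obtain ⟨Q, P, hQ, hP⟩ := ha
      exact ⟨Q, r • P, hQ, by rw [map_smul, map_smul, ← hP, smul_mul_assoc]⟩
  -- injectivity
  let ν : (ι →₀ ℕ) →+ M :=
    { toFun := fun v => ∑ i, v i • b i
      map_zero' := by simp
      map_add' := fun v w => by simp [add_smul, Finset.sum_add_distrib] }
  have hν : Function.Injective ν := by
    intro v w hvw
    ext i
    have h1 : ∀ v : ι →₀ ℕ, b.repr (ν v) i = v i := by
      intro v
      simp only [ν, AddMonoidHom.coe_mk, ZeroHom.coe_mk, map_sum, Finsupp.finsetSum_apply,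
        map_nsmul, Finsupp.smul_apply, Module.Basis.repr_self]
      rw [Finset.sum_eq_single i (by intro k _ hk; simp [hk]) (by simp)]
      simp
    have h2 := h1 v
    rw [hvw, h1 w] at h2
    exact_mod_cast h2.symm
  have hψinj : Function.Injective ψ := by
    rw [injective_iff_map_eq_zero]
    intro P hP
    let θ : MvPolynomial ι ℂ →ₐ[ℂ] AddMonoidAlgebra ℂ M :=
      AddMonoidAlgebra.mapDomainAlgHom ℂ ℂ ν
    let inc := AddMonoidAlgebra.mapDomainAlgHom ℂ ℂ S.subtype
    -- After multiplication by a power of χ^f both images of a polynomial, in the Laurent ring and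
    -- in the local ring, come from the same element of the coordinate ring. As the latter is a
    -- domain, the kernel of `ψ` lies in that of the injective `θ`.
    have hθ : ∀ P : MvPolynomial ι ℂ, ∃ (n : ℕ) (a : AddMonoidAlgebra ℂ S),
        θ P * chi (n • (f : M)) = inc a ∧ ψ P * al (chi f) ^ n = al a := by
      intro P
      induction P using MvPolynomial.induction_on' with
      | monomial v r =>
        refine ⟨c * ∑ i, v i, r • chi (∑ i, v i • β i), ?_, ?_⟩
        · have h1 : θ (monomial v r) = r • chi (ν v) := by
            rw [smul_chi]
            exact AddMonoidAlgebra.mapDomain_single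
          rw [h1, map_smul, mapDomainAlgHom_chi, smul_mul_assoc, ← chi_add]
          congr 2
          simp only [AddSubmonoid.subtype_apply, AddSubmonoid.coe_finsetSum,
            AddSubmonoidClass.coe_nsmul, hβ, smul_add, Finset.sum_add_distrib]
          congr 1
          rw [Finset.mul_sum, Finset.sum_smul]
          exact Finset.sum_congr rfl fun i _ => by rw [smul_smul, mul_comm]
        · rw [monomial_eq, map_mul, Finsupp.prod_fintype _ _ (by simp), hψmon, map_smul,
            ← algebraMap_eq, AlgHom.commutes, Algebra.smul_def, mul_assoc, Finset.mul_sum,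
            ← Finset.prod_pow_eq_pow_sum, ← Finset.prod_mul_distrib, chi_sum, map_prod]
          congr 1
          refine Finset.prod_congr rfl fun i _ => ?_
          rw [pow_mul, ← mul_pow, hX', chi_nsmul, map_pow]
      | add P Q hP hQ =>
        obtain ⟨n, a, h1, h2⟩ := hP
        obtain ⟨n', a', h1', h2'⟩ := hQ
        refine ⟨n + n', a * chi (n' • f) + a' * chi (n • f), ?_, ?_⟩
        · have hi : ∀ k : ℕ, inc (chi (k • f)) = chi (k • (f : M)) := fun k => by
            rw [mapDomainAlgHom_chi]; rfl
          rw [map_add θ, map_add inc, map_mul inc, map_mul inc, hi, hi, add_smul, chi_add, ← h1, ← h1']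
          ring
        · rw [map_add ψ, map_add al, map_mul al, map_mul al, ← h2, ← h2', chi_nsmul, chi_nsmul, map_pow, map_pow]
          ring
    obtain ⟨n, a, h1, h2⟩ := hθ P
    rw [hP, zero_mul] at h2
    have h3 : a = 0 := by
      obtain ⟨t, ht⟩ := (IsLocalization.map_eq_zero_iff (RingHom.ker y).primeCompl R a).1 h2.symm
      refine (mul_eq_zero.1 ht).resolve_left fun h0 => t.2 ?_
      rw [h0]; exact Ideal.zero_mem _
    rw [h3, map_zero] at h1
    have h4 : θ P = 0 := by
      have h5 : chi (n • (f : M)) * chi (-(n • (f : M))) = 1 := by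
        rw [← chi_add, add_neg_cancel, chi_zero]
      calc θ P = θ P * (chi (n • (f : M)) * chi (-(n • (f : M)))) := by rw [h5, mul_one]
        _ = 0 := by rw [← mul_assoc, h1, zero_mul]
    exact chi_injective ν hν (h4.trans (map_zero θ).symm)
  -- the local ring is a localization of the polynomial ring
  let p : Ideal (MvPolynomial ι ℂ) := (IsLocalRing.maximalIdeal R).comap ψ
  have hp : p.IsPrime := Ideal.comap_isPrime _ _
  have hmemp : ∀ P, P ∉ p ↔ IsUnit (ψ P) := fun P => by
    simp [p, Ideal.mem_comap, IsLocalRing.mem_maximalIdeal, mem_nonunits_iff]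
  let : Algebra (MvPolynomial ι ℂ) R := ψ.toRingHom.toAlgebra
  have halg : ∀ P, algebraMap (MvPolynomial ι ℂ) R P = ψ P := fun _ => rfl
  have hloc : IsLocalization.AtPrime R p := by
    refine ⟨fun P => (hmemp P).1 P.2, fun z => ?_, fun {P Q} hPQ => ⟨1, ?_⟩⟩
    · obtain ⟨a, s, rfl⟩ := IsLocalization.exists_mk'_eq (RingHom.ker y).primeCompl z
      obtain ⟨Q, P, hQ, hP⟩ := hnum a
      obtain ⟨Q', P', hQ', hP'⟩ := hnum s
      have hs : IsUnit (al s) := hunit s s.2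
      have hP'u : IsUnit (ψ P') := by rw [← hP']; exact hs.mul hQ'
      refine ⟨(P * Q', ⟨Q * P', ?_⟩), ?_⟩
      · exact (hmemp _).2 (by rw [map_mul]; exact hQ.mul hP'u)
      · simp only [halg, map_mul]
        rw [← hP, ← hP']
        have : IsLocalization.mk' R a s * al s = al a := IsLocalization.mk'_spec _ _ _
        linear_combination (ψ Q * ψ Q') * this
    · rw [hψinj hPQ]
  have hreg : IsRegularLocalRing (Localization.AtPrime p) := inferInstance
  exact IsRegularLocalRing.of_ringEquiv
    (IsLocalization.algEquiv p.primeCompl (Localization.AtPrime p) R).toRingEquiv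

end ChartRegular
end


noncomputable section

/-! ## The torus and the points of the codimension one orbits -/

section Points

/-- The Nullstellensatz: maximal ideals are the kernels of the points. -/
theorem exists_pt_of_isMaximal {B : Type*} [CommRing B] [Algebra ℂ B] [Algebra.FiniteType ℂ B]
    (m : Ideal B) [hm : m.IsMaximal] : ∃ u : Pt B, RingHom.ker u = m := by
  let := Ideal.Quotient.field m
  have : Module.Finite ℂ (B ⧸ m) := finite_of_finite_type_of_isJacobsonRing ℂ (B ⧸ m)
  have hbij : Function.Bijective (algebraMap ℂ (B ⧸ m)) :=
    IsAlgClosed.algebraMap_bijective_of_isIntegral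
  let φ : ℂ ≃ₐ[ℂ] (B ⧸ m) := AlgEquiv.ofBijective (Algebra.ofId ℂ (B ⧸ m)) hbij
  refine ⟨(φ.symm : (B ⧸ m) →ₐ[ℂ] ℂ).comp (Ideal.Quotient.mkₐ ℂ m), ?_⟩
  ext b
  simp [RingHom.mem_ker, Ideal.Quotient.eq_zero_iff_mem]

theorem eq_zero_of_forall_pt {B : Type*} [CommRing B] [Algebra ℂ B] [Algebra.FiniteType ℂ B]
    [IsReduced B] {a : B} (h : ∀ u : Pt B, u a = 0) : a = 0 := by
  have : IsJacobsonRing B := isJacobsonRing_of_finiteType (A := ℂ)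
  have h1 : a ∈ (⊥ : Ideal B).jacobson := by
    refine Ideal.mem_sInf.2 fun {m} hm => ?_
    have := hm.2
    obtain ⟨u, rfl⟩ := exists_pt_of_isMaximal m
    exact h u
  rw [← Ideal.radical_eq_jacobson] at h1
  obtain ⟨n, hn⟩ := h1
  exact IsNilpotent.eq_zero ⟨n, hn⟩

theorem isUnit_of_forall_pt {B : Type*} [CommRing B] [Algebra ℂ B] [Algebra.FiniteType ℂ B]
    {a : B} (h : ∀ u : Pt B, u a ≠ 0) : IsUnit a := by
  by_contra ha
  obtain ⟨m, hm, ham⟩ := exists_max_ideal_of_mem_nonunits ha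
  obtain ⟨u, rfl⟩ := exists_pt_of_isMaximal m
  exact h u ham

/-- The units of a Laurent polynomial ring are the monomials. -/
theorem exists_eq_smul_chi_of_isUnit {M : Type*} [AddCommGroup M] [TwoUniqueSums M]
    {a : AddMonoidAlgebra ℂ M} (ha : IsUnit a) : ∃ (c : ℂ) (m : M), a = c • chi m := by
  obtain ⟨a', haa'⟩ := ha.exists_right_inv
  have ha0 : a ≠ 0 := by rintro rfl; simp at haa'
  have ha0' : a' ≠ 0 := by rintro rfl; simp at haa'
  have hs : a.coeff.support.Nonempty := by
    rw [Finsupp.support_nonempty_iff]; simpa using ha0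
  have hs' : a'.coeff.support.Nonempty := by
    rw [Finsupp.support_nonempty_iff]; simpa using ha0'
  -- Otherwise there are two distinct pairs of exponents with unique sums. Each contributes a
  -- non-zero coefficient to the product 1, so both sums are 0, contradicting uniqueness.
  have hcard : a.coeff.support.card * a'.coeff.support.card ≤ 1 := by
    by_contra hlt
    obtain ⟨p, hp, q, hq, hpq, hup, huq⟩ :=
      TwoUniqueSums.uniqueAdd_of_one_lt_card (not_le.1 hlt)
    rw [Finset.mem_product] at hp hq
    have key : ∀ r : M × M, r.1 ∈ a.coeff.support → r.2 ∈ a'.coeff.support →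
        UniqueAdd a.coeff.support a'.coeff.support r.1 r.2 → r.1 + r.2 = 0 := by
      intro r h1 h2 hr
      have h3 := AddMonoidAlgebra.coeff_mul_add_of_uniqueAdd (R := ℂ) hr
      rw [haa'] at h3
      by_contra hne
      rw [AddMonoidAlgebra.one_def, AddMonoidAlgebra.coeff_single,
        Finsupp.single_eq_of_ne hne] at h3
      exact mul_ne_zero (Finsupp.mem_support_iff.1 h1) (Finsupp.mem_support_iff.1 h2) h3.symm
    have := hup hq.1 hq.2 (by rw [key p hp.1 hp.2 hup, key q hq.1 hq.2 huq])
    exact hpq (Prod.ext this.1.symm this.2.symm)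
  have hcard1 : a.coeff.support.card = 1 := by
    have h1 := hs.card_pos
    have h2 := hs'.card_pos
    nlinarith
  obtain ⟨m, c, hc, h⟩ := Finsupp.card_support_eq_one'.1 hcard1
  exact ⟨c, m, by rw [smul_chi]; exact AddMonoidAlgebra.ext h⟩

end Points

/-! ### Torus points and general points of the divisor orbits -/

section OrbitPoints

variable {M : Type*} [AddCommGroup M] {S : AddSubmonoid M} {U : Finset (M →+ ℤ)} {e : M}

/-- No functional of `U` can be omitted in the description of the dual monoid. -/
def IsIrredundant (U : Finset (M →+ ℤ)) : Prop :=
  ∀ u ∈ U, ∃ m : M, u m < 0 ∧ ∀ u' ∈ U, u' ≠ u → 0 ≤ u' m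

/-- Redundant functionals are discarded so that each remaining one defines a facet of the dual cone,
and so an orbit of codimension one. -/
theorem IsGorenstein.exists_isIrredundant (h : IsGorenstein S U e) :
    ∃ U' : Finset (M →+ ℤ), IsGorenstein S U' e ∧ IsIrredundant U' := by
  classical
  induction U using Finset.strongInduction with
  | H U ih =>
    by_cases hU : IsIrredundant U
    · exact ⟨U, h, hU⟩
    · simp only [IsIrredundant] at hU
      push Not at hU
      obtain ⟨u, hu, hum⟩ := hU
      refine ih (U.erase u) (Finset.erase_ssubset hu) ⟨fun m => ?_, fun u' hu' =>
        h.apply_eq_one u' (Finset.mem_of_mem_erase hu')⟩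
      rw [h.mem_iff]
      refine ⟨fun hm u' hu' => hm u' (Finset.mem_of_mem_erase hu'), fun hm u' hu' => ?_⟩
      by_cases huu : u' = u
      · subst huu
        by_contra hlt
        obtain ⟨v, hv, hvu, hvm⟩ := hum m (not_le.1 hlt)
        exact absurd (hm v (Finset.mem_erase.2 ⟨hvu, hv⟩)) (not_le.2 hvm)
      · exact hm u' (Finset.mem_erase.2 ⟨huu, hu'⟩)

theorem pt_chi_ne_zero {M : Type*} [AddCommGroup M] (u : Pt (AddMonoidAlgebra ℂ M)) (m : M) :
    u (chi m) ≠ 0 := by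
  intro h
  have h1 : u (chi (m + -m)) = 1 := by rw [add_neg_cancel, chi_zero, map_one]
  rw [chi_add, map_mul, h, zero_mul] at h1
  exact zero_ne_one h1

/-- Here `J` is empty: `e` is positive on all functionals, so inverting χ^e yields the full torus.
-/
theorem IsGorenstein.isChart_torus (h : IsGorenstein S U e) (u : Pt (AddMonoidAlgebra ℂ M))
    {ι : Type*} (b : Module.Basis ι ℤ M) :
    IsChart (u.comp (AddMonoidAlgebra.mapDomainAlgHom ℂ ℂ S.subtype)) b ∅ ⟨e, h.mem⟩ where
  ne_zero := by
    rw [AlgHom.comp_apply, mapDomainAlgHom_chi]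
    exact pt_chi_ne_zero u _
  nonneg := by simp
  eq_zero := by simp
  exists_add_mem := fun m _ => h.add_nsmul_e_mem m

open Classical in
/-- The distinguished point of the orbit of the ray `u`. -/
theorem IsGorenstein.exists_rayPoint (h : IsGorenstein S U e) {u : M →+ ℤ} (hu : u ∈ U) :
    ∃ y : Pt (AddMonoidAlgebra ℂ S), ∀ m : S, y (chi m) = if u m = 0 then 1 else 0 := by
  have hpos : ∀ m : S, 0 ≤ u m := fun m => (h.mem_iff _).1 m.2 u hu
  refine ⟨AddMonoidAlgebra.lift ℂ ℂ S
    { toFun := fun m => if u m.toAdd = 0 then 1 else 0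
      map_one' := by simp
      map_mul' := fun m m' => ?_ }, fun m => ?_⟩
  · have h1 := hpos m.toAdd
    have h2 := hpos m'.toAdd
    simp only [toAdd_mul, AddSubmonoid.coe_add, map_add]
    by_cases h3 : u m.toAdd = 0 <;> by_cases h4 : u m'.toAdd = 0
    · simp [h3, h4]
    · simp [h3, h4]
    · simp [h3, h4]
    · rw [if_neg h3, if_neg h4, if_neg (by omega)]; simp
  · simp [chi, AddMonoidAlgebra.lift_single]

/-- The condition u(e) = 1 makes `u` surjective, so its kernel splits off. -/
theorem exists_basis_repr_eq [Module.Free ℤ M] [Module.Finite ℤ M] (u : M →+ ℤ)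
    (hu : u e = 1) : ∃ (b : Module.Basis (Fin (Module.finrank ℤ M)) ℤ M)
      (j : Fin (Module.finrank ℤ M)), ∀ m, b.repr m j = u m := by
  let l : M →ₗ[ℤ] ℤ := u.toIntLinearMap
  have hl : Function.Surjective l := fun n => ⟨n • e, by simp [l, hu]⟩
  let ε := l.quotKerEquivOfSurjective hl
  let bQ : Module.Basis Unit ℤ (M ⧸ LinearMap.ker l) := (Module.Basis.singleton Unit ℤ).map ε.symm
  let b := (Module.finBasis ℤ (LinearMap.ker l)).sumQuot bQ
  have hcard : Fintype.card (Fin (Module.finrank ℤ (LinearMap.ker l)) ⊕ Unit) =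
      Module.finrank ℤ M := (Module.finrank_eq_card_basis b).symm
  refine ⟨b.reindex (Fintype.equivFinOfCardEq hcard),
    Fintype.equivFinOfCardEq hcard (Sum.inr ()), fun m => ?_⟩
  have h1 : b.repr m (Sum.inr ()) = bQ.repr (Submodule.Quotient.mk m) () :=
    Module.Basis.sumQuot_repr_inr _ _ _ _
  have h2 : ε (Submodule.Quotient.mk m) = u m :=
    LinearMap.quotKerEquivOfSurjective_apply_mk l hl m
  simp [h1, bQ, h2]

theorem IsGorenstein.exists_isChart_rayPoint [Module.Free ℤ M] [Module.Finite ℤ M]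
    (h : IsGorenstein S U e) (hirr : IsIrredundant U) {u : M →+ ℤ} (hu : u ∈ U)
    {y : Pt (AddMonoidAlgebra ℂ S)} (hy : ∀ m : S, y (chi m) ≠ 0 ↔ u m = 0) :
    ∃ (b : Module.Basis (Fin (Module.finrank ℤ M)) ℤ M)
      (J : Set (Fin (Module.finrank ℤ M))) (f : S), IsChart y b J f := by
  obtain ⟨b, j, hb⟩ := exists_basis_repr_eq u (h.apply_eq_one u hu)
  obtain ⟨m₀, hm₀, hm₀'⟩ := hirr u hu
  -- The element m₀ - u(m₀) e is killed by `u`; the other functionals are at least -u(m₀) ≥ 1 on it.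
  -- Inverting it leaves only the inequality of `u`.
  have huf : u (m₀ - u m₀ • e) = 0 := by
    rw [map_sub, map_zsmul, h.apply_eq_one u hu]; simp
  have huf' : ∀ u' ∈ U, u' ≠ u → 1 ≤ u' (m₀ - u m₀ • e) := by
    intro u' hu' hne
    have := hm₀' u' hu' hne
    rw [map_sub, map_zsmul, h.apply_eq_one u' hu', smul_eq_mul, mul_one]
    omega
  have hnn : ∀ u' ∈ U, 0 ≤ u' (m₀ - u m₀ • e) := by
    intro u' hu'
    by_cases hne : u' = u
    · rw [hne, huf]
    · exact zero_le_one.trans (huf' u' hu' hne)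
  refine ⟨b, {j}, ⟨_, (h.mem_iff _).2 hnn⟩, (hy _).2 huf, ?_, ?_, ?_⟩
  · rintro m hm _ rfl
    rw [hb]; exact (h.mem_iff m).1 hm u hu
  · rintro m hm _ rfl
    rw [hb]; exact (hy m).1 hm
  · intro m hm
    refine h.add_nsmul_mem hnn fun u' hu' => ?_
    by_cases hne : u' = u
    · left; rw [hne, ← hb]; exact hm j rfl
    · exact Or.inr (huf' u' hu' hne)

end OrbitPoints
end


noncomputable section

/-! ## The invariant volume form of a Gorenstein toric variety -/

section Volume

variable {M : Type*} [AddCommGroup M] {S : AddSubmonoid M} {e : M} {N : ℕ}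

/-- The inclusion of the dense torus, on coordinate rings. -/
abbrev latticeIncl (S : AddSubmonoid M) : AddMonoidAlgebra ℂ S →ₐ[ℂ] AddMonoidAlgebra ℂ M :=
  AddMonoidAlgebra.mapDomainAlgHom ℂ ℂ S.subtype

theorem dWedge_apply {B : Type*} [CommRing B] [Algebra ℂ B] {k : ℕ} (h : Fin k → B) (y : Pt B)
    (v : Fin k → tangentSpace y) :
    dWedge h y v = (Matrix.of fun a b => (v a : B →ₗ[ℂ] ℂ) (h b)).det := rfl

/-- By additivity of `l a` the matrix factors as the values on the basis, times the integral
coordinate matrix of β, times a diagonal matrix. -/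
theorem logarithmic_det {N : ℕ} (b₀ : Module.Basis (Fin N) ℤ M) (l : Fin N → M →+ ℂ)
    (w : Fin N → ℂ) (β : Fin N → M) :
    (Matrix.of fun a b => w b * l a (β b)).det =
      (∏ b, w b) * (b₀.det β : ℂ) * (Matrix.of fun a i => l a (b₀ i)).det := by
  have h1 : (Matrix.of fun a b => w b * l a (β b)) =
      (Matrix.of fun a i => l a (b₀ i)) * ((b₀.toMatrix β).map (Int.castRingHom ℂ)) *
        Matrix.diagonal w := by
    ext a b
    rw [Matrix.mul_diagonal, Matrix.mul_apply]
    simp only [Matrix.of_apply, Matrix.map_apply, Module.Basis.toMatrix_apply]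
    conv_lhs => rw [← b₀.sum_repr (β b)]
    rw [map_sum, mul_comm]
    congr 1
    exact Finset.sum_congr rfl fun i _ => by
      rw [map_zsmul, zsmul_eq_mul, mul_comm]; rfl
  rw [h1, Matrix.det_mul, Matrix.det_mul, Matrix.det_diagonal, Module.Basis.det_apply,
    ← RingHom.mapMatrix_apply, ← RingHom.map_det]
  simp only [eq_intCast]
  ring

/-- The logarithmic derivative of a tangent vector of the torus. -/
theorem exists_logDeriv (u : Pt (AddMonoidAlgebra ℂ M)) (D : tangentSpace u) :
    ∃ l : M →+ ℂ, ∀ m, (D : AddMonoidAlgebra ℂ M →ₗ[ℂ] ℂ) (chi m) = u (chi m) * l m := by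
  refine ⟨AddMonoidHom.mk' (fun m => (D : AddMonoidAlgebra ℂ M →ₗ[ℂ] ℂ) (chi m) / u (chi m))
    fun a b => ?_, fun m => ?_⟩
  · have ha := pt_chi_ne_zero u a
    have hb := pt_chi_ne_zero u b
    rw [chi_add, tangentSpace_mul, map_mul]
    field_simp
    ring
  · have hm := pt_chi_ne_zero u m
    simp only [AddMonoidHom.mk'_apply]
    field_simp

variable {U : Finset (M →+ ℤ)}

/-- The logarithmic derivative is additive on `S` and extends to M by m = (m + c e) - c e. Thus
vectors at torus points of Y are handled without identifying the two tangent spaces. -/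
theorem IsGorenstein.exists_logDeriv (h : IsGorenstein S U e) (u : Pt (AddMonoidAlgebra ℂ M))
    (D : tangentSpace (u.comp (latticeIncl S))) :
    ∃ l : M →+ ℂ, ∀ m : S,
      (D : AddMonoidAlgebra ℂ S →ₗ[ℂ] ℂ) (chi m) = u (chi (m : M)) * l m := by
  have hu : ∀ m : S, (u.comp (latticeIncl S)) (chi m) = u (chi (m : M)) := fun m => by
    rw [AlgHom.comp_apply, mapDomainAlgHom_chi]; rfl
  let θ : S → ℂ := fun m => (D : AddMonoidAlgebra ℂ S →ₗ[ℂ] ℂ) (chi m) / u (chi (m : M))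
  have hθ : ∀ a b, θ (a + b) = θ a + θ b := by
    intro a b
    have ha := pt_chi_ne_zero u (a : M)
    have hb := pt_chi_ne_zero u (b : M)
    simp only [θ]
    rw [chi_add, tangentSpace_mul, hu, hu, AddSubmonoid.coe_add, chi_add, map_mul]
    field_simp
    ring
  have hθn : ∀ (n : ℕ) a, θ (n • a) = n * θ a := by
    intro n a
    induction n with
    | zero => simp [θ, chi_zero, tangentSpace_one]
    | succ n ih => rw [succ_nsmul, hθ, ih]; push_cast; ring
  let e' : S := ⟨e, h.mem⟩
  choose c hc using h.add_nsmul_e_mem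
  have key : ∀ (m : M) (a b : S), (a : M) = m + b → θ a - θ b = θ ⟨_, hc m⟩ - c m * θ e' := by
    intro m a b hab
    have h1 : a + c m • e' = ⟨_, hc m⟩ + b := by
      apply Subtype.ext
      simp only [AddSubmonoid.coe_add, AddSubmonoidClass.coe_nsmul, hab, e']
      abel
    have h2 := congrArg θ h1
    rw [hθ, hθ, hθn] at h2
    linear_combination h2
  refine ⟨AddMonoidHom.mk' (fun m => θ ⟨_, hc m⟩ - c m * θ e') fun m m' => ?_, fun m => ?_⟩
  · rw [← key (m + m') (⟨_, hc m⟩ + ⟨_, hc m'⟩) ((c m + c m') • e') (by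
      simp only [AddSubmonoid.coe_add, AddSubmonoidClass.coe_nsmul, e', add_smul]
      abel), hθ, hθn]
    push_cast
    ring
  · have hm := pt_chi_ne_zero u (m : M)
    rw [AddMonoidHom.mk'_apply, ← key m m 0 (by simp)]
    have h0 : θ 0 = 0 := by simp [θ, chi_zero, tangentSpace_one]
    rw [h0, sub_zero]
    simp only [θ]
    field_simp

/-- Monomials `β` of full rank, and `g`, `s` with `g ∏ β = s e`.  They present the volume form
as `(g / s) dβ₁ ∧ ⋯ ∧ dβ_N`, up to a constant, where `s ≠ 0`. -/
structure VolumePresentation (S : AddSubmonoid M) (e : M) (b₀ : Module.Basis (Fin N) ℤ M) where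
  β : Fin N → S
  g : S
  s : S
  sum_eq : (g : M) + ∑ i, (β i : M) = s + e
  det_ne_zero : b₀.det (fun i => (β i : M)) ≠ 0

/-- The form given by a presentation. -/
def VolumePresentation.form {b₀ : Module.Basis (Fin N) ℤ M} (P : VolumePresentation S e b₀) :
    Form (AddMonoidAlgebra ℂ S) N := fun y =>
  (y (chi P.g) / (y (chi P.s) * (b₀.det (fun i => (P.β i : M)) : ℂ))) •
    dWedge (fun i => chi (P.β i)) y

/-- The presentation of the volume form by local coordinates. -/
def LocalCoords.presentation {b₀ : Module.Basis (Fin N) ℤ M} {y : Pt (AddMonoidAlgebra ℂ S)}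
    (L : LocalCoords e b₀ y) : VolumePresentation S e b₀ where
  β := L.β
  g := L.g
  s := L.s
  sum_eq := L.sum_eq
  det_ne_zero := L.det_ne_zero

open Classical in
/-- The volume form which is `∏ dβ / β`, multiplied by the character `e`, on the torus. -/
def volForm (S : AddSubmonoid M) (e : M) (b₀ : Module.Basis (Fin N) ℤ M) :
    Form (AddMonoidAlgebra ℂ S) N := fun y =>
  -- The value 0 is a default where no presentation applies. At points with local coordinates the
  -- choice of presentation is immaterial, by `volForm_eq`.
  if h : ∃ P : VolumePresentation S e b₀, y (chi P.s) ≠ 0 then h.choose.form y else 0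

namespace VolumePresentation

variable {b₀ : Module.Basis (Fin N) ℤ M}

/-- The relation g ∏ β = s e turns the coefficient of the logarithmic determinant into χ^e, so no
trace of the presentation remains. -/
theorem form_torus (P : VolumePresentation S e b₀) (u : Pt (AddMonoidAlgebra ℂ M))
    (v : Fin N → tangentSpace (u.comp (latticeIncl S))) (l : Fin N → M →+ ℂ)
    (hl : ∀ a (m : S), (v a : AddMonoidAlgebra ℂ S →ₗ[ℂ] ℂ) (chi m) = u (chi (m : M)) * l a m) :
    P.form (u.comp (latticeIncl S)) v =
      u (chi e) * (Matrix.of fun a i => l a (b₀ i)).det := by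
  have hu : ∀ m : S, (u.comp (latticeIncl S)) (chi m) = u (chi (m : M)) := fun m => by
    rw [AlgHom.comp_apply, mapDomainAlgHom_chi]; rfl
  have h1 := congrArg (fun m => u (chi m)) P.sum_eq
  simp only [chi_add, chi_sum, map_mul, map_prod] at h1
  have hs := pt_chi_ne_zero u (P.s : M)
  have hd : (b₀.det (fun i => (P.β i : M)) : ℂ) ≠ 0 := by exact_mod_cast P.det_ne_zero
  rw [form, AlternatingMap.smul_apply, dWedge_apply]
  simp only [hl, hu]
  rw [logarithmic_det b₀ l (fun b => u (chi (P.β b : M))), smul_eq_mul, div_mul_eq_mul_div,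
    div_eq_iff (mul_ne_zero hs hd)]
  linear_combination (b₀.det (fun i => (P.β i : M)) : ℂ) *
    (Matrix.of fun a i => l a (b₀ i)).det * h1

variable [Module.Free ℤ M] [Module.Finite ℤ M]

instance instFGLattice : AddMonoid.FG M :=
  AddGroup.fg_iff_addMonoid_fg.1 (Module.Finite.iff_addGroup_fg.1 inferInstance)

instance instNoZeroDivisorsLattice : NoZeroDivisors (AddMonoidAlgebra ℂ M) := inferInstance

/-- On global derivations each presentation gives a quotient of regular functions. The
cross-multiplied identity holds on the torus by `form_torus`, and the coordinate ring embeds into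
that of the torus. -/
theorem form_toTangent_eq (h : IsGorenstein S U e) (P P' : VolumePresentation S e b₀)
    {y : Pt (AddMonoidAlgebra ℂ S)} (hs : y (chi P.s) ≠ 0) (hs' : y (chi P'.s) ≠ 0)
    (E : Fin N → Derivation ℂ (AddMonoidAlgebra ℂ S) (AddMonoidAlgebra ℂ S)) :
    P.form y (fun a => (E a).toTangent y) = P'.form y (fun a => (E a).toTangent y) := by
  let V : VolumePresentation S e b₀ → AddMonoidAlgebra ℂ S := fun P =>
    (b₀.det (fun i => (P.β i : M)) : ℂ)⁻¹ •
      (chi P.g * (Matrix.of fun a b => E a (chi (P.β b))).det)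
  have hV : ∀ (P : VolumePresentation S e b₀) (y' : Pt (AddMonoidAlgebra ℂ S)),
      P.form y' (fun a => (E a).toTangent y') = y' (V P) / y' (chi P.s) := by
    intro P y'
    rw [form, AlternatingMap.smul_apply, dWedge_apply]
    simp only [V, Derivation.toTangent_apply, map_smul, map_mul, AlgHom.map_det, smul_eq_mul]
    rw [show (Matrix.of fun a b => y' ((E a) (chi (P.β b)))) =
      y'.mapMatrix (Matrix.of fun a b => E a (chi (P.β b))) from rfl]
    simp only [div_eq_mul_inv, mul_inv]
    ring
  have key : V P * chi P'.s = V P' * chi P.s := by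
    apply chi_injective S.subtype S.subtype_injective
    rw [← sub_eq_zero]
    apply eq_zero_of_forall_pt
    intro u
    have hu : ∀ m : S, (u.comp (latticeIncl S)) (chi m) ≠ 0 := fun m => by
      rw [AlgHom.comp_apply, mapDomainAlgHom_chi]; exact pt_chi_ne_zero u _
    choose l hl using fun a => h.exists_logDeriv u ((E a).toTangent (u.comp (latticeIncl S)))
    have h1 := P.form_torus u _ l hl
    rw [← P'.form_torus u _ l hl, hV, hV, div_eq_div_iff (hu _) (hu _)] at h1
    rw [map_sub, sub_eq_zero]
    simpa only [map_mul, AlgHom.comp_apply] using h1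
  rw [hV, hV, div_eq_div_iff hs hs']
  simpa only [map_mul] using congrArg y key

end VolumePresentation

namespace LocalCoords

variable {b₀ : Module.Basis (Fin N) ℤ M} [Module.Free ℤ M] [Module.Finite ℤ M] [NeZero N]
  {y : Pt (AddMonoidAlgebra ℂ S)} (L : LocalCoords e b₀ y)

include L

theorem volForm_eq (h : IsGorenstein S U e) {y' : Pt (AddMonoidAlgebra ℂ S)}
    (hy' : y' (chi L.f) ≠ 0) {P : VolumePresentation S e b₀} (hs : y' (chi P.s) ≠ 0) :
    volForm S e b₀ y' = P.form y' := by
  have hex : ∃ P : VolumePresentation S e b₀, y' (chi P.s) ≠ 0 := ⟨P, hs⟩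
  rw [volForm, dif_pos hex]
  refine Module.Basis.ext_alternating (L.basis hy') fun v _ => ?_
  simp only [L.basis_apply]
  exact VolumePresentation.form_toTangent_eq h _ _ hex.choose_spec hs fun a => L.E (v a)

theorem volForm_eq_presentation (h : IsGorenstein S U e) {y' : Pt (AddMonoidAlgebra ℂ S)}
    (hy' : y' (chi L.f) ≠ 0) : volForm S e b₀ y' = L.presentation.form y' :=
  L.volForm_eq h hy' (P := L.presentation) (L.s_ne_zero y' hy')

/-- The coefficient of the volume form in the frame. -/
def volCoeff : AddMonoidAlgebra ℂ S :=
  (b₀.det (fun i => (L.β i : M)) : ℂ)⁻¹ •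
    (chi L.g * (Matrix.of fun a b => L.E a (chi (L.β b))).det)

omit [Module.Free ℤ M] [Module.Finite ℤ M] in
theorem volCoeff_ne_zero {y' : Pt (AddMonoidAlgebra ℂ S)} (hy' : y' (chi L.f) ≠ 0) :
    y' L.volCoeff ≠ 0 := by
  have hd : (b₀.det (fun i => (L.β i : M)) : ℂ) ≠ 0 := by exact_mod_cast L.det_ne_zero
  rw [volCoeff, map_smul, map_mul, AlgHom.map_det, smul_eq_mul]
  exact mul_ne_zero (inv_ne_zero hd) (mul_ne_zero (L.g_ne_zero y' hy') (L.det_frame_ne_zero hy'))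

theorem volForm_frame (h : IsGorenstein S U e) {y' : Pt (AddMonoidAlgebra ℂ S)}
    (hy' : y' (chi L.f) ≠ 0) :
    volForm S e b₀ y' (L.basis hy') = y' L.volCoeff / y' (chi L.s) := by
  have hd : (b₀.det (fun i => (L.β i : M)) : ℂ) ≠ 0 := by exact_mod_cast L.det_ne_zero
  have hs := L.s_ne_zero y' hy'
  rw [L.volForm_eq_presentation h hy', VolumePresentation.form, AlternatingMap.smul_apply,
    dWedge_apply]
  simp only [L.basis_apply, volCoeff, Derivation.toTangent_apply, map_smul, map_mul,
    AlgHom.map_det, smul_eq_mul, presentation]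
  rw [show (Matrix.of fun a b => y' ((L.E a) (chi (L.β b)))) =
      y'.mapMatrix (Matrix.of fun a b => L.E a (chi (L.β b))) from rfl]
  field_simp

theorem volForm_ne_zero (h : IsGorenstein S U e) {y' : Pt (AddMonoidAlgebra ℂ S)}
    (hy' : y' (chi L.f) ≠ 0) : volForm S e b₀ y' ≠ 0 := by
  intro h0
  have h1 := L.volForm_frame h hy'
  rw [h0, AlternatingMap.zero_apply] at h1
  exact div_ne_zero (L.volCoeff_ne_zero hy') (L.s_ne_zero y' hy') h1.symm

end LocalCoords

/-- The volume form on the torus. -/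
theorem IsGorenstein.pullback_volForm (h : IsGorenstein S U e) [Module.Free ℤ M]
    [Module.Finite ℤ M] [NeZero N] (b₀ : Module.Basis (Fin N) ℤ M)
    (u : Pt (AddMonoidAlgebra ℂ M)) :
    Form.pullback (latticeIncl S) (volForm S e b₀) u =
      (u (chi e) / ∏ j, u (chi (b₀ j))) • dWedge (fun j => chi (b₀ j)) u := by
  obtain ⟨L⟩ := (h.isChart_torus u b₀).exists_localCoords h b₀
  have hprod : ∏ j, u (chi (b₀ j)) ≠ 0 :=
    Finset.prod_ne_zero_iff.2 fun j _ => pt_chi_ne_zero u _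
  ext v
  choose l hl using fun a => _root_.exists_logDeriv u (v a)
  rw [Form.pullback, AlternatingMap.compLinearMap_apply, L.volForm_eq_presentation h L.ne_zero,
    VolumePresentation.form_torus _ u _ l fun a m => by
      rw [pushTangent_apply, mapDomainAlgHom_chi]; exact hl a m,
    AlternatingMap.smul_apply, dWedge_apply]
  simp only [hl]
  rw [logarithmic_det b₀ l, Module.Basis.det_self, smul_eq_mul]
  field_simp
  simp

/-- The volume form is invariant under the torus elements at which the character `e` is `1`. -/
theorem LocalCoords.pullback_volForm {b₀ : Module.Basis (Fin N) ℤ M} [Module.Free ℤ M]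
    [Module.Finite ℤ M] [NeZero N] {y : Pt (AddMonoidAlgebra ℂ S)} (L : LocalCoords e b₀ y)
    (h : IsGorenstein S U e) (τ : AddMonoidAlgebra ℂ S →ₐ[ℂ] AddMonoidAlgebra ℂ S)
    (w : Multiplicative M →* ℂˣ)
    (hτ : ∀ m : S, τ (chi m) = ((w (Multiplicative.ofAdd (m : M)) : ℂˣ) : ℂ) • chi m)
    (hw : w (Multiplicative.ofAdd e) = 1) :
    Form.pullback τ (volForm S e b₀) y = volForm S e b₀ y := by
  have hy : ∀ m : S, (y.comp τ) (chi m) = (w (Multiplicative.ofAdd (m : M)) : ℂˣ) * y (chi m) :=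
    fun m => by rw [AlgHom.comp_apply, hτ, map_smul, smul_eq_mul]
  have hf : (y.comp τ) (chi L.f) ≠ 0 := by
    rw [hy]; exact mul_ne_zero (Units.ne_zero _) L.ne_zero
  have hd : (b₀.det (fun i => (L.β i : M)) : ℂ) ≠ 0 := by exact_mod_cast L.det_ne_zero
  have hs := L.s_ne_zero y L.ne_zero
  -- As w(e) = 1, the relation gives w(g) ∏ w(β) = w(s): the factors acquired by g, s and the dβ_i
  -- cancel.
  have h1 := congrArg (fun m => ((w (Multiplicative.ofAdd m) : ℂˣ) : ℂ)) L.sum_eq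
  simp only [ofAdd_add, ofAdd_sum, map_mul, map_prod, Units.val_mul, Units.coe_prod, hw,
    mul_one] at h1
  ext v
  rw [Form.pullback, AlternatingMap.compLinearMap_apply, L.volForm_eq_presentation h hf,
    L.volForm_eq_presentation h L.ne_zero, VolumePresentation.form, VolumePresentation.form,
    AlternatingMap.smul_apply, AlternatingMap.smul_apply, dWedge_apply, dWedge_apply]
  simp only [presentation, hy, pushTangent_apply, hτ, map_smul, smul_eq_mul]
  have h2 := Matrix.det_mul_row (fun b => ((w (Multiplicative.ofAdd (L.β b : M)) : ℂˣ) : ℂ))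
    (Matrix.of fun a b => (v a : AddMonoidAlgebra ℂ S →ₗ[ℂ] ℂ) (chi (L.β b)))
  simp only [Matrix.of_apply] at h2
  rw [h2]
  have hws := Units.ne_zero (w (Multiplicative.ofAdd (L.s : M)))
  field_simp
  linear_combination (y (chi L.g) * (Matrix.of fun a b =>
    (v a : AddMonoidAlgebra ℂ S →ₗ[ℂ] ℂ) (chi (L.β b))).det) * h1

end Volume
end


noncomputable section

/-! ## Uniqueness of the volume form -/

section Uniqueness

variable {M : Type*} [AddCommGroup M] {S : AddSubmonoid M} {e : M} {N : ℕ} {U : Finset (M →+ ℤ)}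

theorem alternatingMap_sum_apply {V ι κ : Type*} [AddCommGroup V] [Module ℂ V] (s : Finset κ)
    (f : κ → V [⋀^ι]→ₗ[ℂ] ℂ) (v : ι → V) : (∑ k ∈ s, f k) v = ∑ k ∈ s, f k v := by
  classical
  induction s using Finset.induction_on with
  | empty => simp
  | insert k s hk ih => rw [Finset.sum_insert hk, Finset.sum_insert hk, AlternatingMap.add_apply, ih]

theorem eq_sum_coeff_smul_chi {Γ : Type*} [AddCommMonoid Γ] (a : AddMonoidAlgebra ℂ Γ) :
    a = ∑ m ∈ a.coeff.support, a.coeff m • chi m := by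
  ext m
  simp only [chi, AddMonoidAlgebra.coeff_sum, AddMonoidAlgebra.coeff_smul,
    AddMonoidAlgebra.coeff_single, Finsupp.smul_single, smul_eq_mul, mul_one]
  exact (DFunLike.congr_fun (Finsupp.sum_single a.coeff) m).symm

theorem exists_coeff_ne_zero {Γ : Type*} [AddCommMonoid Γ] {y : Pt (AddMonoidAlgebra ℂ Γ)}
    {a : AddMonoidAlgebra ℂ Γ} (h : y a ≠ 0) : ∃ m, y (chi m) ≠ 0 ∧ a.coeff m ≠ 0 := by
  by_contra! hne
  apply h
  rw [eq_sum_coeff_smul_chi a, map_sum]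
  refine Finset.sum_eq_zero fun m _ => ?_
  rw [map_smul, smul_eq_mul]
  by_cases hm : y (chi m) = 0
  · rw [hm, mul_zero]
  · rw [hne m hm, zero_mul]

theorem coeff_latticeIncl (a : AddMonoidAlgebra ℂ S) (m : S) :
    (latticeIncl S a).coeff m = a.coeff m := by
  induction a using chi_induction with
  | hchi m' =>
    rw [mapDomainAlgHom_chi]
    exact Finsupp.single_apply_left S.subtype_injective m' m 1
  | hadd a b ha hb => simp only [map_add, AddMonoidAlgebra.coeff_add, Finsupp.add_apply, ha, hb]
  | hsmul c a ha => simp only [map_smul, AddMonoidAlgebra.coeff_smul, Finsupp.smul_apply, ha]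

theorem mem_of_coeff_latticeIncl {a : AddMonoidAlgebra ℂ S} {m : M}
    (h : (latticeIncl S a).coeff m ≠ 0) : m ∈ S := by
  by_contra hm
  apply h
  clear h
  induction a using chi_induction with
  | hchi m' =>
    rw [mapDomainAlgHom_chi]
    exact Finsupp.single_eq_of_ne (by rintro rfl; exact hm m'.2)
  | hadd a b ha hb =>
    rw [map_add, AddMonoidAlgebra.coeff_add, Finsupp.add_apply, ha, hb, add_zero]
  | hsmul c a ha =>
    rw [map_smul, AddMonoidAlgebra.coeff_smul, Finsupp.smul_apply, ha, smul_zero]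

theorem coeff_smul_chi_mul (c : ℂ) (m₀ : M) (a : AddMonoidAlgebra ℂ M) (m : M) :
    (c • chi m₀ * a).coeff (m₀ + m) = c * a.coeff m := by
  rw [smul_mul_assoc, AddMonoidAlgebra.coeff_smul, Finsupp.smul_apply, chi, smul_eq_mul]
  simp

variable [Module.Free ℤ M] [Module.Finite ℤ M]

theorem IsGorenstein.exists_localCoords (h : IsGorenstein S U e)
    (b₀ : Module.Basis (Fin N) ℤ M)
    {y : Pt (AddMonoidAlgebra ℂ S)} (hy : Module.Finite ℂ (tangentSpace y))
    (hy' : Module.finrank ℂ (tangentSpace y) ≤ N) : Nonempty (LocalCoords e b₀ y) := by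
  have hN : Module.finrank ℤ M = N := by
    simpa using Module.finrank_eq_card_basis b₀
  obtain ⟨b, J, f, hc⟩ := h.exists_isChart y (by omega)
  exact (hc.reindex (finCongr hN)).exists_localCoords h b₀

theorem IsGorenstein.exists_localCoords_of_isNonsingular (h : IsGorenstein S U e)
    (hdim : ringKrullDim (AddMonoidAlgebra ℂ S) ≤ N) (b₀ : Module.Basis (Fin N) ℤ M)
    {y : Pt (AddMonoidAlgebra ℂ S)} (hy : IsNonsingular y) : Nonempty (LocalCoords e b₀ y) := by
  obtain ⟨h1, h2⟩ := finite_tangentSpace_of_isNonsingular hy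
  refine h.exists_localCoords b₀ h1 ?_
  exact_mod_cast h2.trans ((ringKrullDim_atPrime_le _).trans hdim)

variable [NeZero N] {b₀ : Module.Basis (Fin N) ℤ M}

theorem LocalCoords.isRegularForm_near (h : IsGorenstein S U e) {y : Pt (AddMonoidAlgebra ℂ S)}
    (L : LocalCoords e b₀ y) (y' : Pt (AddMonoidAlgebra ℂ S)) (hy' : y' (chi L.f * chi L.s) ≠ 0) :
    volForm S e b₀ y' =
      (y' ((b₀.det (fun i => (L.β i : M)) : ℂ)⁻¹ • (chi L.f * chi L.g)) /
        y' (chi L.f * chi L.s)) • dWedge (fun i => chi (L.β i)) y' := by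
  rw [map_mul] at hy'
  have hf := left_ne_zero_of_mul hy'
  have hs := right_ne_zero_of_mul hy'
  have hd : (b₀.det (fun i => (L.β i : M)) : ℂ) ≠ 0 := by exact_mod_cast L.det_ne_zero
  rw [L.volForm_eq_presentation h hf, VolumePresentation.form]
  simp only [presentation, map_smul, map_mul, smul_eq_mul]
  congr 1
  field_simp

theorem IsGorenstein.isRegularForm_volForm (h : IsGorenstein S U e)
    (hdim : ringKrullDim (AddMonoidAlgebra ℂ S) ≤ N) :
    IsRegularForm (nonsingularPart (AddMonoidAlgebra ℂ S)) (volForm S e b₀) := by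
  intro y hy
  obtain ⟨L⟩ := h.exists_localCoords_of_isNonsingular hdim b₀ hy
  refine ⟨chi L.f * chi L.s, ?_, 1,
    fun _ => (b₀.det (fun i => (L.β i : M)) : ℂ)⁻¹ • (chi L.f * chi L.g),
    fun _ i => chi (L.β i), fun y' _ hy' => ?_⟩
  · rw [map_mul]; exact mul_ne_zero L.ne_zero (L.s_ne_zero y L.ne_zero)
  · rw [L.isRegularForm_near h y' hy']
    simp only [Finset.univ_unique, Finset.sum_const, Finset.card_singleton, one_smul]

theorem IsGorenstein.isNowhereVanishing_volForm (h : IsGorenstein S U e)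
    (hdim : ringKrullDim (AddMonoidAlgebra ℂ S) ≤ N) :
    IsNowhereVanishing (nonsingularPart (AddMonoidAlgebra ℂ S)) (volForm S e b₀) := by
  intro y hy
  obtain ⟨L⟩ := h.exists_localCoords_of_isNonsingular hdim b₀ hy
  exact L.volForm_ne_zero h L.ne_zero

theorem IsGorenstein.isNonsingular_torus (h : IsGorenstein S U e)
    (u : Pt (AddMonoidAlgebra ℂ M)) : IsNonsingular (u.comp (latticeIncl S)) :=
  (h.isChart_torus u (Module.finBasis ℤ M)).isNonsingular h

/-- Two elements of the coordinate ring agreeing on an open part of the torus agree. -/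
theorem eq_of_forall_torus {q a b : AddMonoidAlgebra ℂ S} (hq : q ≠ 0)
    (h : ∀ u : Pt (AddMonoidAlgebra ℂ M), u (latticeIncl S q) ≠ 0 →
      u (latticeIncl S a) = u (latticeIncl S b)) : a = b := by
  have h1 : q * (a - b) = 0 := by
    apply chi_injective S.subtype S.subtype_injective
    rw [map_zero]
    apply eq_zero_of_forall_pt
    intro u
    rw [map_mul, map_mul, map_sub, map_sub]
    by_cases hu : u (latticeIncl S q) = 0
    · rw [hu, zero_mul]
    · rw [h u hu, sub_self, mul_zero]
  exact sub_eq_zero.1 ((mul_eq_zero.1 h1).resolve_left hq)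

/-- `Ω` is locally a quotient of regular functions times the volume form. -/
theorem IsGorenstein.exists_local_ratio (h : IsGorenstein S U e)
    (hdim : ringKrullDim (AddMonoidAlgebra ℂ S) ≤ N) {Ω : Form (AddMonoidAlgebra ℂ S) N}
    (hΩ : IsRegularForm (nonsingularPart (AddMonoidAlgebra ℂ S)) Ω)
    (hΩ' : IsNowhereVanishing (nonsingularPart (AddMonoidAlgebra ℂ S)) Ω)
    {y : Pt (AddMonoidAlgebra ℂ S)} (hy : IsNonsingular y) :
    ∃ G H : AddMonoidAlgebra ℂ S, y G ≠ 0 ∧ y H ≠ 0 ∧ ∀ y' : Pt (AddMonoidAlgebra ℂ S),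
      IsNonsingular y' → y' H ≠ 0 → Ω y' = (y' G / y' H) • volForm S e b₀ y' := by
  obtain ⟨L⟩ := h.exists_localCoords_of_isNonsingular hdim b₀ hy
  obtain ⟨s, hs, r, g, k, hΩs⟩ := hΩ y hy
  let G₁ : AddMonoidAlgebra ℂ S := ∑ j, g j * (Matrix.of fun a b => L.E a (k j b)).det
  -- G/H is the quotient of the values of the two forms on the frame. The factors χ^s and χ^f are
  -- included so that H ≠ 0 guarantees that frame and presentation apply.
  let H := s * L.volCoeff * chi L.s * chi L.f
  let G := G₁ * chi L.s * chi L.s * chi L.f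
  have hyH : y H ≠ 0 := by
    simp only [H, map_mul]
    exact mul_ne_zero (mul_ne_zero (mul_ne_zero hs (L.volCoeff_ne_zero L.ne_zero))
      (L.s_ne_zero y L.ne_zero)) L.ne_zero
  have key : ∀ y' : Pt (AddMonoidAlgebra ℂ S),
      IsNonsingular y' → y' H ≠ 0 → Ω y' = (y' G / y' H) • volForm S e b₀ y' := by
    intro y' hy' hH
    simp only [H, map_mul] at hH
    have hf := right_ne_zero_of_mul hH
    have hs' := right_ne_zero_of_mul (left_ne_zero_of_mul hH)
    have hV := right_ne_zero_of_mul (left_ne_zero_of_mul (left_ne_zero_of_mul hH))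
    have hs₁ := left_ne_zero_of_mul (left_ne_zero_of_mul (left_ne_zero_of_mul hH))
    have h1 : Ω y' (L.basis hf) = y' G₁ / y' s := by
      rw [hΩs y' hy' hs₁, alternatingMap_sum_apply]
      simp only [AlternatingMap.smul_apply, dWedge_apply, L.basis_apply, G₁, map_sum, map_mul,
        AlgHom.map_det, Derivation.toTangent_apply, Finset.sum_div, smul_eq_mul]
      refine Finset.sum_congr rfl fun j _ => ?_
      rw [div_mul_eq_mul_div]
      rfl
    rw [(Ω y').eq_smul_basis_det (L.basis hf), (volForm S e b₀ y').eq_smul_basis_det (L.basis hf),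
      h1, L.volForm_frame h hf, smul_smul]
    congr 1
    simp only [G, H, map_mul]
    field_simp
  refine ⟨G, H, fun h0 => ?_, hyH, key⟩
  apply hΩ' y hy
  rw [key y hy hyH, h0, zero_div, zero_smul]

/-- The volume form is unique up to constants if `S` contains no line. -/
theorem IsGorenstein.eq_smul_volForm (h : IsGorenstein S U e)
    (hdim : ringKrullDim (AddMonoidAlgebra ℂ S) ≤ N)
    (hsharp : ∀ m, m ∈ S → -m ∈ S → m = 0) {Ω : Form (AddMonoidAlgebra ℂ S) N}
    (hΩ : IsRegularForm (nonsingularPart (AddMonoidAlgebra ℂ S)) Ω)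
    (hΩ' : IsNowhereVanishing (nonsingularPart (AddMonoidAlgebra ℂ S)) Ω) :
    ∃ C : ℂ, C ≠ 0 ∧ ∀ y, IsNonsingular y → Ω y = C • volForm S e b₀ y := by
  obtain ⟨U', h', hirr⟩ := h.exists_isIrredundant
  have hex := fun y : {y : Pt (AddMonoidAlgebra ℂ S) // IsNonsingular y} =>
    h.exists_local_ratio (b₀ := b₀) hdim hΩ hΩ' y.2
  choose G H hG hH hGH using hex
  have hH0 : ∀ y, H y ≠ 0 := fun y h0 => hH y (by rw [h0, map_zero])
  let pt : Pt (AddMonoidAlgebra ℂ M) → {y : Pt (AddMonoidAlgebra ℂ S) // IsNonsingular y} :=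
    fun u => ⟨u.comp (latticeIncl S), h.isNonsingular_torus u⟩
  -- The local ratios agree on the torus because the volume form has no zeros there.
  have hcross : ∀ y₁ y₂, G y₁ * H y₂ = G y₂ * H y₁ := by
    intro y₁ y₂
    refine eq_of_forall_torus (mul_ne_zero (hH0 y₁) (hH0 y₂)) fun u hu => ?_
    rw [map_mul, map_mul] at hu
    have hu1 := left_ne_zero_of_mul hu
    have hu2 := right_ne_zero_of_mul hu
    have h1 := hGH y₁ (pt u) (pt u).2 hu1
    rw [hGH y₂ (pt u) (pt u).2 hu2] at h1
    have h2 := smul_left_injective ℂ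
      (h.isNowhereVanishing_volForm (b₀ := b₀) hdim (pt u) (pt u).2) h1
    simp only [pt, AlgHom.comp_apply] at h2
    rw [div_eq_div_iff hu2 hu1] at h2
    simp only [map_mul]
    exact h2.symm
  let u₀ : Pt (AddMonoidAlgebra ℂ M) := AddMonoidAlgebra.lift ℂ ℂ M 1
  let G₀ := G (pt u₀)
  let H₀ := H (pt u₀)
  -- The ideal of denominators of the ratio on the torus. For each torus point u it contains a
  -- function not vanishing at u, so it is the unit ideal and the ratio is a Laurent polynomial.
  let I : Ideal (AddMonoidAlgebra ℂ M) :=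
    { carrier := {a | latticeIncl S H₀ ∣ a * latticeIncl S G₀}
      add_mem' := fun ha hb => by
        simp only [Set.mem_ofPred_eq, add_mul]; exact dvd_add ha hb
      zero_mem' := by simp
      smul_mem' := fun c a ha => by
        simp only [Set.mem_ofPred_eq, smul_eq_mul, mul_assoc]; exact dvd_mul_of_dvd_right ha c }
  have hI : I = ⊤ := by
    by_contra hne
    obtain ⟨m, hm, hIm⟩ := Ideal.exists_le_maximal I hne
    obtain ⟨u, rfl⟩ := exists_pt_of_isMaximal m
    refine hH (pt u) (hIm (show latticeIncl S (H (pt u)) ∈ I from ?_))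
    refine ⟨latticeIncl S (G (pt u)), ?_⟩
    rw [← map_mul, ← map_mul, mul_comm, hcross, mul_comm]
  obtain ⟨a, ha⟩ : latticeIncl S H₀ ∣ latticeIncl S G₀ := by
    have : (1 : AddMonoidAlgebra ℂ M) ∈ I := hI ▸ Submodule.mem_top
    simpa [I] using this
  have hι := chi_injective S.subtype S.subtype_injective
  have hιH : ∀ y, latticeIncl S (H y) ≠ 0 := fun y h0 => hH0 y (hι (by rw [h0, map_zero]))
  have hGa : ∀ y, latticeIncl S (G y) = a * latticeIncl S (H y) := by
    intro y
    apply mul_right_cancel₀ (hιH (pt u₀))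
    have := congrArg (latticeIncl S) (hcross y (pt u₀))
    rw [map_mul, map_mul, show latticeIncl S (G (pt u₀)) = _ from ha] at this
    rw [this]
    ring
  have haunit : IsUnit a := by
    refine isUnit_of_forall_pt fun u hu => hG (pt u) ?_
    change u (latticeIncl S (G (pt u))) = 0
    rw [hGa, map_mul, hu, zero_mul]
  obtain ⟨c, m₀, rfl⟩ := exists_eq_smul_chi_of_isUnit haunit
  have hc : c ≠ 0 := by
    rintro rfl
    rw [zero_smul] at haunit
    exact not_isUnit_zero haunit
  -- At the general point of the divisor of v, numerator and denominator G = cχ^(m₀)H are both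
  -- non-zero, so each has a monomial on which v is 0. Shifting it by ∓m₀ gives a monomial of the
  -- other, on which v is non-negative; this yields both inequalities.
  have hv : ∀ v ∈ U', v m₀ = 0 := by
    intro v hvU
    obtain ⟨y, hy⟩ := h'.exists_rayPoint hvU
    have hy0 : ∀ m : S, y (chi m) ≠ 0 ↔ v m = 0 := fun m => by rw [hy]; simp
    obtain ⟨b, J, f, hchart⟩ := h'.exists_isChart_rayPoint hirr hvU hy0
    let y' : {y : Pt (AddMonoidAlgebra ℂ S) // IsNonsingular y} := ⟨y, hchart.isNonsingular h'⟩
    apply le_antisymm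
    · obtain ⟨m, hm, hm'⟩ := exists_coeff_ne_zero (hG y')
      have h1 : (latticeIncl S (H y')).coeff ((m : M) - m₀) ≠ 0 := by
        intro h0
        have h2 := coeff_smul_chi_mul c m₀ (latticeIncl S (H y')) (m - m₀)
        rw [← hGa, add_sub_cancel, coeff_latticeIncl, h0, mul_zero] at h2
        exact hm' h2
      have h3 := (h'.mem_iff _).1 (mem_of_coeff_latticeIncl h1) v hvU
      rw [map_sub, (hy0 m).1 hm] at h3
      omega
    · obtain ⟨m, hm, hm'⟩ := exists_coeff_ne_zero (hH y')
      have h1 : (latticeIncl S (G y')).coeff (m₀ + (m : M)) ≠ 0 := by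
        rw [hGa, coeff_smul_chi_mul, coeff_latticeIncl]
        exact mul_ne_zero hc hm'
      have h3 := (h'.mem_iff _).1 (mem_of_coeff_latticeIncl h1) v hvU
      rw [map_add, (hy0 m).1 hm] at h3
      omega
  have hm₀ : m₀ = 0 := hsharp m₀ ((h'.mem_iff _).2 fun v hvU => (hv v hvU).ge)
    ((h'.mem_iff _).2 fun v hvU => by rw [map_neg, hv v hvU, neg_zero])
  refine ⟨c, hc, fun y hy => ?_⟩
  have h1 := hGa ⟨y, hy⟩
  rw [hm₀, chi_zero, smul_mul_assoc, one_mul, ← map_smul] at h1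
  rw [hGH ⟨y, hy⟩ y hy (hH ⟨y, hy⟩), hι h1, map_smul, smul_eq_mul,
    mul_div_cancel_right₀ _ (hH ⟨y, hy⟩)]

end Uniqueness
end


noncomputable section

/-! ## The cone of a Minkowski decomposition -/

section MinkowskiCone

variable {d p : ℕ}

/-- The functional on `M'` given by the lattice point `(v, e_k)`. -/
def vertexFunctional (v : Fin d → ℤ) (k : Fin (p + 1)) : CharLattice d p →+ ℤ :=
  AddMonoidHom.mk' (fun m => ∑ i, m.1 i * v i + m.2 k) fun a b => by
    simp only [Prod.fst_add, Prod.snd_add, Pi.add_apply, add_mul, Finset.sum_add_distrib]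
    ring

theorem vertexFunctional_apply (v : Fin d → ℤ) (k : Fin (p + 1)) (m : CharLattice d p) :
    vertexFunctional v k m = ∑ i, m.1 i * v i + m.2 k := rfl

theorem pairing_single (m : CharLattice d p) (r : Fin d → ℝ) (k : Fin (p + 1)) :
    pairing m (r, Pi.single k 1) = ∑ i, (m.1 i : ℝ) * r i + m.2 k := by
  simp [pairing, Pi.single_apply]

variable {R : Fin (p + 1) → Set (Fin d → ℝ)}

theorem mem_dualMonoid_iff_forall (m : CharLattice d p) :
    m ∈ dualMonoid R ↔ ∀ k, ∀ r ∈ R k, 0 ≤ ∑ i, (m.1 i : ℝ) * r i + m.2 k := by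
  constructor
  · intro h k r hr
    rw [← pairing_single]
    exact h _ (Submodule.subset_span (Set.mem_iUnion.2 ⟨k, hr, rfl⟩))
  · intro h u hu
    refine Submodule.span_induction (p := fun u _ => 0 ≤ pairing m u) ?_ ?_ ?_ ?_ hu
    · rintro ⟨r, w⟩ hv
      obtain ⟨k, hr, hw⟩ := Set.mem_iUnion.1 hv
      obtain rfl : w = Pi.single k 1 := hw
      rw [pairing_single]
      exact h k r hr
    · simp [pairing]
    · intro v w _ _ hv hw
      have : pairing m (v + w) = pairing m v + pairing m w := by
        simp only [pairing, Prod.fst_add, Prod.snd_add, Pi.add_apply, mul_add,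
          Finset.sum_add_distrib]
        ring
      rw [this]
      exact add_nonneg hv hw
    · intro c v _ hv
      have : pairing m (c • v) = c * pairing m v := by
        simp only [pairing, mul_add, Finset.mul_sum]
        congr 1 <;> refine Finset.sum_congr rfl fun i _ => ?_
        · change _ * ((c : ℝ) * v.1 i) = _
          ring
        · change _ * ((c : ℝ) * v.2 i) = _
          ring
      rw [this]
      exact mul_nonneg c.2 hv

/-- `R k` is the convex hull of the non-empty set `V k` of lattice points. -/
abbrev AreVertices (R : Fin (p + 1) → Set (Fin d → ℝ)) (V : Fin (p + 1) → Finset (Fin d → ℤ)) :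
    Prop :=
  ∀ k, (V k).Nonempty ∧ R k =
    convexHull ℝ ((fun (v : Fin d → ℤ) (i : Fin d) => (v i : ℝ)) '' (V k : Set (Fin d → ℤ)))

variable {V : Fin (p + 1) → Finset (Fin d → ℤ)}

theorem mem_dualMonoid_iff (hV : AreVertices R V) (m : CharLattice d p) :
    m ∈ dualMonoid R ↔ ∀ k, ∀ v ∈ V k, 0 ≤ vertexFunctional v k m := by
  rw [mem_dualMonoid_iff_forall]
  refine forall_congr' fun k => ⟨fun h v hv => ?_, fun h r hr => ?_⟩
  · have := h (fun i => (v i : ℝ)) (by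
      rw [(hV k).2]; exact subset_convexHull ℝ _ ⟨v, hv, rfl⟩)
    rw [vertexFunctional_apply]
    exact_mod_cast this
  · rw [(hV k).2] at hr
    let l : (Fin d → ℝ) →ₗ[ℝ] ℝ := ∑ i, (m.1 i : ℝ) • LinearMap.proj i
    have hl : ∀ r, l r = ∑ i, (m.1 i : ℝ) * r i := fun r => by simp [l]
    have hconv : Convex ℝ {r : Fin d → ℝ | -(m.2 k : ℝ) ≤ l r} :=
      convex_halfSpace_ge l.isLinear _
    have hsub := convexHull_min (s := (fun (v : Fin d → ℤ) (i : Fin d) => (v i : ℝ)) ''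
        (V k : Set (Fin d → ℤ))) (by
      rintro _ ⟨v, hv, rfl⟩
      have := h v hv
      rw [vertexFunctional_apply] at this
      have h2 : (0 : ℝ) ≤ ∑ i, (m.1 i : ℝ) * v i + m.2 k := by exact_mod_cast this
      rw [Set.mem_ofPred_eq, hl]
      linarith) hconv
    have := hsub hr
    rw [Set.mem_ofPred_eq, hl] at this
    linarith

/-- The character `(0, 1)`, the sum of the `e_k^*`. -/
abbrev totalChar (d p : ℕ) : CharLattice d p := (0, 1)

open Classical in
/-- The functionals given by the vertices. -/
def vertexFunctionals (V : Fin (p + 1) → Finset (Fin d → ℤ)) : Finset (CharLattice d p →+ ℤ) :=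
  Finset.univ.biUnion fun k => (V k).image fun v => vertexFunctional v k

/-- All generators (v, e_k) of the cone have height one with respect to (0, 1). -/
theorem isGorenstein_dualMonoid (hV : AreVertices R V) :
    IsGorenstein (dualMonoid R) (vertexFunctionals V) (totalChar d p) where
  mem_iff m := by
    rw [mem_dualMonoid_iff hV]
    simp only [vertexFunctionals, Finset.mem_biUnion, Finset.mem_univ, true_and, Finset.mem_image]
    constructor
    · rintro h _ ⟨k, v, hv, rfl⟩
      exact h k v hv
    · exact fun h k v hv => h _ ⟨k, v, hv, rfl⟩
  apply_eq_one u hu := by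
    simp only [vertexFunctionals, Finset.mem_biUnion, Finset.mem_univ, true_and,
      Finset.mem_image] at hu
    obtain ⟨k, v, -, rfl⟩ := hu
    simp [vertexFunctional_apply]

/-- A linear functional which is constant on a set with non-empty interior vanishes. -/
theorem eq_zero_of_forall_sum_eq {P : Set (Fin d → ℝ)} (hP : (interior P).Nonempty)
    (m : Fin d → ℝ) (c : ℝ) (h : ∀ r ∈ P, ∑ i, m i * r i = c) : m = 0 := by
  obtain ⟨r, hr⟩ := hP
  obtain ⟨ε, hε, hball⟩ := Metric.isOpen_iff.1 isOpen_interior r hr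
  ext j
  have h1 : r + Pi.single j (ε / 2) ∈ P := interior_subset (hball (by
    rw [Metric.mem_ball, dist_eq_norm, add_sub_cancel_left, Pi.norm_single,
      Real.norm_of_nonneg (by positivity)]
    linarith))
  have h2 := h _ h1
  rw [← h r (interior_subset hr)] at h2
  simp only [Pi.add_apply, mul_add, Finset.sum_add_distrib] at h2
  have h3 : m j * (ε / 2) = 0 := by
    simpa [Pi.single_apply] using h2
  exact (mul_eq_zero.1 h3).resolve_right (by positivity)

/-- The L-part of m is constant on each R_k, hence on their Minkowski sum, which has interior
points; so it vanishes, and then so do the remaining coordinates. This is where the full dimension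
of P enters. -/
theorem eq_zero_of_neg_mem_dualMonoid (hV : AreVertices R V)
    (hdim : (interior (∑ k, R k)).Nonempty) (m : CharLattice d p) (hm : m ∈ dualMonoid R)
    (hm' : -m ∈ dualMonoid R) : m = 0 := by
  rw [mem_dualMonoid_iff_forall] at hm hm'
  have h0 : ∀ k, ∀ r ∈ R k, ∑ i, (m.1 i : ℝ) * r i = -m.2 k := by
    intro k r hr
    have h1 := hm k r hr
    have h2 := hm' k r hr
    simp only [Prod.fst_neg, Prod.snd_neg, Pi.neg_apply, Int.cast_neg, neg_mul,
      Finset.sum_neg_distrib] at h2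
    linarith
  have h1 : (fun i => (m.1 i : ℝ)) = 0 := by
    refine eq_zero_of_forall_sum_eq hdim _ (∑ k, -(m.2 k : ℝ)) fun r hr => ?_
    obtain ⟨g, hg, rfl⟩ := (Set.mem_fintype_sum _ _).1 hr
    simp only [Finset.sum_apply, Finset.mul_sum]
    rw [Finset.sum_comm]
    exact Finset.sum_congr rfl fun k _ => h0 k _ (hg k)
  have h2 : m.1 = 0 := funext fun i => by
    have h2 : (m.1 i : ℝ) = 0 := congrFun h1 i
    exact_mod_cast h2
  refine Prod.ext h2 (funext fun k => ?_)
  obtain ⟨v, hv⟩ := (hV k).1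
  have h3 := h0 k (fun i => (v i : ℝ)) (by
    rw [(hV k).2]; exact subset_convexHull ℝ _ ⟨v, hv, rfl⟩)
  simp only [h2, Pi.zero_apply, Int.cast_zero, zero_mul, Finset.sum_const_zero] at h3
  exact_mod_cast (neg_eq_zero.1 h3.symm)

/-- The characters `z_i` and `t_k` form a basis of `M'`. -/
def charBasis (p : ℕ) (z : Module.Basis (Fin d) ℤ (Fin d → ℤ)) :
    Module.Basis (Fin d ⊕ Fin (p + 1)) ℤ (CharLattice d p) :=
  z.prod (Pi.basisFun ℤ (Fin (p + 1)))

@[simp] theorem charBasis_inl (z : Module.Basis (Fin d) ℤ (Fin d → ℤ)) (i : Fin d) :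
    charBasis p z (Sum.inl i) = (z i, 0) := by
  simp [charBasis]

@[simp] theorem charBasis_inr (z : Module.Basis (Fin d) ℤ (Fin d → ℤ)) (k : Fin (p + 1)) :
    charBasis p z (Sum.inr k) = (0, Pi.single k 1) := by
  simp [charBasis]

/-- The basis of `M'` in the order of `torusForm`. -/
def orderedCharBasis (p : ℕ) (z : Module.Basis (Fin d) ℤ (Fin d → ℤ)) :
    Module.Basis (Fin (p + (d + 1))) ℤ (CharLattice d p) :=
  (charBasis p z).reindex (finSumFinEquiv.trans (finCongr (by omega)))

theorem orderedCharBasis_apply (z : Module.Basis (Fin d) ℤ (Fin d → ℤ)) (a : Fin (p + (d + 1))) :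
    chi (orderedCharBasis p z a) =
      Fin.append (fun i => zFun p (z i)) (fun k : Fin (p + 1) => tChar d k)
        (Fin.cast (by omega) a) := by
  obtain ⟨b, rfl⟩ := (finSumFinEquiv.trans (finCongr (by omega :
    d + (p + 1) = p + (d + 1)))).surjective a
  rw [orderedCharBasis, Module.Basis.reindex_apply, Equiv.symm_apply_apply]
  rcases b with i | k
  · simp [chi, zFun]
  · simp [chi, tChar]

/-- χ^e = ∏ t_k cancels the denominators t_k of the logarithmic form and leaves those of the z_i. -/
theorem pullback_volForm_eq_torusForm (hV : AreVertices R V)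
    (z : Module.Basis (Fin d) ℤ (Fin d → ℤ)) (u : Pt (TorusRing d p)) :
    Form.pullback (torusIncl R)
      (volForm (dualMonoid R) (totalChar d p) (orderedCharBasis p z)) u = torusForm p z u := by
  have h := (isGorenstein_dualMonoid hV).pullback_volForm (orderedCharBasis p z) u
  refine h.trans ?_
  rw [torusForm]
  have h1 : ∏ j, u (chi (orderedCharBasis p z j)) =
      (∏ i, u (zFun p (z i))) * u (chi (totalChar d p)) := by
    have h2 : chi (totalChar d p) = ∏ k : Fin (p + 1), chi ((0, Pi.single k 1) : CharLattice d p) := by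
      rw [← chi_sum]
      congr 1
      refine Prod.ext ?_ ?_
      · simp [Prod.fst_sum]
      · rw [Prod.snd_sum]
        exact (Finset.univ_sum_single (1 : Fin (p + 1) → ℤ)).symm
    rw [← (finSumFinEquiv.trans (finCongr (by omega :
      d + (p + 1) = p + (d + 1)))).prod_comp, Fintype.prod_sum_type, h2, map_prod]
    congr 1 <;> refine Finset.prod_congr rfl fun i _ => ?_ <;>
      rw [orderedCharBasis, Module.Basis.reindex_apply, Equiv.symm_apply_apply] <;>
      simp [chi, zFun]
  rw [h1]
  have h3 := pt_chi_ne_zero u (totalChar d p)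
  have h4 : ∏ i, u (zFun p (z i)) ≠ 0 :=
    Finset.prod_ne_zero_iff.2 fun i _ => pt_chi_ne_zero u (z i, 0)
  congr 1
  · field_simp
  · congr 1
    funext a
    exact orderedCharBasis_apply z a

end MinkowskiCone
end


noncomputable section

/-! ## Dimension bounds -/

section Dimension

variable {d p : ℕ} {R : Fin (p + 1) → Set (Fin d → ℝ)} {V : Fin (p + 1) → Finset (Fin d → ℤ)}
  {B : Type} [CommRing B] [IsDomain B] [Algebra ℂ B]

/-- The element `e_k^*` of the dual monoid. -/
def tElem (R : Fin (p + 1) → Set (Fin d → ℝ)) (k : Fin (p + 1)) : dualMonoid R :=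
  ⟨(0, Pi.single k 1), dualBasis_mem R k⟩

theorem chi_tElem (k : Fin (p + 1)) : chi (tElem R k) = tFun R k := rfl

theorem vertexFunctional_tElem (v : Fin d → ℤ) (j k : Fin (p + 1)) :
    vertexFunctional v j (tElem R k) = if j = k then 1 else 0 := by
  simp [vertexFunctional_apply, tElem, Pi.single_apply]

/-- If `t_k` vanishes on an irreducible subvariety, some vertex `(v, e_k)` vanishes on the
corresponding face. -/
theorem exists_vertexFunctional_eq_zero (hV : AreVertices R V) (φ : CoordRing R →ₐ[ℂ] B)
    {k : Fin (p + 1)} (hk : φ (tFun R k) = 0) :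
    ∃ v ∈ V k, ∀ m : dualMonoid R, φ (chi m) ≠ 0 → vertexFunctional v k m = 0 := by
  by_contra! hne
  have hnonneg : ∀ (m : dualMonoid R) k, ∀ v ∈ V k, 0 ≤ vertexFunctional v k m :=
    fun m => (mem_dualMonoid_iff hV m).1 m.2
  choose! g hg hg' using hne
  -- If every vertex of R_k had a witness, their sum would be positive on all (v, e_k). Then t_k
  -- divides χ^f, whose image is non-zero in the domain `B`, a contradiction.
  let f : dualMonoid R := ∑ v ∈ V k, g v
  have hf : φ (chi f) ≠ 0 := by
    rw [chi_sum, map_prod]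
    exact Finset.prod_ne_zero_iff.2 hg
  have hmem : (f : CharLattice d p) - tElem R k ∈ dualMonoid R := by
    rw [mem_dualMonoid_iff hV]
    intro j v hv
    rw [map_sub, vertexFunctional_tElem]
    have h0 := hnonneg f j v hv
    split_ifs with hjk
    · subst hjk
      have h1 : vertexFunctional v j f = ∑ w ∈ V j, vertexFunctional v j (g w) := by
        rw [← map_sum]; congr 1; simp [f]
      have h2 : vertexFunctional v j (g v) ≤ vertexFunctional v j f := by
        rw [h1]
        exact Finset.single_le_sum (f := fun w => vertexFunctional v j (g w))
          (fun w _ => hnonneg (g w) j v hv) hv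
      have h3 := hnonneg (g v) j v hv
      have h4 := hg' v hv
      omega
    · omega
  have hsplit : f = ⟨_, hmem⟩ + tElem R k := by
    apply Subtype.ext
    simp
  rw [hsplit, chi_add, map_mul, chi_tElem, hk, mul_zero] at hf
  exact hf rfl

/-- The characters with non-zero image have L-parts of rank at most d. Given a maximal independent
set `I` of these, a power of any such character is a Laurent monomial in `I` and the t_k, so `B` is
algebraic over the subalgebra generated by n + |I| elements. This applies on every irreducible
closed subset, in particular inside fibres. -/
theorem trdeg_le_of_coordRing_surjective (hV : AreVertices R V) (φ : CoordRing R →ₐ[ℂ] B)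
    (hφ : Function.Surjective φ) {n : ℕ} (τ : Fin n → B)
    (hτ : ∀ k, φ (tFun R k) ∈ Algebra.adjoin ℂ (Set.range τ)) :
    Algebra.trdeg ℂ B ≤ (n + d : ℕ) := by
  classical
  let F := {m : dualMonoid R // φ (chi m) ≠ 0}
  let w : F → (Fin d → ℤ) := fun m => m.1.1.1
  obtain ⟨I, hI, hmax⟩ := exists_maximal_linearIndepOn ℤ w
  have hIfin : Finite I := LinearIndependent.finite hI
  have : Fintype I := Fintype.ofFinite I
  have hIcard : Fintype.card I ≤ d := by
    have := LinearIndependent.fintype_card_le_finrank hI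
    rwa [Module.finrank_fin_fun] at this
  let T : Fin n ⊕ I → B := Sum.elim τ fun m => φ (chi m.1.1)
  let R₀ := Algebra.adjoin ℂ (Set.range T)
  have ht : ∀ k, φ (tFun R k) ∈ R₀ := fun k =>
    Algebra.adjoin_mono (by rintro _ ⟨i, rfl⟩; exact ⟨Sum.inl i, rfl⟩) (hτ k)
  have hg : ∀ m : I, φ (chi m.1.1) ∈ R₀ := fun m =>
    Algebra.subset_adjoin ⟨Sum.inr m, rfl⟩
  have hchi : ∀ m, IsAlgebraic R₀ (φ (chi m)) := by
    intro m
    by_cases hm : φ (chi m) = 0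
    · rw [hm]; exact isAlgebraic_zero
    obtain ⟨a, ha, hspan⟩ : ∃ a : ℤ, a ≠ 0 ∧ a • w ⟨m, hm⟩ ∈ Submodule.span ℤ (w '' I) := by
      by_cases hmI : (⟨m, hm⟩ : F) ∈ I
      · exact ⟨1, one_ne_zero, by rw [one_smul]; exact Submodule.subset_span ⟨_, hmI, rfl⟩⟩
      · exact hmax _ hmI
    have hspan' : (a.natAbs : ℤ) • w ⟨m, hm⟩ ∈ Submodule.span ℤ (w '' I) := by
      rw [← Int.sign_mul_self_eq_natAbs, mul_smul]
      exact Submodule.smul_mem _ _ hspan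
    rw [Set.image_eq_range, Submodule.mem_span_range_iff_exists_fun] at hspan'
    obtain ⟨c, hc⟩ := hspan'
    have hn : 0 < a.natAbs := Int.natAbs_pos.2 ha
    generalize a.natAbs = q at hc hn
    let b : Fin (p + 1) → ℤ := q • m.1.2 - ∑ i, c i • i.1.1.1.2
    have hrel : q • (m : CharLattice d p) =
        ∑ i, c i • (i.1.1 : CharLattice d p) + ∑ k, b k • (tElem R k : CharLattice d p) := by
      have h2 : ∑ k, b k • (tElem R k : CharLattice d p) = (0, b) := by
        refine Prod.ext ?_ ?_
        · simp [Prod.fst_sum, tElem]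
        · rw [Prod.snd_sum]
          refine Eq.trans (Finset.sum_congr rfl fun k _ => ?_) (Finset.univ_sum_single b)
          simp only [tElem, Prod.smul_mk]
          rw [← Pi.single_smul, smul_eq_mul, mul_one]
      rw [h2]
      refine Prod.ext ?_ ?_
      · rw [Prod.fst_add, Prod.fst_sum, add_zero, Prod.smul_fst, ← natCast_zsmul]
        exact hc.symm
      · rw [Prod.snd_add, Prod.snd_sum, Prod.smul_snd]
        simp only [b, Prod.smul_snd]
        abel
    -- A t_k with image zero may not occur in a denominator. A vertex functional vanishing on the
    -- whole face, but equal to 1 on e_k^*, shows that its exponent is 0.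
    have hb : ∀ k, φ (tFun R k) = 0 → b k = 0 := by
      intro k hk
      obtain ⟨v, -, hv⟩ := exists_vertexFunctional_eq_zero hV φ hk
      have h2 := congrArg (vertexFunctional v k) hrel
      rw [map_nsmul, hv m hm, smul_zero, map_add, map_sum, map_sum, Finset.sum_eq_zero, zero_add] at h2
      · simp only [map_zsmul, vertexFunctional_tElem] at h2
        simpa using h2.symm
      · intro i _
        rw [map_zsmul, hv i.1.1 i.1.2, smul_zero]
    have hrel' : q • m + (∑ i, (-c i).toNat • i.1.1 + ∑ k, (-b k).toNat • tElem R k) =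
        ∑ i, (c i).toNat • i.1.1 + ∑ k, (b k).toNat • tElem R k := by
      apply Subtype.ext
      have h3 := sum_posPart_smul c fun i : I => (i.1.1 : CharLattice d p)
      have h4 := sum_posPart_smul b fun k => (tElem R k : CharLattice d p)
      simp only [AddSubmonoid.coe_add, AddSubmonoidClass.coe_nsmul, AddSubmonoid.coe_finsetSum]
      rw [h3, h4, hrel]
      abel
    have h5 := congrArg (fun x => φ (chi x)) hrel'
    simp only [chi_add, chi_sum, chi_nsmul, map_mul, map_prod, map_pow, chi_tElem] at h5
    set r₂ := (∏ i : I, φ (chi i.1.1) ^ (-c i).toNat) * ∏ k, φ (tFun R k) ^ (-b k).toNat with hr₂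
    set r₁ := (∏ i : I, φ (chi i.1.1) ^ (c i).toNat) * ∏ k, φ (tFun R k) ^ (b k).toNat with hr₁
    have h₂ : r₂ ∈ R₀ := mul_mem (prod_mem fun i _ => pow_mem (hg i) _)
      (prod_mem fun k _ => pow_mem (ht k) _)
    have h₁ : r₁ ∈ R₀ := mul_mem (prod_mem fun i _ => pow_mem (hg i) _)
      (prod_mem fun k _ => pow_mem (ht k) _)
    have h₂0 : r₂ ≠ 0 := by
      refine mul_ne_zero (Finset.prod_ne_zero_iff.2 fun i _ => pow_ne_zero _ i.1.2)
        (Finset.prod_ne_zero_iff.2 fun k _ => ?_)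
      by_cases hk : φ (tFun R k) = 0
      · rw [hb k hk]; simp
      · exact pow_ne_zero _ hk
    -- The relation r₂ X^q = r₁, non-trivial because r₂ ≠ 0 and q > 0.
    refine ⟨Polynomial.C ⟨r₂, h₂⟩ * Polynomial.X ^ q - Polynomial.C ⟨r₁, h₁⟩, fun h0 => ?_, ?_⟩
    · have h6 := congrArg (fun P => P.coeff q) h0
      simp only [Polynomial.coeff_sub, Polynomial.coeff_C_mul, Polynomial.coeff_X_pow, if_true,
        mul_one, Polynomial.coeff_C, if_neg hn.ne', sub_zero, Polynomial.coeff_zero] at h6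
      exact h₂0 (congrArg Subtype.val h6)
    · rw [map_sub, map_mul, map_pow, Polynomial.aeval_X, Polynomial.aeval_C, Polynomial.aeval_C]
      change r₂ * _ - r₁ = 0
      rw [← h5]
      ring
  have halg : Algebra.IsAlgebraic R₀ B := by
    refine ⟨fun x => ?_⟩
    obtain ⟨a, rfl⟩ := hφ x
    induction a using chi_induction with
    | hchi m => exact hchi m
    | hadd a b ha hb => rw [map_add]; exact ha.add hb
    | hsmul c a ha =>
      rw [map_smul, Algebra.smul_def, IsScalarTower.algebraMap_apply ℂ R₀ B]
      exact (isAlgebraic_algebraMap _).mul ha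
  calc Algebra.trdeg ℂ B ≤ Cardinal.mk (Set.range T) :=
        Algebra.IsAlgebraic.trdeg_le_cardinalMk ℂ (Set.range T)
    _ ≤ Cardinal.mk (Fin n ⊕ I) := Cardinal.mk_range_le
    _ ≤ (n + d : ℕ) := by
      rw [Cardinal.mk_fintype, Fintype.card_sum, Fintype.card_fin]
      exact_mod_cast Nat.add_le_add_left hIcard n

theorem ringKrullDim_coordRing_le (hV : AreVertices R V) :
    ringKrullDim (CoordRing R) ≤ (p + (d + 1) : ℕ) := by
  refine ringKrullDim_le_of_forall_trdeg_le ℂ _ fun Q hQ => ?_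
  have := trdeg_le_of_coordRing_surjective hV (Ideal.Quotient.mkₐ ℂ Q) (Ideal.Quotient.mkₐ_surjective ℂ Q)
    (fun k => Ideal.Quotient.mkₐ ℂ Q (tFun R k)) fun k => Algebra.subset_adjoin ⟨k, rfl⟩
  rwa [show p + 1 + d = p + (d + 1) by omega] at this

theorem fibreIncl_tFun (x : Fin (p + 1) → ℂ) (k : Fin (p + 1)) :
    fibreIncl R x (tFun R k) =
      fibreIncl R x (tFun R 0) - algebraMap ℂ _ (x 0 - x k) := by
  refine Fin.cases (by simp) (fun j => ?_) k
  have h : fibreIncl R x (tFun R 0 - tFun R j.succ -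
      algebraMap ℂ (CoordRing R) (x 0 - x j.succ)) = 0 :=
    Ideal.Quotient.eq_zero_iff_mem.2 (Ideal.subset_span ⟨j, rfl⟩)
  rw [map_sub, map_sub, AlgHom.commutes] at h
  linear_combination -h

/-- On the fibre every t_k differs from t_0 by a constant, so the t_k contribute one parameter
instead of p + 1. -/
theorem ringKrullDim_fibreRing_le (hV : AreVertices R V) (x : Fin (p + 1) → ℂ) :
    ringKrullDim (FibreRing R x) ≤ (d + 1 : ℕ) := by
  refine ringKrullDim_le_of_forall_trdeg_le ℂ _ fun Q hQ => ?_
  let φ : CoordRing R →ₐ[ℂ] FibreRing R x ⧸ Q := (Ideal.Quotient.mkₐ ℂ Q).comp (fibreIncl R x)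
  have hφ : Function.Surjective φ :=
    (Ideal.Quotient.mkₐ_surjective ℂ Q).comp (Ideal.Quotient.mkₐ_surjective ℂ _)
  have hτ : ∀ k, φ (tFun R k) ∈
      Algebra.adjoin ℂ (Set.range fun _ : Fin 1 => φ (tFun R 0)) := fun k => by
    have h : φ (tFun R k) = φ (tFun R 0) - algebraMap ℂ _ (x 0 - x k) := by
      simp only [φ, AlgHom.comp_apply, fibreIncl_tFun x k, map_sub, AlgHom.commutes]
    rw [h]
    exact sub_mem (Algebra.subset_adjoin ⟨0, rfl⟩) (Subalgebra.algebraMap_mem _ _)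
  have := trdeg_le_of_coordRing_surjective hV φ hφ _ hτ
  rwa [add_comm 1 d] at this

end Dimension
end


noncomputable section

/-! ## Fibres of functions on an affine variety -/

section Fibre

/-- `φ` presents the fibre `τ = c`. -/
structure IsFibre {A B : Type*} [CommRing A] [Algebra ℂ A] [CommRing B] [Algebra ℂ B]
    (φ : A →ₐ[ℂ] B) {p : ℕ} (τ : Fin p → A) (c : Fin p → ℂ) : Prop where
  surjective : Function.Surjective φ
  ker_eq : RingHom.ker φ = Ideal.span (Set.range fun j => τ j - algebraMap ℂ A (c j))

/-- The differential of `(τ_1, …, τ_p)`. -/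
def tauDiff {A : Type*} [CommRing A] [Algebra ℂ A] {p : ℕ} (τ : Fin p → A) (y : Pt A) :
    tangentSpace y →ₗ[ℂ] (Fin p → ℂ) :=
  LinearMap.pi fun j => LinearMap.applyₗ (τ j) ∘ₗ (tangentSpace y).subtype

theorem tauDiff_apply {A : Type*} [CommRing A] [Algebra ℂ A] {p : ℕ} (τ : Fin p → A) (y : Pt A)
    (D : tangentSpace y) (j : Fin p) : tauDiff τ y D j = (D : A →ₗ[ℂ] ℂ) (τ j) := rfl

variable {A B : Type*} [CommRing A] [Algebra ℂ A] [CommRing B] [Algebra ℂ B] {φ : A →ₐ[ℂ] B}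
  {p n : ℕ} {τ : Fin p → A} {c : Fin p → ℂ}

theorem pushTangent_injective (hφ : Function.Surjective φ) (y : Pt B) :
    Function.Injective (pushTangent φ y) := by
  intro D D' h
  apply Subtype.ext
  refine LinearMap.ext fun b => ?_
  obtain ⟨a, rfl⟩ := hφ b
  rw [← pushTangent_apply, ← pushTangent_apply, h]

theorem exists_pushTangent_eq (hφ : Function.Surjective φ) (y : Pt B)
    (D : tangentSpace (y.comp φ)) (hD : ∀ a, φ a = 0 → (D : A →ₗ[ℂ] ℂ) a = 0) :
    ∃ D', pushTangent φ y D' = D := by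
  let D' : B →ₗ[ℂ] ℂ := (LinearMap.ker φ.toLinearMap).liftQ (D : A →ₗ[ℂ] ℂ) hD ∘ₗ
    (φ.toLinearMap.quotKerEquivOfSurjective hφ).symm.toLinearMap
  have hD' : ∀ a, D' (φ a) = (D : A →ₗ[ℂ] ℂ) a := fun a => by
    have : (φ.toLinearMap.quotKerEquivOfSurjective hφ).symm (φ a) = Submodule.Quotient.mk a := by
      rw [LinearEquiv.symm_apply_eq]; rfl
    simp only [D', LinearMap.comp_apply, LinearEquiv.coe_coe, this]
    rfl
  refine ⟨⟨D', fun a b => ?_⟩, Subtype.ext (LinearMap.ext hD')⟩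
  obtain ⟨a, rfl⟩ := hφ a
  obtain ⟨b, rfl⟩ := hφ b
  rw [← map_mul, hD', hD', hD', tangentSpace_mul]
  rfl

namespace IsFibre

variable (h : IsFibre φ τ c)

include h

theorem apply_tau (j : Fin p) : φ (τ j) = algebraMap ℂ B (c j) := by
  have h1 : τ j - algebraMap ℂ A (c j) ∈ RingHom.ker φ := by
    rw [h.ker_eq]; exact Ideal.subset_span ⟨j, rfl⟩
  rw [RingHom.mem_ker, map_sub, AlgHom.commutes, sub_eq_zero] at h1
  exact h1

theorem tauDiff_pushTangent (y : Pt B) (D : tangentSpace y) :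
    tauDiff τ (y.comp φ) (pushTangent φ y D) = 0 := by
  ext j
  rw [tauDiff_apply, pushTangent_apply, h.apply_tau, tangentSpace_algebraMap]
  rfl

theorem range_pushTangent (y : Pt B) :
    LinearMap.range (pushTangent φ y) = LinearMap.ker (tauDiff τ (y.comp φ)) := by
  ext D
  constructor
  · rintro ⟨D, rfl⟩
    exact h.tauDiff_pushTangent y D
  · intro hD
    refine exists_pushTangent_eq h.surjective y D fun a ha => ?_
    have ha' : a ∈ Ideal.span (Set.range fun j => τ j - algebraMap ℂ A (c j)) := by
      rw [← h.ker_eq]; exact ha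
    refine Submodule.span_induction (p := fun a _ => (D : A →ₗ[ℂ] ℂ) a = 0)
      ?_ (map_zero _) (fun a b _ _ ha hb => by rw [map_add, ha, hb, add_zero]) ?_ ha'
    · rintro _ ⟨j, rfl⟩
      rw [map_sub, tangentSpace_algebraMap, sub_zero]
      exact congrFun (LinearMap.mem_ker.1 hD) j
    · intro a b hb hb'
      have h0 : φ b = 0 := by
        have : b ∈ RingHom.ker φ := by rw [h.ker_eq]; exact hb
        exact this
      rw [smul_eq_mul, tangentSpace_mul, hb', AlgHom.comp_apply, AlgHom.comp_apply, h0, map_zero]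
      simp

/-- The tangent space of the fibre is the kernel of the differential. -/
def tangentSpaceEquiv (y : Pt B) :
    tangentSpace y ≃ₗ[ℂ] LinearMap.ker (tauDiff τ (y.comp φ)) :=
  (LinearEquiv.ofInjective _ (pushTangent_injective h.surjective y)).trans
    (LinearEquiv.ofEq _ _ (h.range_pushTangent y))

theorem finrank_tangentSpace (y : Pt B) [Module.Finite ℂ (tangentSpace (y.comp φ))] :
    Module.finrank ℂ (LinearMap.range (tauDiff τ (y.comp φ))) +
      Module.finrank ℂ (tangentSpace y) = Module.finrank ℂ (tangentSpace (y.comp φ)) := by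
  rw [LinearEquiv.finrank_eq (h.tangentSpaceEquiv y)]
  exact LinearMap.finrank_range_add_finrank_ker _

theorem finite_tangentSpace (y : Pt B) [Module.Finite ℂ (tangentSpace y)] :
    Module.Finite ℂ (tangentSpace (y.comp φ)) := by
  have h1 : Module.Finite ℂ (LinearMap.ker (tauDiff τ (y.comp φ))) :=
    Module.Finite.equiv (h.tangentSpaceEquiv y)
  have h2 : Module.Finite ℂ (LinearMap.range (tauDiff τ (y.comp φ))) := inferInstance
  have h3 : Module.Finite ℂ (tangentSpace (y.comp φ) ⧸ LinearMap.ker (tauDiff τ (y.comp φ))) :=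
    Module.Finite.equiv (LinearMap.quotKerEquivRange _).symm
  exact Module.Finite.of_submodule_quotient (LinearMap.ker (tauDiff τ (y.comp φ)))

/-- Over a non-singular point of a fibre `τ` is submersive if tangent spaces cannot be smaller
than expected. -/
theorem submersive (hB : ringKrullDim B ≤ n) {y : Pt B} (hy : IsNonsingular y)
    (hA : Module.Finite ℂ (tangentSpace (y.comp φ)) →
      Module.finrank ℂ (tangentSpace (y.comp φ)) ≤ p + n →
      Module.finrank ℂ (tangentSpace (y.comp φ)) = p + n) :
    Module.Finite ℂ (tangentSpace (y.comp φ)) ∧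
      Module.finrank ℂ (tangentSpace (y.comp φ)) = p + n ∧
      Function.Surjective (tauDiff τ (y.comp φ)) ∧
      Module.Finite ℂ (tangentSpace y) ∧ Module.finrank ℂ (tangentSpace y) = n := by
  obtain ⟨h1, h2⟩ := finite_tangentSpace_of_isNonsingular hy
  have h3 : Module.finrank ℂ (tangentSpace y) ≤ n := by
    exact_mod_cast h2.trans ((ringKrullDim_atPrime_le _).trans hB)
  have h4 := h.finite_tangentSpace y
  have h5 := h.finrank_tangentSpace y
  have h6 : Module.finrank ℂ (LinearMap.range (tauDiff τ (y.comp φ))) ≤ p := by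
    have := Submodule.finrank_le (LinearMap.range (tauDiff τ (y.comp φ)))
    rwa [Module.finrank_fin_fun] at this
  -- The kernel of dτ has dimension at most n and its image at most p. Once the total is known to be
  -- p + n, both bounds are equalities.
  have h7 := hA h4 (by omega)
  refine ⟨h4, h7, ?_, h1, by omega⟩
  rw [← LinearMap.range_eq_top]
  apply Submodule.eq_top_of_finrank_eq
  rw [Module.finrank_fin_fun]
  omega

end IsFibre

/-- `W` are lifts of the vectors `∂_{t_1}, …, ∂_{t_p}`, for `τ_j = t_0 - t_j`. -/
def IsTauLift (τ : Fin p → A) (y : Pt A) (W : Fin p → tangentSpace y) : Prop :=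
  ∀ j, tauDiff τ y (W j) = -Pi.single j 1

theorem exists_isTauLift {y : Pt A} (h : Function.Surjective (tauDiff τ y)) :
    ∃ W, IsTauLift τ y W := by
  choose W hW using fun j : Fin p => h (-Pi.single j 1)
  exact ⟨W, hW⟩

/-- `dτ_1 ∧ ⋯ ∧ dτ_p ∧ dg` contracted with lifts of the `∂_{t_j}`. -/
theorem IsFibre.dWedge_append_lifts (h : IsFibre φ τ c) {y : Pt B} (g : Fin n → A)
    {W : Fin p → tangentSpace (y.comp φ)} (hW : IsTauLift τ _ W) (v : Fin n → tangentSpace y) :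
    dWedge (Fin.append τ g) (y.comp φ) (Fin.append W fun i => pushTangent φ y (v i)) =
      (-1) ^ p * dWedge (fun i => φ (g i)) y v := by
  rw [dWedge_apply, dWedge_apply, ← Matrix.det_submatrix_equiv_self finSumFinEquiv]
  -- Block triangular: the lifts give -1 on the τ_j = t_0 - t_j, while vectors tangent to the fibre
  -- kill τ.
  have hblock : (Matrix.submatrix (Matrix.of fun a b =>
      ((Fin.append W (fun i => pushTangent φ y (v i)) a :
        tangentSpace (y.comp φ)) : A →ₗ[ℂ] ℂ)
        (Fin.append τ g b)) finSumFinEquiv finSumFinEquiv) =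
      Matrix.fromBlocks (-1) (Matrix.of fun i j => (W i : A →ₗ[ℂ] ℂ) (g j)) 0
        (Matrix.of fun i j => (v i : B →ₗ[ℂ] ℂ) (φ (g j))) := by
    ext (i | i) (j | j)
    · simp only [Matrix.submatrix_apply, Matrix.of_apply, finSumFinEquiv_apply_left,
        Fin.append_left, Matrix.fromBlocks_apply₁₁]
      refine (congrFun (hW i) j).trans ?_
      simp [Matrix.one_apply, Pi.single_apply, eq_comm]
    · simp only [Matrix.submatrix_apply, Matrix.of_apply, finSumFinEquiv_apply_left,
        finSumFinEquiv_apply_right, Fin.append_left, Fin.append_right, Matrix.fromBlocks_apply₁₂]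
    · simp only [Matrix.submatrix_apply, Matrix.of_apply, finSumFinEquiv_apply_left,
        finSumFinEquiv_apply_right, Fin.append_left, Fin.append_right, Matrix.fromBlocks_apply₂₁]
      exact congrFun (h.tauDiff_pushTangent y (v i)) j
    · simp only [Matrix.submatrix_apply, Matrix.of_apply,
        finSumFinEquiv_apply_right, Fin.append_right, Matrix.fromBlocks_apply₂₂]
      rfl
  rw [hblock, Matrix.det_fromBlocks_zero₂₁, Matrix.det_neg, Matrix.det_one, Fintype.card_fin,
    mul_one]

/-- Regular functions whose differentials are coordinates on the tangent space. -/
theorem exists_dual_functions {y : Pt B} (b : Module.Basis (Fin n) ℂ (tangentSpace y)) :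
    ∃ g : Fin n → B, ∀ i j, (b i : B →ₗ[ℂ] ℂ) (g j) = if i = j then 1 else 0 := by
  have hfin : Module.Finite ℂ (tangentSpace y) := Module.Finite.of_basis b
  let ev : B →ₗ[ℂ] Module.Dual ℂ (tangentSpace y) := (tangentSpace y).subtype.flip
  -- The tangent space consists of functionals on `B`, so the pairing separates its vectors; in
  -- finite dimension evaluation then hits the whole dual.
  have hev : Function.Surjective ev :=
    LinearMap.flip_surjective_iff₁.2 (tangentSpace y).subtype_injective
  choose g hg using fun j => hev (b.coord j)
  refine ⟨g, fun i j => ?_⟩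
  have := LinearMap.congr_fun (hg j) (b i)
  rw [Module.Basis.coord_apply, b.repr_self, Finsupp.single_apply] at this
  exact this

/-- There is a frame of the tangent bundle of rank `N` near `y`. -/
def HasFrame (N : ℕ) (y : Pt A) : Prop :=
  ∃ (f : A) (E : Fin N → Derivation ℂ A A), y f ≠ 0 ∧ ∀ y' : Pt A, y' f ≠ 0 →
    ∃ b : Module.Basis (Fin N) ℂ (tangentSpace y'), ∀ i, b i = (E i).toTangent y'

/-- Near `y` a regular form of top degree is a multiple of `dg_1 ∧ ⋯ ∧ dg_N` if the latter does
not vanish at `y`. -/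
theorem exists_eq_smul_dWedge {N : ℕ} {U : Set (Pt A)} {Ω : Form A N} (hΩ : IsRegularForm U Ω)
    {y : Pt A} (hy : y ∈ U) (hframe : HasFrame N y) (g : Fin N → A) (hg : dWedge g y ≠ 0) :
    ∃ a s : A, y s ≠ 0 ∧ ∀ y' ∈ U, y' s ≠ 0 → Ω y' = (y' a / y' s) • dWedge g y' := by
  obtain ⟨f, E, hf, hE⟩ := hframe
  obtain ⟨s, hs, r, k, l, hΩs⟩ := hΩ y hy
  let Δ : A := (Matrix.of fun a b => E a (g b)).det
  let G : A := ∑ j, k j * (Matrix.of fun a b => E a (l j b)).det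
  have hdet : ∀ (y' : Pt A) (b : Module.Basis (Fin N) ℂ (tangentSpace y')),
      (∀ i, b i = (E i).toTangent y') → ∀ l : Fin N → A,
      dWedge l y' b = y' (Matrix.of fun a b => E a (l b)).det := by
    intro y' b hb l
    rw [dWedge_apply, AlgHom.map_det]
    simp only [hb, Derivation.toTangent_apply]
    rfl
  refine ⟨G * f, s * Δ * f, ?_, fun y' hy' hs' => ?_⟩
  · obtain ⟨b, hb⟩ := hE y hf
    rw [map_mul, map_mul]
    refine mul_ne_zero (mul_ne_zero hs fun h0 => hg ?_) hf
    rw [(dWedge g y).eq_smul_basis_det b, hdet y b hb, h0, zero_smul]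
  · rw [map_mul, map_mul] at hs'
    have hf' := right_ne_zero_of_mul hs'
    have hs₁ := left_ne_zero_of_mul (left_ne_zero_of_mul hs')
    have hΔ := right_ne_zero_of_mul (left_ne_zero_of_mul hs')
    obtain ⟨b, hb⟩ := hE y' hf'
    have h1 : Ω y' b = y' G / y' s := by
      rw [hΩs y' hy' hs₁, alternatingMap_sum_apply]
      simp only [AlternatingMap.smul_apply, hdet y' b hb, G, map_sum, map_mul, Finset.sum_div,
        smul_eq_mul]
      exact Finset.sum_congr rfl fun j _ => by rw [div_mul_eq_mul_div]
    rw [(Ω y').eq_smul_basis_det b, (dWedge g y').eq_smul_basis_det b, h1, hdet y' b hb, smul_smul]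
    congr 1
    simp only [map_mul]
    change _ = _ * y' Δ
    field_simp

namespace IsFibre

variable (h : IsFibre φ τ c)

include h

/-- Local coordinates `(τ, g)` at a point where `τ` is submersive. -/
theorem exists_coordinates {y : Pt B} (hA : Module.finrank ℂ (tangentSpace (y.comp φ)) = p + n)
    [Module.Finite ℂ (tangentSpace (y.comp φ))] [Module.Finite ℂ (tangentSpace y)]
    (hn : Module.finrank ℂ (tangentSpace y) = n) {W : Fin p → tangentSpace (y.comp φ)}
    (hW : IsTauLift τ _ W) :
    ∃ (b : Module.Basis (Fin n) ℂ (tangentSpace y)) (g : Fin n → A)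
      (b' : Module.Basis (Fin (p + n)) ℂ (tangentSpace (y.comp φ))),
      (∀ i, b' i = Fin.append W (fun i => pushTangent φ y (b i)) i) ∧
      dWedge (Fin.append τ g) (y.comp φ) b' = (-1) ^ p := by
  let b : Module.Basis (Fin n) ℂ (tangentSpace y) := Module.finBasisOfFinrankEq ℂ _ hn
  obtain ⟨g', hg'⟩ := exists_dual_functions b
  choose g hg using fun i => h.surjective (g' i)
  let W' := Fin.append W fun i => pushTangent φ y (b i)
  have h1 : dWedge (Fin.append τ g) (y.comp φ) W' = (-1) ^ p := by
    rw [h.dWedge_append_lifts g hW b, dWedge_apply]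
    simp only [hg, hg']
    rw [show (Matrix.of fun i j : Fin n => if i = j then (1 : ℂ) else 0) = 1 by
      ext i j; simp [Matrix.one_apply], Matrix.det_one, mul_one]
  have hli : LinearIndependent ℂ W' := by
    by_contra hli
    rw [AlternatingMap.map_linearDependent _ _ hli] at h1
    exact pow_ne_zero p (neg_ne_zero.2 one_ne_zero) h1.symm
  refine ⟨b, g, basisOfLinearIndependentOfCardEqFinrank' W' hli (by rw [Fintype.card_fin, hA]),
    fun i => by simp [W'], ?_⟩
  rw [coe_basisOfLinearIndependentOfCardEqFinrank', h1]

/-- The contraction of a nowhere vanishing form with lifts of the `∂_{t_j}`. -/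
theorem exists_contraction {Ω : Form A (p + n)} (hΩ : IsRegularForm (nonsingularPart A) Ω)
    (hΩ' : IsNowhereVanishing (nonsingularPart A) Ω)
    (hsub : ∀ y ∈ nonsingularPart B, HasFrame (p + n) (y.comp φ) ∧
      y.comp φ ∈ nonsingularPart A ∧ Module.Finite ℂ (tangentSpace (y.comp φ)) ∧
      Module.finrank ℂ (tangentSpace (y.comp φ)) = p + n ∧
      Function.Surjective (tauDiff τ (y.comp φ)) ∧
      Module.Finite ℂ (tangentSpace y) ∧ Module.finrank ℂ (tangentSpace y) = n) :
    ∃ ω : Form B n, (∀ y ∈ nonsingularPart B, ∀ W, IsTauLift τ (y.comp φ) W →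
        ∀ v : Fin n → tangentSpace y,
          ω y v = Ω (y.comp φ) (Fin.append W fun i => pushTangent φ y (v i))) ∧
      IsRegularForm (nonsingularPart B) ω ∧ IsNowhereVanishing (nonsingularPart B) ω := by
  have hex : ∀ y : Pt B, ∃ ωy : (tangentSpace y) [⋀^Fin n]→ₗ[ℂ] ℂ, y ∈ nonsingularPart B →
      ∀ W, IsTauLift τ (y.comp φ) W → ∀ v : Fin n → tangentSpace y,
        ωy v = Ω (y.comp φ) (Fin.append W fun i => pushTangent φ y (v i)) := by
    intro y
    by_cases hy : y ∈ nonsingularPart B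
    · obtain ⟨-, -, h1, h2, h3, h4, h5⟩ := hsub y hy
      obtain ⟨W, hW⟩ := exists_isTauLift h3
      obtain ⟨b, g, b', hb', hdet⟩ := h.exists_coordinates h2 h5 hW
      -- Ω is a multiple of dτ ∧ dg at this point, and the contraction of dτ ∧ dg is (-1)^p d(φ g),
      -- in which the lifts no longer occur.
      refine ⟨Ω (y.comp φ) b' • dWedge (fun i => φ (g i)) y, fun _ W' hW' v => ?_⟩
      have h6 := (dWedge (Fin.append τ g) (y.comp φ)).eq_smul_basis_det b'
      have h7 := h.dWedge_append_lifts g hW' v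
      rw [h6, hdet, AlternatingMap.smul_apply, smul_eq_mul] at h7
      have h8 := mul_left_cancel₀ (pow_ne_zero p (neg_ne_zero.2 one_ne_zero)) h7
      conv_rhs => rw [(Ω (y.comp φ)).eq_smul_basis_det b', AlternatingMap.smul_apply, h8]
      rfl
    · exact ⟨0, fun hy' => absurd hy' hy⟩
  choose ω hω using hex
  refine ⟨ω, hω, fun y hy => ?_, fun y hy h0 => ?_⟩
  · obtain ⟨hframe, hyA, h1, h2, h3, h4, h5⟩ := hsub y hy
    obtain ⟨W, hW⟩ := exists_isTauLift h3
    obtain ⟨b, g, b', hb', hdet⟩ := h.exists_coordinates h2 h5 hW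
    obtain ⟨a, s, hs, hΩs⟩ := exists_eq_smul_dWedge hΩ hyA hframe (Fin.append τ g) fun h0 => by
      rw [h0, AlternatingMap.zero_apply] at hdet
      exact pow_ne_zero p (neg_ne_zero.2 one_ne_zero) hdet.symm
    -- The functions g chosen at `y` serve on a neighbourhood: there Ω = (a/s) dτ ∧ dg, with
    -- contraction (-1)^p (a/s) d(φ g).
    refine ⟨φ s, hs, 1, fun _ => φ ((-1) ^ p * a), fun _ i => φ (g i), fun y' hy' hs' => ?_⟩
    obtain ⟨-, hyA', -, -, h3', -⟩ := hsub y' hy'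
    obtain ⟨W', hW'⟩ := exists_isTauLift h3'
    ext v
    rw [hω y' hy' W' hW' v, hΩs _ hyA' hs', AlternatingMap.smul_apply,
      h.dWedge_append_lifts g hW' v]
    simp only [Finset.univ_unique, Finset.sum_const, Finset.card_singleton, one_smul,
      AlternatingMap.smul_apply, smul_eq_mul, map_mul, map_pow, map_neg, map_one,
      AlgHom.comp_apply]
    ring
  · obtain ⟨-, hyA, h1, h2, h3, h4, h5⟩ := hsub y hy
    obtain ⟨W, hW⟩ := exists_isTauLift h3
    obtain ⟨b, g, b', hb', -⟩ := h.exists_coordinates h2 h5 hW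
    have h6 := hω y hy W hW b
    rw [h0, AlternatingMap.zero_apply] at h6
    -- If the contraction vanished at `y`, Ω would vanish on a basis formed by lifts and fibre
    -- vectors.
    apply hΩ' _ hyA
    rw [(Ω (y.comp φ)).eq_smul_basis_det b', show (⇑b' : Fin (p + n) → _) = _ from funext hb', ← h6,
      zero_smul]

end IsFibre

theorem IsRegularForm.isHolomorphicForm {k : ℕ} {U : Set (Pt B)} {ω : Form B k}
    (hω : IsRegularForm U ω) : IsHolomorphicForm U ω := by
  intro y hy
  obtain ⟨s, hs, r, g, l, hωs⟩ := hω y hy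
  -- Coordinate 0 carries the denominator s; the coefficients are the rational functions z_(j+1) /
  -- z_0.
  refine ⟨r + 1, Fin.cons s g, r, fun j z => z j.succ / z 0, l, fun j => ?_, ?_⟩
  · refine AnalyticAt.div ?_ ?_ (by simpa using hs)
    · exact (ContinuousLinearMap.proj (R := ℂ) (φ := fun _ : Fin (r + 1) => ℂ) j.succ).analyticAt _
    · exact (ContinuousLinearMap.proj (R := ℂ) (φ := fun _ : Fin (r + 1) => ℂ) 0).analyticAt _
  · have hev : ∀ᶠ y' in analyticNhds y, y' s ≠ 0 := by
      have h1 : ∀ᶠ F in 𝓝 (fun a : B => y a), F s ≠ 0 :=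
        (continuous_apply s).continuousAt.eventually_ne hs
      exact Filter.Eventually.comap h1 _
    filter_upwards [hev] with y' hs' hy'
    rw [hωs y' hy' hs']
    simp

end Fibre
end


noncomputable section

/-! ## Non-singularity of submersive fibres -/

section SmoothFibre

variable {A B : Type*} [CommRing A] [Algebra ℂ A] [CommRing B] [Algebra ℂ B] {φ : A →ₐ[ℂ] B}
  {p n : ℕ} {τ : Fin p → A} {c : Fin p → ℂ}

/-- The map of local rings at a point of a closed subvariety. -/
def localRingMap (φ : A →ₐ[ℂ] B) (y : Pt B) : LocalRingAt (y.comp φ) →+* LocalRingAt y :=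
  Localization.localRingHom _ _ (φ : A →+* B) rfl

theorem localRingMap_mk' (φ : A →ₐ[ℂ] B) (y : Pt B) (a : A)
    (s : (RingHom.ker (y.comp φ)).primeCompl) :
    localRingMap φ y (IsLocalization.mk' _ a s) =
      IsLocalization.mk' _ (φ a) (⟨φ s, s.2⟩ : (RingHom.ker y).primeCompl) :=
  Localization.localRingHom_mk' _ _ _ _ _ _

theorem localRingMap_surjective (hφ : Function.Surjective φ) (y : Pt B) :
    Function.Surjective (localRingMap φ y) := by
  intro z
  obtain ⟨b, ⟨s, hs⟩, rfl⟩ := IsLocalization.exists_mk'_eq (RingHom.ker y).primeCompl z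
  obtain ⟨a, rfl⟩ := hφ b
  obtain ⟨t, rfl⟩ := hφ s
  exact ⟨IsLocalization.mk' _ a (⟨t, hs⟩ : (RingHom.ker (y.comp φ)).primeCompl),
    localRingMap_mk' φ y a _⟩

theorem ker_localRingMap_le (hφ : Function.Surjective φ) (y : Pt B) :
    RingHom.ker (localRingMap φ y) ≤
      (RingHom.ker φ).map (algebraMap A (LocalRingAt (y.comp φ))) := by
  intro z hz
  obtain ⟨a, s, rfl⟩ := IsLocalization.exists_mk'_eq (RingHom.ker (y.comp φ)).primeCompl z
  rw [RingHom.mem_ker, localRingMap_mk', IsLocalization.mk'_eq_zero_iff] at hz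
  obtain ⟨⟨t, ht⟩, hta⟩ := hz
  obtain ⟨t, rfl⟩ := hφ t
  have h1 : t * a ∈ RingHom.ker φ := by rw [RingHom.mem_ker, map_mul]; exact hta
  have h2 : IsLocalization.mk' (LocalRingAt (y.comp φ)) a s =
      IsLocalization.mk' (LocalRingAt (y.comp φ)) 1
        (⟨t, ht⟩ * s : (RingHom.ker (y.comp φ)).primeCompl) * algebraMap A _ (t * a) := by
    rw [mul_comm, ← IsLocalization.mk'_eq_mul_mk'_one, IsLocalization.mk'_eq_iff_eq]
    simp only [Submonoid.coe_mul]
    ring_nf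
  rw [h2]
  exact Ideal.mul_mem_left _ _ (Ideal.mem_map_of_mem _ h1)

namespace IsFibre

variable (h : IsFibre φ τ c)

include h

/-- Dividing by p elements of the maximal ideal lowers the dimension by at most p, and the local
ring of the fibre surjects onto that quotient. -/
theorem ringKrullDim_le {y : Pt B} (hy : IsNonsingular (y.comp φ)) :
    ringKrullDim (LocalRingAt (y.comp φ)) ≤ ringKrullDim (LocalRingAt y) + p := by
  classical
  have : IsRegularLocalRing (LocalRingAt (y.comp φ)) := hy
  let s : Finset (LocalRingAt (y.comp φ)) :=
    Finset.univ.image fun j => algebraMap A _ (τ j - algebraMap ℂ A (c j))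
  have hspan : Ideal.span (s : Set (LocalRingAt (y.comp φ))) =
      (RingHom.ker φ).map (algebraMap A (LocalRingAt (y.comp φ))) := by
    rw [h.ker_eq, Ideal.map_span, ← Set.range_comp]
    simp only [s, Finset.coe_image, Finset.coe_univ, Set.image_univ]
    rfl
  have hs : (s : Set (LocalRingAt (y.comp φ))) ⊆ Ring.jacobson (LocalRingAt (y.comp φ)) := by
    rw [IsLocalRing.ringJacobson_eq_maximalIdeal]
    intro z hz
    obtain ⟨j, -, rfl⟩ := Finset.mem_image.1 hz
    rw [SetLike.mem_coe, IsLocalization.AtPrime.to_map_mem_maximal_iff _ (RingHom.ker (y.comp φ)),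
      RingHom.mem_ker, AlgHom.comp_apply, map_sub, h.apply_tau, AlgHom.commutes, sub_self, map_zero]
  have hcard : s.card ≤ p := Finset.card_image_le.trans (by simp)
  have hle : RingHom.ker (localRingMap φ y) ≤ Ideal.span (s : Set (LocalRingAt (y.comp φ))) := by
    rw [hspan]; exact ker_localRingMap_le h.surjective y
  have h1 : ringKrullDim (LocalRingAt (y.comp φ) ⧸ Ideal.span (s : Set (LocalRingAt (y.comp φ)))) ≤
      ringKrullDim (LocalRingAt y) := by
    refine (ringKrullDim_le_of_surjective (Ideal.Quotient.factor hle)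
      (Ideal.Quotient.factor_surjective hle)).trans ?_
    rw [ringKrullDim_eq_of_ringEquiv
      (RingHom.quotientKerEquivOfSurjective (localRingMap_surjective h.surjective y))]
  refine (ringKrullDim_le_ringKrullDim_quotient_add_card s hs).trans ?_
  exact add_le_add h1 (by exact_mod_cast hcard)

/-- Submersivity makes the tangent space of the fibre n-dimensional, while the local dimension is at
least n by `ringKrullDim_le`. -/
theorem isNonsingular {y : Pt B} (hy : IsNonsingular (y.comp φ))
    (hA : Module.finrank ℂ (tangentSpace (y.comp φ)) = p + n)
    (hτ : Function.Surjective (tauDiff τ (y.comp φ))) : IsNonsingular y := by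
  have hreg : IsRegularLocalRing (LocalRingAt (y.comp φ)) := hy
  have : IsNoetherianRing (LocalRingAt y) :=
    isNoetherianRing_of_surjective _ _ _ (localRingMap_surjective h.surjective y)
  obtain ⟨h1, h2⟩ := finite_tangentSpace_of_isNonsingular hy
  have h3 := h.finrank_tangentSpace y
  rw [LinearMap.range_eq_top.2 hτ, finrank_top, Module.finrank_fin_fun, hA] at h3
  have : Module.Finite ℂ (tangentSpace y) :=
    Module.Finite.of_injective _ (pushTangent_injective h.surjective y)
  apply isNonsingular_of_finrank_le
  have h4 := h2.trans (h.ringKrullDim_le hy)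
  rw [hA, ← h3, Nat.cast_add, add_comm (p : WithBot ℕ∞)] at h4
  exact ENat.WithBot.add_le_add_natCast_right_iff.1 h4

end IsFibre

end SmoothFibre
end


noncomputable section

/-! ## The fibres of `f` -/

section MinkowskiFibre

variable {d p : ℕ} {R : Fin (p + 1) → Set (Fin d → ℝ)} {V : Fin (p + 1) → Finset (Fin d → ℤ)}
  {x : Fin (p + 1) → ℂ}

theorem LocalCoords.hasFrame {M : Type*} [AddCommGroup M] {S : AddSubmonoid M} {e : M} {N : ℕ}
    [NeZero N] {b₀ : Module.Basis (Fin N) ℤ M} {y : Pt (AddMonoidAlgebra ℂ S)}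
    (L : LocalCoords e b₀ y) : HasFrame N y :=
  ⟨chi L.f, L.E, L.ne_zero, fun _ hy' => ⟨L.basis hy', L.basis_apply hy'⟩⟩

/-- The function `t_0 - t_j`. -/
def tauFun (R : Fin (p + 1) → Set (Fin d → ℝ)) (j : Fin p) : CoordRing R :=
  tFun R 0 - tFun R j.succ

theorem isFibre_fibreIncl :
    IsFibre (fibreIncl R x) (tauFun R) fun j => x 0 - x j.succ where
  surjective := Ideal.Quotient.mkₐ_surjective ℂ _
  ker_eq := Ideal.Quotient.mkₐ_ker ℂ (fibreIdeal R x)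

/-- The class modulo (1, …, 1) is determined by the differences t_0 - t_j; the ambiguity is the
value of the vector on t_0. -/
theorem areLifts_iff (y : Pt (CoordRing R)) (W : Fin p → tangentSpace y) :
    AreLifts R y W ↔ IsTauLift (tauFun R) y W := by
  refine forall_congr' fun j => ?_
  rw [dMap, Submodule.Quotient.eq, Submodule.mem_span_singleton]
  constructor
  · rintro ⟨c, hc⟩
    ext k
    have h0 := congrFun hc 0
    have h1 := congrFun hc k.succ
    simp only [Pi.smul_apply, Pi.one_apply, Pi.sub_apply, smul_eq_mul, mul_one,
      Pi.single_eq_of_ne (Fin.succ_ne_zero j).symm, sub_zero] at h0 h1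
    rw [tauDiff_apply, tauFun, map_sub, ← h0, Pi.neg_apply]
    have h2 : (Pi.single j.succ 1 : Fin (p + 1) → ℂ) k.succ = (Pi.single j 1 : Fin p → ℂ) k := by
      simp [Pi.single_apply]
    rw [h2] at h1
    linear_combination h1
  · intro h
    refine ⟨(W j : CoordRing R →ₗ[ℂ] ℂ) (tFun R 0), ?_⟩
    ext k
    simp only [Pi.smul_apply, Pi.one_apply, Pi.sub_apply, smul_eq_mul, mul_one]
    refine Fin.cases ?_ (fun k => ?_) k
    · rw [Pi.single_eq_of_ne (Fin.succ_ne_zero j).symm, sub_zero]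
    · have h1 := congrFun h k
      rw [tauDiff_apply, tauFun, map_sub, Pi.neg_apply] at h1
      have h2 : (Pi.single j.succ 1 : Fin (p + 1) → ℂ) k.succ = (Pi.single j 1 : Fin p → ℂ) k := by
        simp [Pi.single_apply]
      rw [h2]
      linear_combination h1

theorem IsTauLift.surjective {A : Type*} [CommRing A] [Algebra ℂ A] {τ : Fin p → A} {y : Pt A}
    {W : Fin p → tangentSpace y} (hW : IsTauLift τ y W) : Function.Surjective (tauDiff τ y) := by
  intro w
  refine ⟨∑ j, -w j • W j, ?_⟩
  rw [map_sum]
  ext k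
  simp only [map_smul, hW _, Finset.sum_apply]
  simp [Pi.single_apply]

/-- Evaluation of the characters of `T_ℂ(N')` at `s ∈ T_ℂ(L)`. -/
def charValueHom (p : ℕ) (s : Fin d → ℂˣ) : Multiplicative (CharLattice d p) →* ℂˣ where
  toFun m := ∏ i, s i ^ m.toAdd.1 i
  map_one' := by simp
  map_mul' a b := by simp [zpow_add, Finset.prod_mul_distrib]

theorem torusAct_chi (s : Fin d → ℂˣ) (m : dualMonoid R) :
    torusAct R s (chi m) =
      ((charValueHom p s (Multiplicative.ofAdd (m : CharLattice d p)) : ℂˣ) : ℂ) • chi m := by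
  rw [smul_chi, torusAct, chi, AddMonoidAlgebra.lift_single, one_smul]
  rfl

theorem torusAct_mul (s s' : Fin d → ℂˣ) (h : ∀ i, s i * s' i = 1) :
    (torusAct R s).comp (torusAct R s') = AlgHom.id ℂ (CoordRing R) := by
  have h1 : ∀ m : dualMonoid R, ((torusAct R s).comp (torusAct R s')) (chi m) = chi m := by
    intro m
    rw [AlgHom.comp_apply, torusAct_chi, map_smul, torusAct_chi, smul_smul, ← Units.val_mul]
    have : charValueHom p s' (Multiplicative.ofAdd (m : CharLattice d p)) *
        charValueHom p s (Multiplicative.ofAdd (m : CharLattice d p)) = 1 := by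
      simp only [charValueHom, MonoidHom.coe_mk, OneHom.coe_mk, ← Finset.prod_mul_distrib,
        ← mul_zpow]
      exact Finset.prod_eq_one fun i _ => by rw [mul_comm, h, one_zpow]
    rw [this, Units.val_one, one_smul]
  exact AlgHom.toLinearMap_injective (linearMap_ext_chi h1)

theorem IsNonsingular.comp_of_inverse {B : Type*} [CommRing B] [Algebra ℂ B] {y : Pt B}
    (hy : IsNonsingular y) (F G : B →ₐ[ℂ] B) (hFG : ∀ b, F (G b) = b) (hGF : ∀ b, G (F b) = b) :
    IsNonsingular (y.comp F) :=
  hy.comp_algEquiv (AlgEquiv.ofAlgHom F G (AlgHom.ext hFG) (AlgHom.ext hGF))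

theorem fibreAct_fibreAct (s s' : Fin d → ℂˣ) (h : ∀ i, s i * s' i = 1) (b : FibreRing R x) :
    fibreAct R s x (fibreAct R s' x b) = b := by
  obtain ⟨a, rfl⟩ := Ideal.Quotient.mk_surjective b
  exact congrArg (Ideal.Quotient.mk (fibreIdeal R x)) (DFunLike.congr_fun (torusAct_mul s s' h) a)

theorem isNonsingular_fibreAct (s : Fin d → ℂˣ) {y : Pt (FibreRing R x)} (hy : IsNonsingular y) :
    IsNonsingular (y.comp (fibreAct R s x)) :=
  hy.comp_of_inverse _ (fibreAct R (fun i => (s i)⁻¹) x)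
    (fibreAct_fibreAct _ _ fun i => mul_inv_cancel (s i))
    (fibreAct_fibreAct _ _ fun i => inv_mul_cancel (s i))

theorem isNonsingular_torusAct (s : Fin d → ℂˣ) {y : Pt (CoordRing R)} (hy : IsNonsingular y) :
    IsNonsingular (y.comp (torusAct R s)) :=
  hy.comp_of_inverse _ (torusAct R fun i => (s i)⁻¹)
    (DFunLike.congr_fun (torusAct_mul _ _ fun i => mul_inv_cancel (s i)))
    (DFunLike.congr_fun (torusAct_mul _ _ fun i => inv_mul_cancel (s i)))

theorem torusIncl_tFun (k : Fin (p + 1)) : torusIncl R (tFun R k) = tChar d k := by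
  exact mapDomainAlgHom_chi (dualMonoid R).subtype (tElem R k)

/-- The coordinate vector field `∂ / ∂t_j` on the torus. -/
theorem exists_torus_vector (u : Pt (TorusRing d p)) (j : Fin p) :
    ∃ D : tangentSpace u, (∀ k, (D : TorusRing d p →ₗ[ℂ] ℂ) (tChar d k) =
      (Pi.single j.succ 1 : Fin (p + 1) → ℂ) k) ∧
      ∀ z, (D : TorusRing d p →ₗ[ℂ] ℂ) (zFun p z) = 0 := by
  have hj : u (tChar d j.succ) ≠ 0 := pt_chi_ne_zero u (0, Pi.single j.succ 1)
  -- The logarithmic field t_j ∂/∂t_j, divided by the value of t_j.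
  refine ⟨tangentOfChi u (fun m => u (chi m) * (m.2 j.succ / u (tChar d j.succ)))
    fun m m' => ?_, fun k => ?_, fun z => ?_⟩
  · rw [chi_add, map_mul, Prod.snd_add, Pi.add_apply, Int.cast_add]
    ring
  · rw [show tChar d k = chi ((0, Pi.single k 1) : CharLattice d p) from rfl, tangentOfChi_chi]
    by_cases hk : k = j.succ
    · subst hk
      simp only [Pi.single_eq_same, Int.cast_one]
      exact mul_one_div_cancel hj
    · simp [hk, Ne.symm hk]
  · rw [show zFun p z = chi ((z, 0) : CharLattice d p) from rfl, tangentOfChi_chi]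
    simp

/-- The reordering `t_1, …, t_p, z_1, …, z_d, t_0` of the characters. -/
def charReorder (d p : ℕ) : Fin p ⊕ Fin (d + 1) → Fin d ⊕ Fin (p + 1) :=
  Sum.elim (fun j => Sum.inr j.succ) (Fin.snoc (α := fun _ => Fin d ⊕ Fin (p + 1)) Sum.inl (Sum.inr 0))

theorem charReorder_bijective (d p : ℕ) : Function.Bijective (charReorder d p) := by
  rw [Fintype.bijective_iff_surjective_and_card]
  refine ⟨?_, by simp only [Fintype.card_sum, Fintype.card_fin]; omega⟩
  rintro (i | k)
  · exact ⟨Sum.inr i.castSucc, by simp [charReorder]⟩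
  · refine Fin.cases ⟨Sum.inr (Fin.last d), by simp [charReorder]⟩ (fun j => ⟨Sum.inl j, rfl⟩) k

/-- The position of the characters `t_1, …, t_p, z_1, …, z_d, t_0` in `torusForm`. -/
def charPosition (d p : ℕ) : Fin p ⊕ Fin (d + 1) ≃ Fin (p + (d + 1)) :=
  (Equiv.ofBijective _ (charReorder_bijective d p)).trans
    (finSumFinEquiv.trans (finCongr (by omega)))

/-- The sign of the reordering of `z_1, …, z_d, t_0, …, t_p` into `t_1, …, t_p, z_1, …, z_d, t_0`. -/
def contractionSign (d p : ℕ) : ℤˣ :=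
  Equiv.Perm.sign (finSumFinEquiv.symm.trans (charPosition d p))

theorem append_charPosition {α : Type*} (zs : Fin d → α) (ts : Fin (p + 1) → α)
    (a : Fin p ⊕ Fin (d + 1)) :
    Fin.append zs ts (Fin.cast (by omega) (charPosition d p a)) =
      Sum.elim zs ts (charReorder d p a) := by
  have : Fin.cast (by omega) (charPosition d p a) = finSumFinEquiv (charReorder d p a) := rfl
  rw [this]
  rcases charReorder d p a with i | k
  · simp
  · simp

/-- After moving t_1, …, t_p to the front, the rows of `W` are the identity on these and zero on the
z_i and t_0, so the determinant reduces to the lower right block. -/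
theorem dWedge_append_torus {A : Type*} [CommRing A] [Algebra ℂ A] {y : Pt A} (zs : Fin d → A)
    (ts : Fin (p + 1) → A) (W : Fin p → tangentSpace y) (v : Fin (d + 1) → tangentSpace y)
    (hWt : ∀ j k, (W j : A →ₗ[ℂ] ℂ) (ts k) = (Pi.single j.succ 1 : Fin (p + 1) → ℂ) k)
    (hWz : ∀ j i, (W j : A →ₗ[ℂ] ℂ) (zs i) = 0) :
    dWedge (fun a : Fin (p + (d + 1)) => Fin.append zs ts (Fin.cast (by omega) a)) y
        (Fin.append W v) =
      ((contractionSign d p : ℤ) : ℂ) *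
        dWedge (Fin.snoc (α := fun _ => A) zs (ts 0)) y v := by
  rw [dWedge_apply, dWedge_apply]
  set X : Matrix (Fin (p + (d + 1))) (Fin (p + (d + 1))) ℂ := Matrix.of fun a b =>
    ((Fin.append W v a : tangentSpace y) : A →ₗ[ℂ] ℂ) (Fin.append zs ts (Fin.cast (by omega) b)) with hX
  have h1 : (X.submatrix id (finSumFinEquiv.symm.trans (charPosition d p))).det =
      ((contractionSign d p : ℤ) : ℂ) * X.det := Matrix.det_permute' _ _
  rw [← Matrix.det_submatrix_equiv_self finSumFinEquiv] at h1
  have h2 : (X.submatrix id (finSumFinEquiv.symm.trans (charPosition d p))).submatrix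
      finSumFinEquiv finSumFinEquiv = Matrix.fromBlocks 1 0
        (Matrix.of fun i j => (v i : A →ₗ[ℂ] ℂ) (ts j.succ))
        (Matrix.of fun i j => (v i : A →ₗ[ℂ] ℂ) (Fin.snoc (α := fun _ => A) zs (ts 0) j)) := by
    have h3 : ∀ i : Fin (d + 1), Sum.elim zs ts (charReorder d p (Sum.inr i)) =
        Fin.snoc (α := fun _ => A) zs (ts 0) i := by
      intro i
      refine Fin.lastCases ?_ (fun i => ?_) i <;> simp [charReorder]
    have h4 : ∀ j, Sum.elim zs ts (charReorder d p (Sum.inl j)) = ts j.succ := fun j => rfl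
    ext (i | i) (j | j) <;>
      simp only [hX, Matrix.submatrix_apply, id, Equiv.trans_apply,
        finSumFinEquiv_symm_apply_castAdd, finSumFinEquiv_symm_apply_natAdd,
        Matrix.of_apply, append_charPosition, h3, h4, finSumFinEquiv_apply_left,
        finSumFinEquiv_apply_right, Fin.append_left, Fin.append_right, Matrix.fromBlocks_apply₁₁,
        Matrix.fromBlocks_apply₁₂, Matrix.fromBlocks_apply₂₁, Matrix.fromBlocks_apply₂₂]
    · rw [hWt]
      simp [Matrix.one_apply, Pi.single_apply, eq_comm]
    · refine Fin.lastCases ?_ (fun j => ?_) j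
      · rw [Fin.snoc_last, hWt]; simp [eq_comm]
      · rw [Fin.snoc_castSucc, hWz]; rfl
  rw [h2, Matrix.det_fromBlocks_zero₁₂, Matrix.det_one, one_mul] at h1
  rw [h1, ← mul_assoc, ← Int.cast_mul, Int.units_coe_mul_self, Int.cast_one, one_mul]

end MinkowskiFibre
end


noncomputable section

/-! ## The contracted form -/

section Contraction

/-- Transport of tangent vectors along an equality of points. -/
def castTangent {A : Type*} [CommRing A] [Algebra ℂ A] {y y' : Pt A} (h : y = y')
    (D : tangentSpace y) : tangentSpace y' :=
  ⟨D, h ▸ D.2⟩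

theorem form_congr {A : Type*} [CommRing A] [Algebra ℂ A] {k : ℕ} (Ω : Form A k) {y y' : Pt A}
    (h : y = y') {v : Fin k → tangentSpace y} {v' : Fin k → tangentSpace y'}
    (hv : ∀ i a, (v i : A →ₗ[ℂ] ℂ) a = (v' i : A →ₗ[ℂ] ℂ) a) : Ω y v = Ω y' v' := by
  subst h
  exact congrArg (Ω y) (funext fun i => Subtype.ext (LinearMap.ext (hv i)))

variable {d p : ℕ} {R : Fin (p + 1) → Set (Fin d → ℝ)} {V : Fin (p + 1) → Finset (Fin d → ℤ)}
  {x : Fin (p + 1) → ℂ} {Ω : Form (CoordRing R) (p + (d + 1))}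
  {ω : Form (FibreRing R x) (d + 1)}

/-- A tangent space of dimension at most N forces a chart, hence dimension exactly N and a
non-singular point of Y. This supplies the hypothesis of `IsFibre.submersive`. -/
theorem submersive_of_isNonsingular (hV : AreVertices R V)
    (b₀ : Module.Basis (Fin (p + (d + 1))) ℤ (CharLattice d p)) {y : Pt (FibreRing R x)}
    (hy : IsNonsingular y) :
    HasFrame (p + (d + 1)) (y.comp (fibreIncl R x)) ∧
      y.comp (fibreIncl R x) ∈ nonsingularPart (CoordRing R) ∧
      Module.Finite ℂ (tangentSpace (y.comp (fibreIncl R x))) ∧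
      Module.finrank ℂ (tangentSpace (y.comp (fibreIncl R x))) = p + (d + 1) ∧
      Function.Surjective (tauDiff (tauFun R) (y.comp (fibreIncl R x))) ∧
      Module.Finite ℂ (tangentSpace y) ∧ Module.finrank ℂ (tangentSpace y) = d + 1 := by
  have hG := isGorenstein_dualMonoid hV
  have key : ∀ y' : Pt (CoordRing R), Module.Finite ℂ (tangentSpace y') →
      Module.finrank ℂ (tangentSpace y') ≤ p + (d + 1) →
      Module.finrank ℂ (tangentSpace y') = p + (d + 1) := fun y' h1 h2 => by
    obtain ⟨L⟩ := hG.exists_localCoords b₀ h1 h2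
    exact (L.finite_tangentSpace L.ne_zero).2.trans (Fintype.card_fin _)
  obtain ⟨h1, h2, h3⟩ := isFibre_fibreIncl.submersive (ringKrullDim_fibreRing_le hV x) hy (key _)
  obtain ⟨L⟩ := hG.exists_localCoords b₀ h1 h2.le
  have hN : Module.finrank ℤ (CharLattice d p) = p + (d + 1) := by
    simpa using Module.finrank_eq_card_basis b₀
  obtain ⟨b, J, f, hc⟩ := hG.exists_isChart (y.comp (fibreIncl R x)) (h2.trans hN.symm).le
  exact ⟨L.hasFrame, hc.isNonsingular hG, h1, h2, h3⟩

/-- The action fixes every t_k, so it carries lifts of ∂_(t_j) to lifts; the contraction inherits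
the invariance of Ω. -/
theorem pullback_fibreAct (hω : IsContraction R Ω x ω) (s : Fin d → ℂˣ) {y : Pt (FibreRing R x)}
    (hy : IsNonsingular y) (hlift : ∃ W, AreLifts R (y.comp (fibreIncl R x)) W)
    (hΩ : Form.pullback (torusAct R s) Ω (y.comp (fibreIncl R x)) = Ω (y.comp (fibreIncl R x))) :
    Form.pullback (fibreAct R s x) ω y = ω y := by
  obtain ⟨W, hW⟩ := hlift
  have hpt : (y.comp (fibreIncl R x)).comp (torusAct R s) =
      (y.comp (fibreAct R s x)).comp (fibreIncl R x) := AlgHom.ext fun _ => rfl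
  let W' : Fin p → tangentSpace ((y.comp (fibreAct R s x)).comp (fibreIncl R x)) := fun j =>
    castTangent hpt (pushTangent (torusAct R s) _ (W j))
  have hW' : AreLifts R _ W' := by
    intro j
    rw [← hW j, dMap, dMap]
    congr 1
    funext k
    exact congrArg (W j : CoordRing R →ₗ[ℂ] ℂ) (torusAct_tFun R s k)
  ext v
  rw [hω y hy W hW v, ← hΩ]
  refine (hω _ (isNonsingular_fibreAct s hy) W' hW' _).trans (form_congr Ω hpt.symm fun i a => ?_)
  refine Fin.addCases (fun j => ?_) (fun j => ?_) i
  · simp only [Fin.append_left]; rfl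
  · simp only [Fin.append_right]; rfl

theorem torus_square (u : Pt (TorusFibreRing R x)) :
    (u.comp (Ideal.Quotient.mkₐ ℂ ((fibreIdeal R x).map (torusIncl R)))).comp (torusIncl R) =
      (u.comp (torusFibreIncl R x)).comp (fibreIncl R x) := AlgHom.ext fun _ => rfl

theorem exists_torus_lifts (u : Pt (TorusFibreRing R x)) :
    ∃ W : Fin p → tangentSpace
        (u.comp (Ideal.Quotient.mkₐ ℂ ((fibreIdeal R x).map (torusIncl R)))),
      (∀ j k, (W j : TorusRing d p →ₗ[ℂ] ℂ) (tChar d k) =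
        (Pi.single j.succ 1 : Fin (p + 1) → ℂ) k) ∧
      (∀ j z, (W j : TorusRing d p →ₗ[ℂ] ℂ) (zFun p z) = 0) ∧
      AreLifts R _ fun j => castTangent (torus_square u) (pushTangent (torusIncl R) _ (W j)) := by
  choose W hW hWz using exists_torus_vector
    (u.comp (Ideal.Quotient.mkₐ ℂ ((fibreIdeal R x).map (torusIncl R))))
  refine ⟨W, hW, hWz, fun j => ?_⟩
  rw [dMap]
  congr 1
  funext k
  rw [← hW j k, ← torusIncl_tFun (R := R) k]
  rfl

/-- The fields ∂/∂t_j are lifts at every torus point, so f is submersive there. -/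
theorem isNonsingular_torusFibre (hV : AreVertices R V)
    (b₀ : Module.Basis (Fin (p + (d + 1))) ℤ (CharLattice d p)) (u : Pt (TorusFibreRing R x)) :
    IsNonsingular (u.comp (torusFibreIncl R x)) := by
  have hG := isGorenstein_dualMonoid hV
  obtain ⟨W, -, -, hW⟩ := exists_torus_lifts u
  have hc := hG.isChart_torus
    (u.comp (Ideal.Quotient.mkₐ ℂ ((fibreIdeal R x).map (torusIncl R)))) b₀
  obtain ⟨L⟩ := hc.exists_localCoords hG b₀
  have h1 := (L.finite_tangentSpace L.ne_zero).2.trans (Fintype.card_fin _)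
  have h2 := hc.isNonsingular hG
  change IsNonsingular ((u.comp (Ideal.Quotient.mkₐ ℂ
    ((fibreIdeal R x).map (torusIncl R)))).comp (torusIncl R)) at h2
  change Module.finrank ℂ (tangentSpace ((u.comp (Ideal.Quotient.mkₐ ℂ
    ((fibreIdeal R x).map (torusIncl R)))).comp (torusIncl R))) = _ at h1
  rw [torus_square] at h1 h2
  exact isFibre_fibreIncl.isNonsingular h2 h1 ((areLifts_iff _ _).1 hW).surjective

/-- Since the contraction may use any lifts, it is computed with ∂/∂t_j on the torus, which kill the
z_i and t_0. -/
theorem pullback_torusFibreIncl {C : ℂ} {z : Fin d → Fin d → ℤ} (hω : IsContraction R Ω x ω)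
    (hΩ : ∀ u, Form.pullback (torusIncl R) Ω u = C • torusForm p z u)
    (u : Pt (TorusFibreRing R x)) (hu : IsNonsingular (u.comp (torusFibreIncl R x))) :
    Form.pullback (torusFibreIncl R x) ω u =
      (((contractionSign d p : ℤ) : ℂ) * C) • torusFibreForm R x z u := by
  obtain ⟨W, hWt, hWz, hW⟩ := exists_torus_lifts u
  let q : TorusRing d p →ₐ[ℂ] TorusFibreRing R x :=
    Ideal.Quotient.mkₐ ℂ ((fibreIdeal R x).map (torusIncl R))
  ext v
  have h1 : Form.pullback (torusFibreIncl R x) ω u v =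
      Form.pullback (torusIncl R) Ω (u.comp q) (Fin.append W fun i => pushTangent q u (v i)) := by
    refine (hω _ hu _ hW _).trans (form_congr Ω (torus_square u).symm fun i a => ?_)
    refine Fin.addCases (fun j => ?_) (fun j => ?_) i
    · simp only [Fin.append_left]; rfl
    · simp only [Fin.append_right]; rfl
  have h2 : dWedge (Fin.snoc (α := fun _ => TorusRing d p) (fun i => zFun p (z i)) (tChar d 0))
      (u.comp q) (fun i => pushTangent q u (v i)) =
      dWedge (Fin.snoc (α := fun _ => TorusFibreRing R x)
        (fun i => Ideal.Quotient.mk _ (zFun p (z i))) (Ideal.Quotient.mk _ (tChar d 0))) u v := by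
    rw [dWedge_apply, dWedge_apply]
    congr 1
    ext i j
    refine Fin.lastCases ?_ (fun j => ?_) j
    · simp only [Matrix.of_apply, Fin.snoc_last]; rfl
    · simp only [Matrix.of_apply, Fin.snoc_castSucc]; rfl
  rw [h1, hΩ, AlternatingMap.smul_apply, torusForm, AlternatingMap.smul_apply,
    dWedge_append_torus _ _ W _ hWt fun j i => hWz j (z i), h2, torusFibreForm,
    AlternatingMap.smul_apply, AlternatingMap.smul_apply]
  simp only [smul_eq_mul]
  change C * ((∏ i, u (q (zFun p (z i))))⁻¹ * _) = _ * ((∏ i, u (q (zFun p (z i))))⁻¹ * _)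
  ring

end Contraction
end

theorem proposition3p2 (d p : ℕ) (P : Set (Fin d → ℝ)) (R : Fin (p + 1) → Set (Fin d → ℝ))
    (hR : ∀ k, IsLatticePolytope (R k)) (hP : P = ∑ k, R k) (hdim : (interior P).Nonempty)
    (z : Module.Basis (Fin d) ℤ (Fin d → ℤ)) :
    -- the characters `z_i` and `t_k` form a basis of `M'`
    (∃ b : Module.Basis (Fin d ⊕ Fin (p + 1)) ℤ (CharLattice d p),
      (∀ i, b (Sum.inl i) = (z i, 0)) ∧ ∀ k, b (Sum.inr k) = (0, Pi.single k 1)) ∧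
    (∃ Ω : Form (CoordRing R) (p + (d + 1)), IsVolumeForm R Ω) ∧
    ∃ ε : ℂ, (ε = 1 ∨ ε = -1) ∧
      ∀ Ω : Form (CoordRing R) (p + (d + 1)), IsVolumeForm R Ω →
        ∃ C : ℂ, C ≠ 0 ∧
          (∀ u : Pt (TorusRing d p),
            u.comp (torusIncl R) ∈ nonsingularPart (CoordRing R) ∧
            Form.pullback (torusIncl R) Ω u = C • torusForm p z u) ∧
          ∀ x : Fin (p + 1) → ℂ,
            -- `Ω` is defined, and the `∂_{t_j}` lift, along the non-singular part of the fibre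
            (∀ y ∈ nonsingularPart (FibreRing R x),
              y.comp (fibreIncl R x) ∈ nonsingularPart (CoordRing R) ∧
              ∃ V : Fin p → tangentSpace (y.comp (fibreIncl R x)), AreLifts R _ V) ∧
            ∃ ω : Form (FibreRing R x) (d + 1),
              IsContraction R Ω x ω ∧
              IsRegularForm (nonsingularPart (FibreRing R x)) ω ∧
              IsHolomorphicForm (nonsingularPart (FibreRing R x)) ω ∧
              IsNowhereVanishing (nonsingularPart (FibreRing R x)) ω ∧
              (∀ s : Fin d → ℂˣ, ∀ y ∈ nonsingularPart (FibreRing R x),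
                y.comp (fibreAct R s x) ∈ nonsingularPart (FibreRing R x) ∧
                Form.pullback (fibreAct R s x) ω y = ω y) ∧
              ∀ u : Pt (TorusFibreRing R x),
                u.comp (torusFibreIncl R x) ∈ nonsingularPart (FibreRing R x) ∧
                Form.pullback (torusFibreIncl R x) ω u = (ε * C) • torusFibreForm R x z u := by
  choose V hVne hVR using hR
  have hV : AreVertices R V := fun k => ⟨hVne k, hVR k⟩
  have hG := isGorenstein_dualMonoid hV
  have hA := ringKrullDim_coordRing_le hV
  have hsharp := eq_zero_of_neg_mem_dualMonoid hV (hP ▸ hdim)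
  let b₀ := orderedCharBasis p z
  refine ⟨⟨charBasis p z, charBasis_inl z, charBasis_inr z⟩,
    ⟨volForm (dualMonoid R) (totalChar d p) b₀, hG.isRegularForm_volForm hA,
      hG.isNowhereVanishing_volForm hA⟩,
    -- The sign of a permutation depending only on d and p, fixed before Ω and x are chosen.
    ((contractionSign d p : ℤ) : ℂ), ?_, fun Ω hΩ => ?_⟩
  · rcases Int.units_eq_one_or (contractionSign d p) with h | h <;> simp [h]
  obtain ⟨C, hC, hΩC⟩ := hG.eq_smul_volForm (b₀ := b₀) hA hsharp hΩ.1 hΩ.2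
  have htorus : ∀ u, Form.pullback (torusIncl R) Ω u = C • torusForm p z u := fun u => by
    rw [← pullback_volForm_eq_torusForm hV z u]
    ext v
    exact congrArg (fun η => η fun i => pushTangent (torusIncl R) u (v i))
      (hΩC _ (hG.isNonsingular_torus u))
  have hinv : ∀ s, ∀ y, IsNonsingular y → Form.pullback (torusAct R s) Ω y = Ω y := by
    intro s y hy
    obtain ⟨L⟩ := hG.exists_localCoords_of_isNonsingular hA b₀ hy
    -- The character e = (0, 1) has no L-part, so it is trivial on T_ℂ(L).
    have h1 := L.pullback_volForm hG (torusAct R s) (charValueHom p s) (torusAct_chi s)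
      (by simp [charValueHom])
    rw [hΩC y hy, ← h1]
    ext v
    exact congrArg (fun η => η fun i => pushTangent (torusAct R s) y (v i))
      (hΩC _ (isNonsingular_torusAct s hy))
  refine ⟨C, hC, fun u => ⟨hG.isNonsingular_torus u, htorus u⟩, fun x => ?_⟩
  have hsub := fun (y : Pt (FibreRing R x)) (hy : y ∈ nonsingularPart (FibreRing R x)) =>
    submersive_of_isNonsingular hV b₀ hy
  have hlift : ∀ y ∈ nonsingularPart (FibreRing R x),
      ∃ W, AreLifts R (y.comp (fibreIncl R x)) W := fun y hy => by
    obtain ⟨W, hW⟩ := exists_isTauLift (hsub y hy).2.2.2.2.1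
    exact ⟨W, (areLifts_iff _ W).2 hW⟩
  obtain ⟨ω, hω, hreg, hnv⟩ := isFibre_fibreIncl.exists_contraction hΩ.1 hΩ.2 hsub
  have hcontr : IsContraction R Ω x ω := fun y hy W hW v =>
    hω y hy W ((areLifts_iff _ W).1 hW) v
  exact ⟨fun y hy => ⟨(hsub y hy).2.1, hlift y hy⟩, ω, hcontr, hreg, hreg.isHolomorphicForm, hnv,
    fun s y hy => ⟨isNonsingular_fibreAct s hy,
      pullback_fibreAct hcontr s hy (hlift y hy) (hinv s _ (hsub y hy).2.1)⟩,
    fun u => ⟨isNonsingular_torusFibre hV b₀ u,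
      pullback_torusFibreIncl hcontr htorus u (isNonsingular_torusFibre hV b₀ u)⟩⟩
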